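/- **Setting.** An *intercategory* has objects, transversal arrows (forming a category), horizontal arrows and vertical arrows, horizontal, vertical and basic cells, and cubes. The objects, horizontal arrows and horizontal cells, and likewise the objects, vertical arrows and vertical cells, form a weak double category whose strict direction is the transversal one. Basic cells and cubes compose strictly transversally, and horizontally and vertically up to coherent invertible special cubes. There are natural special cubes (interchangers) $$\chi:\tfrac{\alpha|\beta}{\bar\alpha|\bar\beta}\to \tfrac{\alpha}{\bar\alpha}\big|\tfrac{\beta}{\bar\beta},\qquad \mu:\tfrac{\mathrm{id}_v}{\mathrm{id}_{\bar v}}\to \mathrm{id}_{\frac{v}{\bar v}},\qquad \delta:\mathrm{Id}_{h|h'}\to \mathrm{Id}_h|\mathrm{Id}_{h'},\qquad \tau:\mathrm{Id}_{\mathrm{id}_A}\to \mathrm{id}_{\mathrm{Id}_A},$$ satisfying the twelve coherence conditions that make horizontal composition and horizontal identities lax with respect to the vertical structure and make the horizontal associativity and unit isomorphisms compatible with this laxity. Equivalently, an intercategory is a pseudocategory in the 2-category $\mathcal{C}x\mathcal{D}bl$ of weak double categories, colax double functors and their transformations. A *colax-lax* (resp. *colax-colax*) morphism of intercategories is strictly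 functorial transversally, has coherent natural special comparison cubes that are colax horizontally and lax (resp. colax) vertically, and is compatible with $\chi,\mu,\delta,\tau$. Colax-lax morphisms are the horizontal arrows and colax-colax morphisms the vertical arrows of the double category $\mathbb{P}\mathrm{sCat}(\mathcal{C}x\mathcal{D}bl)$. A double cell $RF\Rightarrow GU$ in it (with $F,G$ colax-lax on top and bottom, $U,R$ colax-colax on the left and right) assigns, naturally in the transversal direction and compatibly with boundaries, to each object, horizontal arrow, vertical arrow and basic cell a transversal arrow, horizontal cell, vertical cell and cube $RFX\to GUX$, coherently with horizontal and vertical composition and identities. Let $\mathbf V$ be a monoidal category with all small coproducts, preserved by $\otimes$ in each variable, with pullbacks and with a terminal object $1$ (hence with binary products). * $(\mathbf V,\times,\otimes)$ is regarded as an intercategory with only one object and only identity transversal, horizontal and vertical arrows and cells; its basic cells are the objects of $\mathbf V$, its cubes the morphisms of $\mathbf V$; horizontal composition is $\times$ with unit $1$, vertical composition is $\otimes$ with unit $I$; $\chi:(X\times Y)\otimes(X'\times Y')\to(X\otimes X')\times(Y\otimes Y')$ has components $p_1\otimes p_1$ and $p_2\otimes p_2$, $\mu:1\otimes1\to1$ and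 $\tau:I\to1$ are the unique morphisms, and $\delta:I\to I\times I$ is the diagonal. * $\mathsf{SM}(\mathbf V)$ has sets as objects, functions as transversal arrows, spans of sets as horizontal arrows (composed by pullback) with span morphisms as horizontal cells, and matrices $[V_{ab}]_{a\in A,b\in B}$ of objects of $\mathbf V$ as vertical arrows $A\to B$ (composed by $\sum_b V_{ab}\otimes W_{bc}$, with identity matrix $I$ on the diagonal and $0$ elsewhere) with matrices of morphisms over a pair of functions as vertical cells. Basic cells are spans of matrices $V_{\sigma_0s,\tau_0t}\leftarrow W_{st}\to V'_{\sigma_1s,\tau_1t}$ lying over two spans of sets, composed horizontally by pullback and vertically by matrix multiplication; cubes are the morphisms of spans of matrices. The interchangers $\chi$, $\delta$ are the canonical comparisons into pullbacks and $\mu$, $\tau$ are identities. * $F:\mathbf V\to\mathsf{SM}(\mathbf V)$ sends the object to the one-element set $1$, the horizontal and vertical arrow to the identity span of $1$ and to the $1\times1$ matrix $[1]$, a basic cell $V$ to the span of matrices $[1]\leftarrow[V]\to[1]$, and a morphism $f$ to the cube with middle component $[f]$; its comparisons are the canonical ones. * $G:\mathsf{SM}(\mathbf V)\to\mathbf V$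 sends a span of matrices with middle matrix $[V_{st}]_{s\in S,t\in T}$ to $\sum_{s,t}V_{st}$, with the induced action on cubes and the canonical comparisons; for instance $G(\mathrm{id}_{[U_{ab}]})=\sum_{a,b}U_{ab}\to1$ is the unique morphism and $G(\mathrm{Id}_S)\cong\sum_SI\to I$ is the codiagonal. * $\alpha: GF\Rightarrow \mathrm{id}$ has as its component at a basic cell $V$ the canonical identification of the one-fold coproduct $\sum_{1\times1}V$ with $V$. $\beta:\mathrm{id}\Rightarrow FG$ has as its component at a span of matrices with middle matrix $[V_{st}]$ the cube whose middle component is given by the coproduct injections $j_{st}:V_{st}\to\sum_{s,t}V_{st}$; all its other components are uniquely determined. **Theorem.** 1. $(\mathbf V,\times,\otimes)$ and $\mathsf{SM}(\mathbf V)$, with the structure just described, are intercategories. 2. $F$ is a colax-lax morphism of intercategories which is strong horizontally (its horizontal comparisons are invertible), and so lax vertically. It is a full inclusion: it is injective on objects, on horizontal and vertical arrows and on basic cells, and bijective on transversal arrows, horizontal cells, vertical cells and cubes with given transversal domain and codomain. 3. $G$ is a colax-colax morphism of intercategories. 4. $\alpha$ and $\beta$ are double cells of $\mathbb{P}\mathrm{sCat}(\mathcal{C}x\mathcal{D}bl)$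 of the shapes $$\begin{array}{ccc}\mathbf V&\xrightarrow{F}&\mathsf{SM}(\mathbf V)\\ \|&\alpha&\downarrow{\scriptstyle G}\\ \mathbf V&=&\mathbf V\end{array}\qquad\qquad\begin{array}{ccc}\mathsf{SM}(\mathbf V)&=&\mathsf{SM}(\mathbf V)\\ {\scriptstyle G}\downarrow&\beta&\|\\ \mathbf V&\xrightarrow{F}&\mathsf{SM}(\mathbf V)\end{array}$$ and they satisfy the triangle equalities $F\alpha\cdot\beta F=1_F$ and $\alpha G\cdot G\beta=1_G$ on all objects, horizontal and vertical arrows and basic cells. That is, $F$ and $G$ are conjoint arrows in $\mathbb{P}\mathrm{sCat}(\mathcal{C}x\mathcal{D}bl)$. 5. All components of $\alpha$ are invertible. Thus $\mathbf V$ is a reflective subintercategory of $\mathsf{SM}(\mathbf V)$. -/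

import Mathlib

open CategoryTheory Limits MonoidalCategory

universe u v w u₁ v₁ u₂ v₂ u₃ v₃ u₄ v₄
universe u₁' v₁' u₂' v₂' u₃' v₃' u₄' v₄'
universe u₁'' v₁'' u₂'' v₂'' u₃'' v₃'' u₄'' v₄''
universe u₁₃ v₁₃ u₂₃ v₂₃ u₃₃ v₃₃ u₄₃ v₄₃

namespace Intercat

/-! ## Weak double categories

A weak double category is presented by a category `O` of objects and (strict) transversal arrows,
a family `Ar A B` of weak arrows, and cells `Cell h h'`, each of which has a boundary
`dom φ : A ⟶ A'`, `cod φ : B ⟶ B'`.  Data and laws are separated. -/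

/-- The data of a weak double category over the category `O` of objects and transversal arrows. -/
structure DblData (O : Type u₁) [Category.{v₁} O] where
  /-- the weak arrows -/
  Ar : O → O → Type u₂
  /-- the cells from `h` to `h'` (with arbitrary transversal boundary) -/
  Cell : {A B A' B' : O} → Ar A B → Ar A' B' → Type v₂
  dom : {A B A' B' : O} → {h : Ar A B} → {h' : Ar A' B'} → Cell h h' → (A ⟶ A')
  cod : {A B A' B' : O} → {h : Ar A B} → {h' : Ar A' B'} → Cell h h' → (B ⟶ B')
  /-- transversal identities and composition of cells -/
  one : {A B : O} → (h : Ar A B) → Cell h h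
  comp : {A B A' B' A'' B'' : O} → {h : Ar A B} → {h' : Ar A' B'} → {h'' : Ar A'' B''} →
    Cell h h' → Cell h' h'' → Cell h h''
  /-- weak identities -/
  unit : (A : O) → Ar A A
  unitCell : {A A' : O} → (A ⟶ A') → Cell (unit A) (unit A')
  /-- weak composition, in diagrammatic order -/
  mul : {A B D : O} → Ar A B → Ar B D → Ar A D
  mulCell : {A B D A' B' D' : O} → {h : Ar A B} → {k : Ar B D} → {h' : Ar A' B'} →
    {k' : Ar B' D'} → (φ : Cell h h') → (ψ : Cell k k') → cod φ = dom ψ →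
    Cell (mul h k) (mul h' k')
  assoc : {A B D E : O} → (h : Ar A B) → (k : Ar B D) → (l : Ar D E) →
    Cell (mul (mul h k) l) (mul h (mul k l))
  lam : {A B : O} → (h : Ar A B) → Cell (mul (unit A) h) h
  rho : {A B : O} → (h : Ar A B) → Cell (mul h (unit B)) h

namespace DblData

variable {O : Type u₁} [Category.{v₁} O]

/-- Transversal invertibility of a cell. -/
def IsInv (D : DblData.{u₁, v₁, u₂, v₂} O) {A B A' B' : O} {h : D.Ar A B} {h' : D.Ar A' B'}
    (φ : D.Cell h h') : Prop :=
  ∃ ψ : D.Cell h' h, D.comp φ ψ = D.one h ∧ D.comp ψ φ = D.one h'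

/-- The laws of a weak double category. -/
structure IsDbl (D : DblData.{u₁, v₁, u₂, v₂} O) : Prop where
  dom_one : ∀ {A B : O} (h : D.Ar A B), D.dom (D.one h) = 𝟙 A
  cod_one : ∀ {A B : O} (h : D.Ar A B), D.cod (D.one h) = 𝟙 B
  dom_comp : ∀ {A B A' B' A'' B'' : O} {h : D.Ar A B} {h' : D.Ar A' B'} {h'' : D.Ar A'' B''}
    (φ : D.Cell h h') (ψ : D.Cell h' h''), D.dom (D.comp φ ψ) = D.dom φ ≫ D.dom ψ
  cod_comp : ∀ {A B A' B' A'' B'' : O} {h : D.Ar A B} {h' : D.Ar A' B'} {h'' : D.Ar A'' B''}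
    (φ : D.Cell h h') (ψ : D.Cell h' h''), D.cod (D.comp φ ψ) = D.cod φ ≫ D.cod ψ
  one_comp : ∀ {A B A' B' : O} {h : D.Ar A B} {h' : D.Ar A' B'} (φ : D.Cell h h'),
    D.comp (D.one h) φ = φ
  comp_one : ∀ {A B A' B' : O} {h : D.Ar A B} {h' : D.Ar A' B'} (φ : D.Cell h h'),
    D.comp φ (D.one h') = φ
  comp_assoc : ∀ {A B A' B' A'' B'' A₃ B₃ : O} {h : D.Ar A B} {h' : D.Ar A' B'}
    {h'' : D.Ar A'' B''} {h₃ : D.Ar A₃ B₃} (φ : D.Cell h h') (ψ : D.Cell h' h'')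
    (ω : D.Cell h'' h₃), D.comp (D.comp φ ψ) ω = D.comp φ (D.comp ψ ω)
  dom_unitCell : ∀ {A A' : O} (f : A ⟶ A'), D.dom (D.unitCell f) = f
  cod_unitCell : ∀ {A A' : O} (f : A ⟶ A'), D.cod (D.unitCell f) = f
  unitCell_id : ∀ A : O, D.unitCell (𝟙 A) = D.one (D.unit A)
  unitCell_comp : ∀ {A A' A'' : O} (f : A ⟶ A') (g : A' ⟶ A''),
    D.unitCell (f ≫ g) = D.comp (D.unitCell f) (D.unitCell g)
  dom_mulCell : ∀ {A B E A' B' E' : O} {h : D.Ar A B} {k : D.Ar B E} {h' : D.Ar A' B'}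
    {k' : D.Ar B' E'} (φ : D.Cell h h') (ψ : D.Cell k k') (e : D.cod φ = D.dom ψ),
    D.dom (D.mulCell φ ψ e) = D.dom φ
  cod_mulCell : ∀ {A B E A' B' E' : O} {h : D.Ar A B} {k : D.Ar B E} {h' : D.Ar A' B'}
    {k' : D.Ar B' E'} (φ : D.Cell h h') (ψ : D.Cell k k') (e : D.cod φ = D.dom ψ),
    D.cod (D.mulCell φ ψ e) = D.cod ψ
  mulCell_one : ∀ {A B E : O} (h : D.Ar A B) (k : D.Ar B E)
    (e : D.cod (D.one h) = D.dom (D.one k)),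
    D.mulCell (D.one h) (D.one k) e = D.one (D.mul h k)
  mulCell_comp : ∀ {A B E A' B' E' A'' B'' E'' : O} {h : D.Ar A B} {k : D.Ar B E}
    {h' : D.Ar A' B'} {k' : D.Ar B' E'} {h'' : D.Ar A'' B''} {k'' : D.Ar B'' E''}
    (φ : D.Cell h h') (φ' : D.Cell h' h'') (ψ : D.Cell k k') (ψ' : D.Cell k' k'')
    (e : D.cod φ = D.dom ψ) (e' : D.cod φ' = D.dom ψ')
    (e'' : D.cod (D.comp φ φ') = D.dom (D.comp ψ ψ')),
    D.mulCell (D.comp φ φ') (D.comp ψ ψ') e'' =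
      D.comp (D.mulCell φ ψ e) (D.mulCell φ' ψ' e')
  dom_assoc : ∀ {A B E G : O} (h : D.Ar A B) (k : D.Ar B E) (l : D.Ar E G),
    D.dom (D.assoc h k l) = 𝟙 A
  cod_assoc : ∀ {A B E G : O} (h : D.Ar A B) (k : D.Ar B E) (l : D.Ar E G),
    D.cod (D.assoc h k l) = 𝟙 G
  dom_lam : ∀ {A B : O} (h : D.Ar A B), D.dom (D.lam h) = 𝟙 A
  cod_lam : ∀ {A B : O} (h : D.Ar A B), D.cod (D.lam h) = 𝟙 B
  dom_rho : ∀ {A B : O} (h : D.Ar A B), D.dom (D.rho h) = 𝟙 A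
  cod_rho : ∀ {A B : O} (h : D.Ar A B), D.cod (D.rho h) = 𝟙 B
  assoc_inv : ∀ {A B E G : O} (h : D.Ar A B) (k : D.Ar B E) (l : D.Ar E G),
    D.IsInv (D.assoc h k l)
  lam_inv : ∀ {A B : O} (h : D.Ar A B), D.IsInv (D.lam h)
  rho_inv : ∀ {A B : O} (h : D.Ar A B), D.IsInv (D.rho h)
  assoc_nat : ∀ {A B E G A' B' E' G' : O} {h : D.Ar A B} {k : D.Ar B E} {l : D.Ar E G}
    {h' : D.Ar A' B'} {k' : D.Ar B' E'} {l' : D.Ar E' G'}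
    (φ : D.Cell h h') (ψ : D.Cell k k') (ω : D.Cell l l')
    (e₁ : D.cod φ = D.dom ψ) (e₂ : D.cod (D.mulCell φ ψ e₁) = D.dom ω)
    (e₃ : D.cod ψ = D.dom ω) (e₄ : D.cod φ = D.dom (D.mulCell ψ ω e₃)),
    D.comp (D.mulCell (D.mulCell φ ψ e₁) ω e₂) (D.assoc h' k' l') =
      D.comp (D.assoc h k l) (D.mulCell φ (D.mulCell ψ ω e₃) e₄)
  lam_nat : ∀ {A B A' B' : O} {h : D.Ar A B} {h' : D.Ar A' B'} (φ : D.Cell h h')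
    (e : D.cod (D.unitCell (D.dom φ)) = D.dom φ),
    D.comp (D.mulCell (D.unitCell (D.dom φ)) φ e) (D.lam h') = D.comp (D.lam h) φ
  rho_nat : ∀ {A B A' B' : O} {h : D.Ar A B} {h' : D.Ar A' B'} (φ : D.Cell h h')
    (e : D.cod φ = D.dom (D.unitCell (D.cod φ))),
    D.comp (D.mulCell φ (D.unitCell (D.cod φ)) e) (D.rho h') = D.comp (D.rho h) φ
  pentagon : ∀ {A B E G K : O} (h : D.Ar A B) (k : D.Ar B E) (l : D.Ar E G) (m : D.Ar G K)
    (e₁ : D.cod (D.assoc h k l) = D.dom (D.one m))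
    (e₂ : D.cod (D.one h) = D.dom (D.assoc k l m)),
    D.comp (D.mulCell (D.assoc h k l) (D.one m) e₁)
        (D.comp (D.assoc h (D.mul k l) m) (D.mulCell (D.one h) (D.assoc k l m) e₂)) =
      D.comp (D.assoc (D.mul h k) l m) (D.assoc h k (D.mul l m))
  triangle : ∀ {A B E : O} (h : D.Ar A B) (k : D.Ar B E)
    (e₁ : D.cod (D.one h) = D.dom (D.lam k)) (e₂ : D.cod (D.rho h) = D.dom (D.one k)),
    D.comp (D.assoc h (D.unit B) k) (D.mulCell (D.one h) (D.lam k) e₁) =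
      D.mulCell (D.rho h) (D.one k) e₂

end DblData

/-! ## Basic cells and cubes -/

section Squares

variable {O : Type u₁} [Category.{v₁} O]

/-- Basic cells and cubes over two weak double categories `H` (horizontal) and `V` (vertical) with
the same objects and transversal arrows.  A cube goes transversally from a basic cell to a basic
cell, and has a top, a bottom, a left and a right face. -/
structure SqData (H : DblData.{u₁, v₁, u₂, v₂} O) (V : DblData.{u₁, v₁, u₃, v₃} O) where
  Sq : {A B A₁ B₁ : O} → H.Ar A B → H.Ar A₁ B₁ → V.Ar A A₁ → V.Ar B B₁ → Type u₄
  Cube : {A B A₁ B₁ A' B' A₁' B₁' : O} → {h : H.Ar A B} → {k : H.Ar A₁ B₁} → {x : V.Ar A A₁} →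
    {y : V.Ar B B₁} → {h' : H.Ar A' B'} → {k' : H.Ar A₁' B₁'} → {x' : V.Ar A' A₁'} →
    {y' : V.Ar B' B₁'} → Sq h k x y → Sq h' k' x' y' → Type v₄
  top : {A B A₁ B₁ A' B' A₁' B₁' : O} → {h : H.Ar A B} → {k : H.Ar A₁ B₁} → {x : V.Ar A A₁} →
    {y : V.Ar B B₁} → {h' : H.Ar A' B'} → {k' : H.Ar A₁' B₁'} → {x' : V.Ar A' A₁'} →
    {y' : V.Ar B' B₁'} → {α : Sq h k x y} → {α' : Sq h' k' x' y'} → Cube α α' → H.Cell h h'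
  bot : {A B A₁ B₁ A' B' A₁' B₁' : O} → {h : H.Ar A B} → {k : H.Ar A₁ B₁} → {x : V.Ar A A₁} →
    {y : V.Ar B B₁} → {h' : H.Ar A' B'} → {k' : H.Ar A₁' B₁'} → {x' : V.Ar A' A₁'} →
    {y' : V.Ar B' B₁'} → {α : Sq h k x y} → {α' : Sq h' k' x' y'} → Cube α α' → H.Cell k k'
  left : {A B A₁ B₁ A' B' A₁' B₁' : O} → {h : H.Ar A B} → {k : H.Ar A₁ B₁} → {x : V.Ar A A₁} →
    {y : V.Ar B B₁} → {h' : H.Ar A' B'} → {k' : H.Ar A₁' B₁'} → {x' : V.Ar A' A₁'} →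
    {y' : V.Ar B' B₁'} → {α : Sq h k x y} → {α' : Sq h' k' x' y'} → Cube α α' → V.Cell x x'
  right : {A B A₁ B₁ A' B' A₁' B₁' : O} → {h : H.Ar A B} → {k : H.Ar A₁ B₁} → {x : V.Ar A A₁} →
    {y : V.Ar B B₁} → {h' : H.Ar A' B'} → {k' : H.Ar A₁' B₁'} → {x' : V.Ar A' A₁'} →
    {y' : V.Ar B' B₁'} → {α : Sq h k x y} → {α' : Sq h' k' x' y'} → Cube α α' → V.Cell y y'
  one : {A B A₁ B₁ : O} → {h : H.Ar A B} → {k : H.Ar A₁ B₁} → {x : V.Ar A A₁} →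
    {y : V.Ar B B₁} → (α : Sq h k x y) → Cube α α
  comp : {A B A₁ B₁ A' B' A₁' B₁' A'' B'' A₁'' B₁'' : O} → {h : H.Ar A B} → {k : H.Ar A₁ B₁} →
    {x : V.Ar A A₁} → {y : V.Ar B B₁} → {h' : H.Ar A' B'} → {k' : H.Ar A₁' B₁'} →
    {x' : V.Ar A' A₁'} → {y' : V.Ar B' B₁'} → {h'' : H.Ar A'' B''} → {k'' : H.Ar A₁'' B₁''} →
    {x'' : V.Ar A'' A₁''} → {y'' : V.Ar B'' B₁''} → {α : Sq h k x y} → {α' : Sq h' k' x' y'} →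
    {α'' : Sq h'' k'' x'' y''} → Cube α α' → Cube α' α'' → Cube α α''

variable {H : DblData.{u₁, v₁, u₂, v₂} O} {V : DblData.{u₁, v₁, u₃, v₃} O}

/-- Exchange of the horizontal and the vertical direction. -/
@[reducible] def SqData.transpose (S : SqData.{u₁, v₁, u₂, v₂, u₃, v₃, u₄, v₄} H V) :
    SqData.{u₁, v₁, u₃, v₃, u₂, v₂, u₄, v₄} V H where
  Sq x y h k := S.Sq h k x y
  Cube α α' := S.Cube α α'
  top Φ := S.left Φ
  bot Φ := S.right Φ
  left Φ := S.top Φ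
  right Φ := S.bot Φ
  one α := S.one α
  comp Φ Ψ := S.comp Φ Ψ

section

variable (S : SqData.{u₁, v₁, u₂, v₂, u₃, v₃, u₄, v₄} H V)

/-- Transversal invertibility of a cube. -/
def SqData.IsInv {A B A₁ B₁ A' B' A₁' B₁' : O} {h : H.Ar A B} {k : H.Ar A₁ B₁}
    {x : V.Ar A A₁} {y : V.Ar B B₁} {h' : H.Ar A' B'} {k' : H.Ar A₁' B₁'} {x' : V.Ar A' A₁'}
    {y' : V.Ar B' B₁'} {α : S.Sq h k x y} {α' : S.Sq h' k' x' y'} (Φ : S.Cube α α') : Prop :=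
  ∃ Ψ : S.Cube α' α, S.comp Φ Ψ = S.one α ∧ S.comp Ψ Φ = S.one α'

/-- A special cube: its horizontal and vertical faces are transversal identities. -/
structure SqData.IsSpecial {A B A₁ B₁ : O} {h : H.Ar A B} {k : H.Ar A₁ B₁}
    {x : V.Ar A A₁} {y : V.Ar B B₁} {α α' : S.Sq h k x y} (Φ : S.Cube α α') : Prop where
  top : S.top Φ = H.one h
  bot : S.bot Φ = H.one k
  left : S.left Φ = V.one x
  right : S.right Φ = V.one y

/-- Basic cells and cubes form a category under transversal composition, the faces are functorial
and fit together along the transversal edges of a cube. -/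
structure IsSq : Prop where
  corner_tl : ∀ {A B A₁ B₁ A' B' A₁' B₁' : O} {h : H.Ar A B} {k : H.Ar A₁ B₁} {x : V.Ar A A₁}
    {y : V.Ar B B₁} {h' : H.Ar A' B'} {k' : H.Ar A₁' B₁'} {x' : V.Ar A' A₁'} {y' : V.Ar B' B₁'}
    {α : S.Sq h k x y} {α' : S.Sq h' k' x' y'} (Φ : S.Cube α α'),
    H.dom (S.top Φ) = V.dom (S.left Φ)
  corner_tr : ∀ {A B A₁ B₁ A' B' A₁' B₁' : O} {h : H.Ar A B} {k : H.Ar A₁ B₁} {x : V.Ar A A₁}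
    {y : V.Ar B B₁} {h' : H.Ar A' B'} {k' : H.Ar A₁' B₁'} {x' : V.Ar A' A₁'} {y' : V.Ar B' B₁'}
    {α : S.Sq h k x y} {α' : S.Sq h' k' x' y'} (Φ : S.Cube α α'),
    H.cod (S.top Φ) = V.dom (S.right Φ)
  corner_bl : ∀ {A B A₁ B₁ A' B' A₁' B₁' : O} {h : H.Ar A B} {k : H.Ar A₁ B₁} {x : V.Ar A A₁}
    {y : V.Ar B B₁} {h' : H.Ar A' B'} {k' : H.Ar A₁' B₁'} {x' : V.Ar A' A₁'} {y' : V.Ar B' B₁'}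
    {α : S.Sq h k x y} {α' : S.Sq h' k' x' y'} (Φ : S.Cube α α'),
    H.dom (S.bot Φ) = V.cod (S.left Φ)
  corner_br : ∀ {A B A₁ B₁ A' B' A₁' B₁' : O} {h : H.Ar A B} {k : H.Ar A₁ B₁} {x : V.Ar A A₁}
    {y : V.Ar B B₁} {h' : H.Ar A' B'} {k' : H.Ar A₁' B₁'} {x' : V.Ar A' A₁'} {y' : V.Ar B' B₁'}
    {α : S.Sq h k x y} {α' : S.Sq h' k' x' y'} (Φ : S.Cube α α'),
    H.cod (S.bot Φ) = V.cod (S.right Φ)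
  one_special : ∀ {A B A₁ B₁ : O} {h : H.Ar A B} {k : H.Ar A₁ B₁} {x : V.Ar A A₁}
    {y : V.Ar B B₁} (α : S.Sq h k x y), S.IsSpecial (S.one α)
  faces_comp : ∀ {A B A₁ B₁ A' B' A₁' B₁' A'' B'' A₁'' B₁'' : O} {h : H.Ar A B}
    {k : H.Ar A₁ B₁} {x : V.Ar A A₁} {y : V.Ar B B₁} {h' : H.Ar A' B'} {k' : H.Ar A₁' B₁'}
    {x' : V.Ar A' A₁'} {y' : V.Ar B' B₁'} {h'' : H.Ar A'' B''} {k'' : H.Ar A₁'' B₁''}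
    {x'' : V.Ar A'' A₁''} {y'' : V.Ar B'' B₁''} {α : S.Sq h k x y} {α' : S.Sq h' k' x' y'}
    {α'' : S.Sq h'' k'' x'' y''} (Φ : S.Cube α α') (Ψ : S.Cube α' α''),
    S.top (S.comp Φ Ψ) = H.comp (S.top Φ) (S.top Ψ) ∧
    S.bot (S.comp Φ Ψ) = H.comp (S.bot Φ) (S.bot Ψ) ∧
    S.left (S.comp Φ Ψ) = V.comp (S.left Φ) (S.left Ψ) ∧
    S.right (S.comp Φ Ψ) = V.comp (S.right Φ) (S.right Ψ)
  one_comp : ∀ {A B A₁ B₁ A' B' A₁' B₁' : O} {h : H.Ar A B} {k : H.Ar A₁ B₁} {x : V.Ar A A₁}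
    {y : V.Ar B B₁} {h' : H.Ar A' B'} {k' : H.Ar A₁' B₁'} {x' : V.Ar A' A₁'} {y' : V.Ar B' B₁'}
    {α : S.Sq h k x y} {α' : S.Sq h' k' x' y'} (Φ : S.Cube α α'), S.comp (S.one α) Φ = Φ
  comp_one : ∀ {A B A₁ B₁ A' B' A₁' B₁' : O} {h : H.Ar A B} {k : H.Ar A₁ B₁} {x : V.Ar A A₁}
    {y : V.Ar B B₁} {h' : H.Ar A' B'} {k' : H.Ar A₁' B₁'} {x' : V.Ar A' A₁'} {y' : V.Ar B' B₁'}
    {α : S.Sq h k x y} {α' : S.Sq h' k' x' y'} (Φ : S.Cube α α'), S.comp Φ (S.one α') = Φ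
  comp_assoc : ∀ {A B A₁ B₁ A' B' A₁' B₁' A'' B'' A₁'' B₁'' A₃ B₃ A₁₃ B₁₃ : O} {h : H.Ar A B}
    {k : H.Ar A₁ B₁} {x : V.Ar A A₁} {y : V.Ar B B₁} {h' : H.Ar A' B'} {k' : H.Ar A₁' B₁'}
    {x' : V.Ar A' A₁'} {y' : V.Ar B' B₁'} {h'' : H.Ar A'' B''} {k'' : H.Ar A₁'' B₁''}
    {x'' : V.Ar A'' A₁''} {y'' : V.Ar B'' B₁''} {h₃ : H.Ar A₃ B₃} {k₃ : H.Ar A₁₃ B₁₃}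
    {x₃ : V.Ar A₃ A₁₃} {y₃ : V.Ar B₃ B₁₃} {α : S.Sq h k x y} {α' : S.Sq h' k' x' y'}
    {α'' : S.Sq h'' k'' x'' y''} {α₃ : S.Sq h₃ k₃ x₃ y₃}
    (Φ : S.Cube α α') (Ψ : S.Cube α' α'') (Ω : S.Cube α'' α₃),
    S.comp (S.comp Φ Ψ) Ω = S.comp Φ (S.comp Ψ Ω)

end

/-- The data of horizontal composition of basic cells and cubes (for the vertical one, apply this
to `S.transpose`). -/
structure HStr (S : SqData.{u₁, v₁, u₂, v₂, u₃, v₃, u₄, v₄} H V) where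
  unit : {A A₁ : O} → (x : V.Ar A A₁) → S.Sq (H.unit A) (H.unit A₁) x x
  unitCube : {A A₁ A' A₁' : O} → {x : V.Ar A A₁} → {x' : V.Ar A' A₁'} → V.Cell x x' →
    S.Cube (unit x) (unit x')
  mul : {A B E A₁ B₁ E₁ : O} → {h : H.Ar A B} → {k : H.Ar B E} → {h₁ : H.Ar A₁ B₁} →
    {k₁ : H.Ar B₁ E₁} → {x : V.Ar A A₁} → {y : V.Ar B B₁} → {z : V.Ar E E₁} →
    S.Sq h h₁ x y → S.Sq k k₁ y z → S.Sq (H.mul h k) (H.mul h₁ k₁) x z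
  mulCube : {A B E A₁ B₁ E₁ A' B' E' A₁' B₁' E₁' : O} → {h : H.Ar A B} → {k : H.Ar B E} →
    {h₁ : H.Ar A₁ B₁} → {k₁ : H.Ar B₁ E₁} → {x : V.Ar A A₁} → {y : V.Ar B B₁} →
    {z : V.Ar E E₁} → {h' : H.Ar A' B'} → {k' : H.Ar B' E'} →
    {h₁' : H.Ar A₁' B₁'} → {k₁' : H.Ar B₁' E₁'} → {x' : V.Ar A' A₁'} → {y' : V.Ar B' B₁'} →
    {z' : V.Ar E' E₁'} → {α : S.Sq h h₁ x y} → {β : S.Sq k k₁ y z} → {α' : S.Sq h' h₁' x' y'} →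
    {β' : S.Sq k' k₁' y' z'} → (Φ : S.Cube α α') → (Ψ : S.Cube β β') →
    S.right Φ = S.left Ψ → S.Cube (mul α β) (mul α' β')
  assoc : {A B E G A₁ B₁ E₁ G₁ : O} → {h : H.Ar A B} → {k : H.Ar B E} → {l : H.Ar E G} →
    {h₁ : H.Ar A₁ B₁} → {k₁ : H.Ar B₁ E₁} → {l₁ : H.Ar E₁ G₁} → {x : V.Ar A A₁} →
    {y : V.Ar B B₁} → {z : V.Ar E E₁} → {t : V.Ar G G₁} →
    (α : S.Sq h h₁ x y) → (β : S.Sq k k₁ y z) → (γ : S.Sq l l₁ z t) →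
    S.Cube (mul (mul α β) γ) (mul α (mul β γ))
  lam : {A B A₁ B₁ : O} → {h : H.Ar A B} → {h₁ : H.Ar A₁ B₁} → {x : V.Ar A A₁} →
    {y : V.Ar B B₁} → (α : S.Sq h h₁ x y) → S.Cube (mul (unit x) α) α
  rho : {A B A₁ B₁ : O} → {h : H.Ar A B} → {h₁ : H.Ar A₁ B₁} → {x : V.Ar A A₁} →
    {y : V.Ar B B₁} → (α : S.Sq h h₁ x y) → S.Cube (mul α (unit y)) α

/-- The laws of horizontal composition: the vertical arrows and cells, the basic cells and the
cubes form a weak double category, for which the top and bottom faces are strict double functors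
to `H`. -/
structure IsHStr {S : SqData.{u₁, v₁, u₂, v₂, u₃, v₃, u₄, v₄} H V} (T : HStr S) : Prop where
  faces_unitCube : ∀ {A A₁ A' A₁' : O} {x : V.Ar A A₁} {x' : V.Ar A' A₁'} (φ : V.Cell x x'),
    S.top (T.unitCube φ) = H.unitCell (V.dom φ) ∧
    S.bot (T.unitCube φ) = H.unitCell (V.cod φ) ∧
    S.left (T.unitCube φ) = φ ∧ S.right (T.unitCube φ) = φ
  unitCube_one : ∀ {A A₁ : O} (x : V.Ar A A₁), T.unitCube (V.one x) = S.one (T.unit x)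
  unitCube_comp : ∀ {A A₁ A' A₁' A'' A₁'' : O} {x : V.Ar A A₁} {x' : V.Ar A' A₁'}
    {x'' : V.Ar A'' A₁''} (φ : V.Cell x x') (ψ : V.Cell x' x''),
    T.unitCube (V.comp φ ψ) = S.comp (T.unitCube φ) (T.unitCube ψ)
  faces_mulCube : ∀ {A B E A₁ B₁ E₁ A' B' E' A₁' B₁' E₁' : O} {h : H.Ar A B} {k : H.Ar B E}
    {h₁ : H.Ar A₁ B₁} {k₁ : H.Ar B₁ E₁} {x : V.Ar A A₁} {y : V.Ar B B₁} {z : V.Ar E E₁}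
    {h' : H.Ar A' B'} {k' : H.Ar B' E'} {h₁' : H.Ar A₁' B₁'} {k₁' : H.Ar B₁' E₁'}
    {x' : V.Ar A' A₁'} {y' : V.Ar B' B₁'} {z' : V.Ar E' E₁'} {α : S.Sq h h₁ x y}
    {β : S.Sq k k₁ y z} {α' : S.Sq h' h₁' x' y'} {β' : S.Sq k' k₁' y' z'}
    (Φ : S.Cube α α') (Ψ : S.Cube β β') (e : S.right Φ = S.left Ψ)
    (e₁ : H.cod (S.top Φ) = H.dom (S.top Ψ)) (e₂ : H.cod (S.bot Φ) = H.dom (S.bot Ψ)),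
    S.top (T.mulCube Φ Ψ e) = H.mulCell (S.top Φ) (S.top Ψ) e₁ ∧
    S.bot (T.mulCube Φ Ψ e) = H.mulCell (S.bot Φ) (S.bot Ψ) e₂ ∧
    S.left (T.mulCube Φ Ψ e) = S.left Φ ∧ S.right (T.mulCube Φ Ψ e) = S.right Ψ
  mulCube_one : ∀ {A B E A₁ B₁ E₁ : O} {h : H.Ar A B} {k : H.Ar B E}
    {h₁ : H.Ar A₁ B₁} {k₁ : H.Ar B₁ E₁} {x : V.Ar A A₁} {y : V.Ar B B₁} {z : V.Ar E E₁}
    (α : S.Sq h h₁ x y) (β : S.Sq k k₁ y z) (e : S.right (S.one α) = S.left (S.one β)),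
    T.mulCube (S.one α) (S.one β) e = S.one (T.mul α β)
  mulCube_comp : ∀ {A B E A₁ B₁ E₁ A' B' E' A₁' B₁' E₁' A'' B'' E'' A₁'' B₁'' E₁'' : O}
    {h : H.Ar A B} {k : H.Ar B E}
    {h₁ : H.Ar A₁ B₁} {k₁ : H.Ar B₁ E₁} {x : V.Ar A A₁} {y : V.Ar B B₁} {z : V.Ar E E₁}
    {h' : H.Ar A' B'} {k' : H.Ar B' E'} {h₁' : H.Ar A₁' B₁'} {k₁' : H.Ar B₁' E₁'}
    {x' : V.Ar A' A₁'} {y' : V.Ar B' B₁'} {z' : V.Ar E' E₁'}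
    {h'' : H.Ar A'' B''} {k'' : H.Ar B'' E''} {h₁'' : H.Ar A₁'' B₁''} {k₁'' : H.Ar B₁'' E₁''}
    {x'' : V.Ar A'' A₁''} {y'' : V.Ar B'' B₁''} {z'' : V.Ar E'' E₁''} {α : S.Sq h h₁ x y}
    {β : S.Sq k k₁ y z} {α' : S.Sq h' h₁' x' y'} {β' : S.Sq k' k₁' y' z'}
    {α'' : S.Sq h'' h₁'' x'' y''} {β'' : S.Sq k'' k₁'' y'' z''}
    (Φ : S.Cube α α') (Φ' : S.Cube α' α'') (Ψ : S.Cube β β') (Ψ' : S.Cube β' β'')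
    (e : S.right Φ = S.left Ψ) (e' : S.right Φ' = S.left Ψ')
    (e'' : S.right (S.comp Φ Φ') = S.left (S.comp Ψ Ψ')),
    T.mulCube (S.comp Φ Φ') (S.comp Ψ Ψ') e'' =
      S.comp (T.mulCube Φ Ψ e) (T.mulCube Φ' Ψ' e')
  faces_assoc : ∀ {A B E G A₁ B₁ E₁ G₁ : O} {h : H.Ar A B} {k : H.Ar B E} {l : H.Ar E G}
    {h₁ : H.Ar A₁ B₁} {k₁ : H.Ar B₁ E₁} {l₁ : H.Ar E₁ G₁} {x : V.Ar A A₁}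
    {y : V.Ar B B₁} {z : V.Ar E E₁} {t : V.Ar G G₁}
    (α : S.Sq h h₁ x y) (β : S.Sq k k₁ y z) (γ : S.Sq l l₁ z t),
    S.top (T.assoc α β γ) = H.assoc h k l ∧ S.bot (T.assoc α β γ) = H.assoc h₁ k₁ l₁ ∧
    S.left (T.assoc α β γ) = V.one x ∧ S.right (T.assoc α β γ) = V.one t
  faces_lam : ∀ {A B A₁ B₁ : O} {h : H.Ar A B} {h₁ : H.Ar A₁ B₁} {x : V.Ar A A₁}
    {y : V.Ar B B₁} (α : S.Sq h h₁ x y),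
    S.top (T.lam α) = H.lam h ∧ S.bot (T.lam α) = H.lam h₁ ∧
    S.left (T.lam α) = V.one x ∧ S.right (T.lam α) = V.one y
  faces_rho : ∀ {A B A₁ B₁ : O} {h : H.Ar A B} {h₁ : H.Ar A₁ B₁} {x : V.Ar A A₁}
    {y : V.Ar B B₁} (α : S.Sq h h₁ x y),
    S.top (T.rho α) = H.rho h ∧ S.bot (T.rho α) = H.rho h₁ ∧
    S.left (T.rho α) = V.one x ∧ S.right (T.rho α) = V.one y
  assoc_inv : ∀ {A B E G A₁ B₁ E₁ G₁ : O} {h : H.Ar A B} {k : H.Ar B E} {l : H.Ar E G}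
    {h₁ : H.Ar A₁ B₁} {k₁ : H.Ar B₁ E₁} {l₁ : H.Ar E₁ G₁} {x : V.Ar A A₁}
    {y : V.Ar B B₁} {z : V.Ar E E₁} {t : V.Ar G G₁}
    (α : S.Sq h h₁ x y) (β : S.Sq k k₁ y z) (γ : S.Sq l l₁ z t), S.IsInv (T.assoc α β γ)
  lam_inv : ∀ {A B A₁ B₁ : O} {h : H.Ar A B} {h₁ : H.Ar A₁ B₁} {x : V.Ar A A₁}
    {y : V.Ar B B₁} (α : S.Sq h h₁ x y), S.IsInv (T.lam α)
  rho_inv : ∀ {A B A₁ B₁ : O} {h : H.Ar A B} {h₁ : H.Ar A₁ B₁} {x : V.Ar A A₁}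
    {y : V.Ar B B₁} (α : S.Sq h h₁ x y), S.IsInv (T.rho α)
  assoc_nat : ∀ {A B E G A₁ B₁ E₁ G₁ A' B' E' G' A₁' B₁' E₁' G₁' : O}
    {h : H.Ar A B} {k : H.Ar B E} {l : H.Ar E G}
    {h₁ : H.Ar A₁ B₁} {k₁ : H.Ar B₁ E₁} {l₁ : H.Ar E₁ G₁} {x : V.Ar A A₁}
    {y : V.Ar B B₁} {z : V.Ar E E₁} {t : V.Ar G G₁}
    {h' : H.Ar A' B'} {k' : H.Ar B' E'} {l' : H.Ar E' G'}
    {h₁' : H.Ar A₁' B₁'} {k₁' : H.Ar B₁' E₁'} {l₁' : H.Ar E₁' G₁'} {x' : V.Ar A' A₁'}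
    {y' : V.Ar B' B₁'} {z' : V.Ar E' E₁'} {t' : V.Ar G' G₁'}
    {α : S.Sq h h₁ x y} {β : S.Sq k k₁ y z} {γ : S.Sq l l₁ z t}
    {α' : S.Sq h' h₁' x' y'} {β' : S.Sq k' k₁' y' z'} {γ' : S.Sq l' l₁' z' t'}
    (Φ : S.Cube α α') (Ψ : S.Cube β β') (Ω : S.Cube γ γ')
    (e₁ : S.right Φ = S.left Ψ) (e₂ : S.right (T.mulCube Φ Ψ e₁) = S.left Ω)
    (e₃ : S.right Ψ = S.left Ω) (e₄ : S.right Φ = S.left (T.mulCube Ψ Ω e₃)),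
    S.comp (T.mulCube (T.mulCube Φ Ψ e₁) Ω e₂) (T.assoc α' β' γ') =
      S.comp (T.assoc α β γ) (T.mulCube Φ (T.mulCube Ψ Ω e₃) e₄)
  lam_nat : ∀ {A B A₁ B₁ A' B' A₁' B₁' : O} {h : H.Ar A B} {k : H.Ar A₁ B₁} {x : V.Ar A A₁}
    {y : V.Ar B B₁} {h' : H.Ar A' B'} {k' : H.Ar A₁' B₁'} {x' : V.Ar A' A₁'} {y' : V.Ar B' B₁'}
    {α : S.Sq h k x y} {α' : S.Sq h' k' x' y'} (Φ : S.Cube α α')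
    (e : S.right (T.unitCube (S.left Φ)) = S.left Φ),
    S.comp (T.mulCube (T.unitCube (S.left Φ)) Φ e) (T.lam α') = S.comp (T.lam α) Φ
  rho_nat : ∀ {A B A₁ B₁ A' B' A₁' B₁' : O} {h : H.Ar A B} {k : H.Ar A₁ B₁} {x : V.Ar A A₁}
    {y : V.Ar B B₁} {h' : H.Ar A' B'} {k' : H.Ar A₁' B₁'} {x' : V.Ar A' A₁'} {y' : V.Ar B' B₁'}
    {α : S.Sq h k x y} {α' : S.Sq h' k' x' y'} (Φ : S.Cube α α')
    (e : S.right Φ = S.left (T.unitCube (S.right Φ))),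
    S.comp (T.mulCube Φ (T.unitCube (S.right Φ)) e) (T.rho α') = S.comp (T.rho α) Φ
  pentagon : ∀ {A B E G K A₁ B₁ E₁ G₁ K₁ : O} {h : H.Ar A B} {k : H.Ar B E} {l : H.Ar E G}
    {m : H.Ar G K} {h₁ : H.Ar A₁ B₁} {k₁ : H.Ar B₁ E₁} {l₁ : H.Ar E₁ G₁} {m₁ : H.Ar G₁ K₁}
    {x : V.Ar A A₁} {y : V.Ar B B₁} {z : V.Ar E E₁} {t : V.Ar G G₁} {s : V.Ar K K₁}
    (α : S.Sq h h₁ x y) (β : S.Sq k k₁ y z) (γ : S.Sq l l₁ z t) (δ : S.Sq m m₁ t s)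
    (e₁ : S.right (T.assoc α β γ) = S.left (S.one δ))
    (e₂ : S.right (S.one α) = S.left (T.assoc β γ δ)),
    S.comp (T.mulCube (T.assoc α β γ) (S.one δ) e₁)
        (S.comp (T.assoc α (T.mul β γ) δ) (T.mulCube (S.one α) (T.assoc β γ δ) e₂)) =
      S.comp (T.assoc (T.mul α β) γ δ) (T.assoc α β (T.mul γ δ))
  triangle : ∀ {A B E A₁ B₁ E₁ : O} {h : H.Ar A B} {k : H.Ar B E}
    {h₁ : H.Ar A₁ B₁} {k₁ : H.Ar B₁ E₁} {x : V.Ar A A₁} {y : V.Ar B B₁} {z : V.Ar E E₁}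
    (α : S.Sq h h₁ x y) (β : S.Sq k k₁ y z)
    (e₁ : S.right (S.one α) = S.left (T.lam β)) (e₂ : S.right (T.rho α) = S.left (S.one β)),
    S.comp (T.assoc α (T.unit y) β) (T.mulCube (S.one α) (T.lam β) e₁) =
      T.mulCube (T.rho α) (S.one β) e₂

end Squares

/-! ## Intercategories -/

/-- The data of an intercategory: a horizontal and a vertical weak double category with the same
objects and transversal arrows, basic cells and cubes with horizontal composition `hs` and vertical
composition `vs`, and the interchangers `χ`, `μ`, `δ`, `τ`. -/
structure InterData where
  O : Type u₁
  [cat : Category.{v₁} O]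
  H : DblData.{u₁, v₁, u₂, v₂} O
  V : DblData.{u₁, v₁, u₃, v₃} O
  S : SqData.{u₁, v₁, u₂, v₂, u₃, v₃, u₄, v₄} H V
  hs : HStr S
  vs : HStr S.transpose
  chi : {A B E A₁ B₁ E₁ A₂ B₂ E₂ : O} → {h : H.Ar A B} → {k : H.Ar B E} → {h₁ : H.Ar A₁ B₁} →
    {k₁ : H.Ar B₁ E₁} → {h₂ : H.Ar A₂ B₂} → {k₂ : H.Ar B₂ E₂} →
    {x : V.Ar A A₁} → {y : V.Ar B B₁} → {z : V.Ar E E₁} →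
    {x₁ : V.Ar A₁ A₂} → {y₁ : V.Ar B₁ B₂} → {z₁ : V.Ar E₁ E₂} →
    (α : S.Sq h h₁ x y) → (β : S.Sq k k₁ y z) →
    (α₁ : S.Sq h₁ h₂ x₁ y₁) → (β₁ : S.Sq k₁ k₂ y₁ z₁) →
    S.Cube (vs.mul (hs.mul α β) (hs.mul α₁ β₁)) (hs.mul (vs.mul α α₁) (vs.mul β β₁))
  mu : {A A₁ A₂ : O} → (x : V.Ar A A₁) → (y : V.Ar A₁ A₂) →
    S.Cube (vs.mul (hs.unit x) (hs.unit y)) (hs.unit (V.mul x y))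
  delta : {A B E : O} → (h : H.Ar A B) → (k : H.Ar B E) →
    S.Cube (vs.unit (H.mul h k)) (hs.mul (vs.unit h) (vs.unit k))
  tau : (A : O) → S.Cube (vs.unit (H.unit A)) (hs.unit (V.unit A))

attribute [instance] InterData.cat

/-- The laws of an intercategory: four weak double categories fitting together, special and natural
interchangers, and the twelve coherence conditions saying that horizontal composition (with `χ`,
`δ`) and the horizontal identity (with `μ`, `τ`) are lax functors for the vertical structure and
that the horizontal associativity and unit isomorphisms are compatible with this laxity. -/
structure InterData.IsIntercategory
    (I : InterData.{u₁, v₁, u₂, v₂, u₃, v₃, u₄, v₄}) : Prop where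
  isDblH : I.H.IsDbl
  isDblV : I.V.IsDbl
  isSq : IsSq I.S
  isHStr : IsHStr I.hs
  isVStr : IsHStr I.vs
  chi_special : ∀ {A B E A₁ B₁ E₁ A₂ B₂ E₂ : I.O} {h : I.H.Ar A B} {k : I.H.Ar B E}
    {h₁ : I.H.Ar A₁ B₁} {k₁ : I.H.Ar B₁ E₁} {h₂ : I.H.Ar A₂ B₂} {k₂ : I.H.Ar B₂ E₂}
    {x : I.V.Ar A A₁} {y : I.V.Ar B B₁} {z : I.V.Ar E E₁} {x₁ : I.V.Ar A₁ A₂}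
    {y₁ : I.V.Ar B₁ B₂} {z₁ : I.V.Ar E₁ E₂} (α : I.S.Sq h h₁ x y) (β : I.S.Sq k k₁ y z)
    (α₁ : I.S.Sq h₁ h₂ x₁ y₁) (β₁ : I.S.Sq k₁ k₂ y₁ z₁), I.S.IsSpecial (I.chi α β α₁ β₁)
  mu_special : ∀ {A A₁ A₂ : I.O} (x : I.V.Ar A A₁) (y : I.V.Ar A₁ A₂), I.S.IsSpecial (I.mu x y)
  delta_special : ∀ {A B E : I.O} (h : I.H.Ar A B) (k : I.H.Ar B E), I.S.IsSpecial (I.delta h k)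
  tau_special : ∀ A : I.O, I.S.IsSpecial (I.tau A)
  chi_nat : ∀ {A B E A₁ B₁ E₁ A₂ B₂ E₂ A' B' E' A₁' B₁' E₁' A₂' B₂' E₂' : I.O}
    {h : I.H.Ar A B} {k : I.H.Ar B E}
    {h₁ : I.H.Ar A₁ B₁} {k₁ : I.H.Ar B₁ E₁} {h₂ : I.H.Ar A₂ B₂} {k₂ : I.H.Ar B₂ E₂}
    {x : I.V.Ar A A₁} {y : I.V.Ar B B₁} {z : I.V.Ar E E₁} {x₁ : I.V.Ar A₁ A₂}
    {y₁ : I.V.Ar B₁ B₂} {z₁ : I.V.Ar E₁ E₂}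
    {h' : I.H.Ar A' B'} {k' : I.H.Ar B' E'}
    {h₁' : I.H.Ar A₁' B₁'} {k₁' : I.H.Ar B₁' E₁'} {h₂' : I.H.Ar A₂' B₂'} {k₂' : I.H.Ar B₂' E₂'}
    {x' : I.V.Ar A' A₁'} {y' : I.V.Ar B' B₁'} {z' : I.V.Ar E' E₁'} {x₁' : I.V.Ar A₁' A₂'}
    {y₁' : I.V.Ar B₁' B₂'} {z₁' : I.V.Ar E₁' E₂'}
    {α : I.S.Sq h h₁ x y} {β : I.S.Sq k k₁ y z}
    {α₁ : I.S.Sq h₁ h₂ x₁ y₁} {β₁ : I.S.Sq k₁ k₂ y₁ z₁}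
    {α' : I.S.Sq h' h₁' x' y'} {β' : I.S.Sq k' k₁' y' z'}
    {α₁' : I.S.Sq h₁' h₂' x₁' y₁'} {β₁' : I.S.Sq k₁' k₂' y₁' z₁'}
    (Φ : I.S.Cube α α') (Ψ : I.S.Cube β β') (Φ₁ : I.S.Cube α₁ α₁') (Ψ₁ : I.S.Cube β₁ β₁')
    (e₁ : I.S.right Φ = I.S.left Ψ) (e₂ : I.S.right Φ₁ = I.S.left Ψ₁)
    (e₃ : I.S.bot (I.hs.mulCube Φ Ψ e₁) = I.S.top (I.hs.mulCube Φ₁ Ψ₁ e₂))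
    (e₄ : I.S.bot Φ = I.S.top Φ₁) (e₅ : I.S.bot Ψ = I.S.top Ψ₁)
    (e₆ : I.S.right (I.vs.mulCube Φ Φ₁ e₄) = I.S.left (I.vs.mulCube Ψ Ψ₁ e₅)),
    I.S.comp (I.vs.mulCube (I.hs.mulCube Φ Ψ e₁) (I.hs.mulCube Φ₁ Ψ₁ e₂) e₃)
        (I.chi α' β' α₁' β₁') =
      I.S.comp (I.chi α β α₁ β₁)
        (I.hs.mulCube (I.vs.mulCube Φ Φ₁ e₄) (I.vs.mulCube Ψ Ψ₁ e₅) e₆)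
  mu_nat : ∀ {A A₁ A₂ A' A₁' A₂' : I.O} {x : I.V.Ar A A₁} {y : I.V.Ar A₁ A₂}
    {x' : I.V.Ar A' A₁'} {y' : I.V.Ar A₁' A₂'} (φ : I.V.Cell x x') (ψ : I.V.Cell y y')
    (e₁ : I.S.bot (I.hs.unitCube φ) = I.S.top (I.hs.unitCube ψ))
    (e₂ : I.V.cod φ = I.V.dom ψ),
    I.S.comp (I.vs.mulCube (I.hs.unitCube φ) (I.hs.unitCube ψ) e₁) (I.mu x' y') =
      I.S.comp (I.mu x y) (I.hs.unitCube (I.V.mulCell φ ψ e₂))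
  delta_nat : ∀ {A B E A' B' E' : I.O} {h : I.H.Ar A B} {k : I.H.Ar B E}
    {h' : I.H.Ar A' B'} {k' : I.H.Ar B' E'} (φ : I.H.Cell h h') (ψ : I.H.Cell k k')
    (e₁ : I.S.right (I.vs.unitCube φ) = I.S.left (I.vs.unitCube ψ))
    (e₂ : I.H.cod φ = I.H.dom ψ),
    I.S.comp (I.vs.unitCube (I.H.mulCell φ ψ e₂)) (I.delta h' k') =
      I.S.comp (I.delta h k) (I.hs.mulCube (I.vs.unitCube φ) (I.vs.unitCube ψ) e₁)
  tau_nat : ∀ {A A' : I.O} (f : A ⟶ A'),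
    I.S.comp (I.vs.unitCube (I.H.unitCell f)) (I.tau A') =
      I.S.comp (I.tau A) (I.hs.unitCube (I.V.unitCell f))
  chi_vassoc : ∀ {A B E A₁ B₁ E₁ A₂ B₂ E₂ A₃ B₃ E₃ : I.O} {h : I.H.Ar A B} {k : I.H.Ar B E}
    {h₁ : I.H.Ar A₁ B₁} {k₁ : I.H.Ar B₁ E₁} {h₂ : I.H.Ar A₂ B₂} {k₂ : I.H.Ar B₂ E₂}
    {h₃ : I.H.Ar A₃ B₃} {k₃ : I.H.Ar B₃ E₃}
    {x : I.V.Ar A A₁} {y : I.V.Ar B B₁} {z : I.V.Ar E E₁} {x₁ : I.V.Ar A₁ A₂}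
    {y₁ : I.V.Ar B₁ B₂} {z₁ : I.V.Ar E₁ E₂} {x₂ : I.V.Ar A₂ A₃}
    {y₂ : I.V.Ar B₂ B₃} {z₂ : I.V.Ar E₂ E₃} (α : I.S.Sq h h₁ x y) (β : I.S.Sq k k₁ y z)
    (α₁ : I.S.Sq h₁ h₂ x₁ y₁) (β₁ : I.S.Sq k₁ k₂ y₁ z₁)
    (α₂ : I.S.Sq h₂ h₃ x₂ y₂) (β₂ : I.S.Sq k₂ k₃ y₂ z₂)
    (e₁ : I.S.bot (I.chi α β α₁ β₁) = I.S.top (I.S.one (I.hs.mul α₂ β₂)))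
    (e₂ : I.S.right (I.vs.assoc α α₁ α₂) = I.S.left (I.vs.assoc β β₁ β₂))
    (e₃ : I.S.bot (I.S.one (I.hs.mul α β)) = I.S.top (I.chi α₁ β₁ α₂ β₂)),
    I.S.comp (I.vs.mulCube (I.chi α β α₁ β₁) (I.S.one (I.hs.mul α₂ β₂)) e₁)
        (I.S.comp (I.chi (I.vs.mul α α₁) (I.vs.mul β β₁) α₂ β₂)
          (I.hs.mulCube (I.vs.assoc α α₁ α₂) (I.vs.assoc β β₁ β₂) e₂)) =
      I.S.comp (I.vs.assoc (I.hs.mul α β) (I.hs.mul α₁ β₁) (I.hs.mul α₂ β₂))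
        (I.S.comp (I.vs.mulCube (I.S.one (I.hs.mul α β)) (I.chi α₁ β₁ α₂ β₂) e₃)
          (I.chi α β (I.vs.mul α₁ α₂) (I.vs.mul β₁ β₂)))
  chi_vlam : ∀ {A B E A₁ B₁ E₁ : I.O} {h : I.H.Ar A B} {k : I.H.Ar B E}
    {h₁ : I.H.Ar A₁ B₁} {k₁ : I.H.Ar B₁ E₁}
    {x : I.V.Ar A A₁} {y : I.V.Ar B B₁} {z : I.V.Ar E E₁}
    (α : I.S.Sq h h₁ x y) (β : I.S.Sq k k₁ y z)
    (e₁ : I.S.bot (I.delta h k) = I.S.top (I.S.one (I.hs.mul α β)))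
    (e₂ : I.S.right (I.vs.lam α) = I.S.left (I.vs.lam β)),
    I.S.comp (I.vs.mulCube (I.delta h k) (I.S.one (I.hs.mul α β)) e₁)
        (I.S.comp (I.chi (I.vs.unit h) (I.vs.unit k) α β)
          (I.hs.mulCube (I.vs.lam α) (I.vs.lam β) e₂)) =
      I.vs.lam (I.hs.mul α β)
  chi_vrho : ∀ {A B E A₁ B₁ E₁ : I.O} {h : I.H.Ar A B} {k : I.H.Ar B E}
    {h₁ : I.H.Ar A₁ B₁} {k₁ : I.H.Ar B₁ E₁}
    {x : I.V.Ar A A₁} {y : I.V.Ar B B₁} {z : I.V.Ar E E₁}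
    (α : I.S.Sq h h₁ x y) (β : I.S.Sq k k₁ y z)
    (e₁ : I.S.bot (I.S.one (I.hs.mul α β)) = I.S.top (I.delta h₁ k₁))
    (e₂ : I.S.right (I.vs.rho α) = I.S.left (I.vs.rho β)),
    I.S.comp (I.vs.mulCube (I.S.one (I.hs.mul α β)) (I.delta h₁ k₁) e₁)
        (I.S.comp (I.chi α β (I.vs.unit h₁) (I.vs.unit k₁))
          (I.hs.mulCube (I.vs.rho α) (I.vs.rho β) e₂)) =
      I.vs.rho (I.hs.mul α β)
  mu_vassoc : ∀ {A A₁ A₂ A₃ : I.O} (x : I.V.Ar A A₁) (y : I.V.Ar A₁ A₂) (z : I.V.Ar A₂ A₃)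
    (e₁ : I.S.bot (I.mu x y) = I.S.top (I.S.one (I.hs.unit z)))
    (e₂ : I.S.bot (I.S.one (I.hs.unit x)) = I.S.top (I.mu y z)),
    I.S.comp (I.vs.mulCube (I.mu x y) (I.S.one (I.hs.unit z)) e₁)
        (I.S.comp (I.mu (I.V.mul x y) z) (I.hs.unitCube (I.V.assoc x y z))) =
      I.S.comp (I.vs.assoc (I.hs.unit x) (I.hs.unit y) (I.hs.unit z))
        (I.S.comp (I.vs.mulCube (I.S.one (I.hs.unit x)) (I.mu y z) e₂)
          (I.mu x (I.V.mul y z)))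
  mu_vlam : ∀ {A A₁ : I.O} (x : I.V.Ar A A₁)
    (e : I.S.bot (I.tau A) = I.S.top (I.S.one (I.hs.unit x))),
    I.S.comp (I.vs.mulCube (I.tau A) (I.S.one (I.hs.unit x)) e)
        (I.S.comp (I.mu (I.V.unit A) x) (I.hs.unitCube (I.V.lam x))) =
      I.vs.lam (I.hs.unit x)
  mu_vrho : ∀ {A A₁ : I.O} (x : I.V.Ar A A₁)
    (e : I.S.bot (I.S.one (I.hs.unit x)) = I.S.top (I.tau A₁)),
    I.S.comp (I.vs.mulCube (I.S.one (I.hs.unit x)) (I.tau A₁) e)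
        (I.S.comp (I.mu x (I.V.unit A₁)) (I.hs.unitCube (I.V.rho x))) =
      I.vs.rho (I.hs.unit x)
  chi_hassoc : ∀ {A B E G A₁ B₁ E₁ G₁ A₂ B₂ E₂ G₂ : I.O}
    {h : I.H.Ar A B} {k : I.H.Ar B E} {l : I.H.Ar E G}
    {h₁ : I.H.Ar A₁ B₁} {k₁ : I.H.Ar B₁ E₁} {l₁ : I.H.Ar E₁ G₁}
    {h₂ : I.H.Ar A₂ B₂} {k₂ : I.H.Ar B₂ E₂} {l₂ : I.H.Ar E₂ G₂}
    {x : I.V.Ar A A₁} {y : I.V.Ar B B₁} {z : I.V.Ar E E₁} {t : I.V.Ar G G₁}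
    {x₁ : I.V.Ar A₁ A₂} {y₁ : I.V.Ar B₁ B₂} {z₁ : I.V.Ar E₁ E₂} {t₁ : I.V.Ar G₁ G₂}
    (α : I.S.Sq h h₁ x y) (β : I.S.Sq k k₁ y z) (γ : I.S.Sq l l₁ z t)
    (α₁ : I.S.Sq h₁ h₂ x₁ y₁) (β₁ : I.S.Sq k₁ k₂ y₁ z₁) (γ₁ : I.S.Sq l₁ l₂ z₁ t₁)
    (e₁ : I.S.right (I.chi α β α₁ β₁) = I.S.left (I.S.one (I.vs.mul γ γ₁)))
    (e₂ : I.S.bot (I.hs.assoc α β γ) = I.S.top (I.hs.assoc α₁ β₁ γ₁))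
    (e₃ : I.S.right (I.S.one (I.vs.mul α α₁)) = I.S.left (I.chi β γ β₁ γ₁)),
    I.S.comp (I.chi (I.hs.mul α β) γ (I.hs.mul α₁ β₁) γ₁)
        (I.S.comp (I.hs.mulCube (I.chi α β α₁ β₁) (I.S.one (I.vs.mul γ γ₁)) e₁)
          (I.hs.assoc (I.vs.mul α α₁) (I.vs.mul β β₁) (I.vs.mul γ γ₁))) =
      I.S.comp (I.vs.mulCube (I.hs.assoc α β γ) (I.hs.assoc α₁ β₁ γ₁) e₂)
        (I.S.comp (I.chi α (I.hs.mul β γ) α₁ (I.hs.mul β₁ γ₁))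
          (I.hs.mulCube (I.S.one (I.vs.mul α α₁)) (I.chi β γ β₁ γ₁) e₃))
  delta_hassoc : ∀ {A B E G : I.O} (h : I.H.Ar A B) (k : I.H.Ar B E) (l : I.H.Ar E G)
    (e₁ : I.S.right (I.delta h k) = I.S.left (I.S.one (I.vs.unit l)))
    (e₂ : I.S.right (I.S.one (I.vs.unit h)) = I.S.left (I.delta k l)),
    I.S.comp (I.delta (I.H.mul h k) l)
        (I.S.comp (I.hs.mulCube (I.delta h k) (I.S.one (I.vs.unit l)) e₁)
          (I.hs.assoc (I.vs.unit h) (I.vs.unit k) (I.vs.unit l))) =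
      I.S.comp (I.vs.unitCube (I.H.assoc h k l))
        (I.S.comp (I.delta h (I.H.mul k l))
          (I.hs.mulCube (I.S.one (I.vs.unit h)) (I.delta k l) e₂))
  chi_hlam : ∀ {A B A₁ B₁ A₂ B₂ : I.O} {h : I.H.Ar A B} {h₁ : I.H.Ar A₁ B₁} {h₂ : I.H.Ar A₂ B₂}
    {x : I.V.Ar A A₁} {y : I.V.Ar B B₁} {x₁ : I.V.Ar A₁ A₂} {y₁ : I.V.Ar B₁ B₂}
    (α : I.S.Sq h h₁ x y) (α₁ : I.S.Sq h₁ h₂ x₁ y₁)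
    (e₁ : I.S.right (I.mu x x₁) = I.S.left (I.S.one (I.vs.mul α α₁)))
    (e₂ : I.S.bot (I.hs.lam α) = I.S.top (I.hs.lam α₁)),
    I.S.comp (I.chi (I.hs.unit x) α (I.hs.unit x₁) α₁)
        (I.S.comp (I.hs.mulCube (I.mu x x₁) (I.S.one (I.vs.mul α α₁)) e₁)
          (I.hs.lam (I.vs.mul α α₁))) =
      I.vs.mulCube (I.hs.lam α) (I.hs.lam α₁) e₂
  delta_hlam : ∀ {A B : I.O} (h : I.H.Ar A B)
    (e : I.S.right (I.tau A) = I.S.left (I.S.one (I.vs.unit h))),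
    I.S.comp (I.delta (I.H.unit A) h)
        (I.S.comp (I.hs.mulCube (I.tau A) (I.S.one (I.vs.unit h)) e)
          (I.hs.lam (I.vs.unit h))) =
      I.vs.unitCube (I.H.lam h)
  chi_hrho : ∀ {A B A₁ B₁ A₂ B₂ : I.O} {h : I.H.Ar A B} {h₁ : I.H.Ar A₁ B₁} {h₂ : I.H.Ar A₂ B₂}
    {x : I.V.Ar A A₁} {y : I.V.Ar B B₁} {x₁ : I.V.Ar A₁ A₂} {y₁ : I.V.Ar B₁ B₂}
    (α : I.S.Sq h h₁ x y) (α₁ : I.S.Sq h₁ h₂ x₁ y₁)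
    (e₁ : I.S.right (I.S.one (I.vs.mul α α₁)) = I.S.left (I.mu y y₁))
    (e₂ : I.S.bot (I.hs.rho α) = I.S.top (I.hs.rho α₁)),
    I.S.comp (I.chi α (I.hs.unit y) α₁ (I.hs.unit y₁))
        (I.S.comp (I.hs.mulCube (I.S.one (I.vs.mul α α₁)) (I.mu y y₁) e₁)
          (I.hs.rho (I.vs.mul α α₁))) =
      I.vs.mulCube (I.hs.rho α) (I.hs.rho α₁) e₂
  delta_hrho : ∀ {A B : I.O} (h : I.H.Ar A B)
    (e : I.S.right (I.S.one (I.vs.unit h)) = I.S.left (I.tau B)),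
    I.S.comp (I.delta h (I.H.unit B))
        (I.S.comp (I.hs.mulCube (I.S.one (I.vs.unit h)) (I.tau B) e)
          (I.hs.rho (I.vs.unit h))) =
      I.vs.unitCube (I.H.rho h)

/-! ## Morphisms of weak double categories -/

section Maps

variable {O : Type u₁} [Category.{v₁} O] {O' : Type u₁'} [Category.{v₁'} O']

/-- A map on weak arrows and cells, over a functor `T` on objects and transversal arrows. -/
structure ArMap (D : DblData.{u₁, v₁, u₂, v₂} O) (D' : DblData.{u₁', v₁', u₂', v₂'} O')
    (T : O ⥤ O') where
  ar : {A B : O} → D.Ar A B → D'.Ar (T.obj A) (T.obj B)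
  cell : {A B A' B' : O} → {h : D.Ar A B} → {h' : D.Ar A' B'} → D.Cell h h' →
    D'.Cell (ar h) (ar h')

variable {D : DblData.{u₁, v₁, u₂, v₂} O} {D' : DblData.{u₁', v₁', u₂', v₂'} O'} {T : O ⥤ O'}

/-- Functoriality on cells, compatibly with boundaries. -/
structure IsArMap (m : ArMap D D' T) : Prop where
  dom_cell : ∀ {A B A' B' : O} {h : D.Ar A B} {h' : D.Ar A' B'} (φ : D.Cell h h'),
    D'.dom (m.cell φ) = T.map (D.dom φ)
  cod_cell : ∀ {A B A' B' : O} {h : D.Ar A B} {h' : D.Ar A' B'} (φ : D.Cell h h'),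
    D'.cod (m.cell φ) = T.map (D.cod φ)
  cell_one : ∀ {A B : O} (h : D.Ar A B), m.cell (D.one h) = D'.one (m.ar h)
  cell_comp : ∀ {A B A' B' A'' B'' : O} {h : D.Ar A B} {h' : D.Ar A' B'} {h'' : D.Ar A'' B''}
    (φ : D.Cell h h') (ψ : D.Cell h' h''),
    m.cell (D.comp φ ψ) = D'.comp (m.cell φ) (m.cell ψ)

/-- Colax comparison cells for weak composition and weak identities. -/
structure ColaxData (m : ArMap D D' T) where
  mul : {A B E : O} → (h : D.Ar A B) → (k : D.Ar B E) →
    D'.Cell (m.ar (D.mul h k)) (D'.mul (m.ar h) (m.ar k))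
  unit : (A : O) → D'.Cell (m.ar (D.unit A)) (D'.unit (T.obj A))

/-- The laws of a colax double functor (for a map satisfying `IsArMap`). -/
structure IsColax {m : ArMap D D' T} (c : ColaxData m) : Prop where
  dom_mul : ∀ {A B E : O} (h : D.Ar A B) (k : D.Ar B E), D'.dom (c.mul h k) = 𝟙 (T.obj A)
  cod_mul : ∀ {A B E : O} (h : D.Ar A B) (k : D.Ar B E), D'.cod (c.mul h k) = 𝟙 (T.obj E)
  dom_unit : ∀ A : O, D'.dom (c.unit A) = 𝟙 (T.obj A)
  cod_unit : ∀ A : O, D'.cod (c.unit A) = 𝟙 (T.obj A)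
  mul_nat : ∀ {A B E A' B' E' : O} {h : D.Ar A B} {k : D.Ar B E} {h' : D.Ar A' B'}
    {k' : D.Ar B' E'} (φ : D.Cell h h') (ψ : D.Cell k k') (e : D.cod φ = D.dom ψ)
    (e' : D'.cod (m.cell φ) = D'.dom (m.cell ψ)),
    D'.comp (m.cell (D.mulCell φ ψ e)) (c.mul h' k') =
      D'.comp (c.mul h k) (D'.mulCell (m.cell φ) (m.cell ψ) e')
  unit_nat : ∀ {A A' : O} (f : A ⟶ A'),
    D'.comp (m.cell (D.unitCell f)) (c.unit A') = D'.comp (c.unit A) (D'.unitCell (T.map f))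
  assoc : ∀ {A B E G : O} (h : D.Ar A B) (k : D.Ar B E) (l : D.Ar E G)
    (e₁ : D'.cod (c.mul h k) = D'.dom (D'.one (m.ar l)))
    (e₂ : D'.cod (D'.one (m.ar h)) = D'.dom (c.mul k l)),
    D'.comp (c.mul (D.mul h k) l)
        (D'.comp (D'.mulCell (c.mul h k) (D'.one (m.ar l)) e₁)
          (D'.assoc (m.ar h) (m.ar k) (m.ar l))) =
      D'.comp (m.cell (D.assoc h k l))
        (D'.comp (c.mul h (D.mul k l)) (D'.mulCell (D'.one (m.ar h)) (c.mul k l) e₂))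
  lam : ∀ {A B : O} (h : D.Ar A B) (e : D'.cod (c.unit A) = D'.dom (D'.one (m.ar h))),
    D'.comp (c.mul (D.unit A) h)
        (D'.comp (D'.mulCell (c.unit A) (D'.one (m.ar h)) e) (D'.lam (m.ar h))) =
      m.cell (D.lam h)
  rho : ∀ {A B : O} (h : D.Ar A B) (e : D'.cod (D'.one (m.ar h)) = D'.dom (c.unit B)),
    D'.comp (c.mul h (D.unit B))
        (D'.comp (D'.mulCell (D'.one (m.ar h)) (c.unit B) e) (D'.rho (m.ar h))) =
      m.cell (D.rho h)

/-- Lax comparison cells for weak composition and weak identities. -/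
structure LaxData (m : ArMap D D' T) where
  mul : {A B E : O} → (h : D.Ar A B) → (k : D.Ar B E) →
    D'.Cell (D'.mul (m.ar h) (m.ar k)) (m.ar (D.mul h k))
  unit : (A : O) → D'.Cell (D'.unit (T.obj A)) (m.ar (D.unit A))

/-- The laws of a lax double functor (for a map satisfying `IsArMap`). -/
structure IsLax {m : ArMap D D' T} (c : LaxData m) : Prop where
  dom_mul : ∀ {A B E : O} (h : D.Ar A B) (k : D.Ar B E), D'.dom (c.mul h k) = 𝟙 (T.obj A)
  cod_mul : ∀ {A B E : O} (h : D.Ar A B) (k : D.Ar B E), D'.cod (c.mul h k) = 𝟙 (T.obj E)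
  dom_unit : ∀ A : O, D'.dom (c.unit A) = 𝟙 (T.obj A)
  cod_unit : ∀ A : O, D'.cod (c.unit A) = 𝟙 (T.obj A)
  mul_nat : ∀ {A B E A' B' E' : O} {h : D.Ar A B} {k : D.Ar B E} {h' : D.Ar A' B'}
    {k' : D.Ar B' E'} (φ : D.Cell h h') (ψ : D.Cell k k') (e : D.cod φ = D.dom ψ)
    (e' : D'.cod (m.cell φ) = D'.dom (m.cell ψ)),
    D'.comp (D'.mulCell (m.cell φ) (m.cell ψ) e') (c.mul h' k') =
      D'.comp (c.mul h k) (m.cell (D.mulCell φ ψ e))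
  unit_nat : ∀ {A A' : O} (f : A ⟶ A'),
    D'.comp (D'.unitCell (T.map f)) (c.unit A') = D'.comp (c.unit A) (m.cell (D.unitCell f))
  assoc : ∀ {A B E G : O} (h : D.Ar A B) (k : D.Ar B E) (l : D.Ar E G)
    (e₁ : D'.cod (c.mul h k) = D'.dom (D'.one (m.ar l)))
    (e₂ : D'.cod (D'.one (m.ar h)) = D'.dom (c.mul k l)),
    D'.comp (D'.mulCell (c.mul h k) (D'.one (m.ar l)) e₁)
        (D'.comp (c.mul (D.mul h k) l) (m.cell (D.assoc h k l))) =
      D'.comp (D'.assoc (m.ar h) (m.ar k) (m.ar l))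
        (D'.comp (D'.mulCell (D'.one (m.ar h)) (c.mul k l) e₂) (c.mul h (D.mul k l)))
  lam : ∀ {A B : O} (h : D.Ar A B) (e : D'.cod (c.unit A) = D'.dom (D'.one (m.ar h))),
    D'.comp (D'.mulCell (c.unit A) (D'.one (m.ar h)) e)
        (D'.comp (c.mul (D.unit A) h) (m.cell (D.lam h))) =
      D'.lam (m.ar h)
  rho : ∀ {A B : O} (h : D.Ar A B) (e : D'.cod (D'.one (m.ar h)) = D'.dom (c.unit B)),
    D'.comp (D'.mulCell (D'.one (m.ar h)) (c.unit B) e)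
        (D'.comp (c.mul h (D.unit B)) (m.cell (D.rho h))) =
      D'.rho (m.ar h)

variable {H : DblData.{u₁, v₁, u₂, v₂} O} {V : DblData.{u₁, v₁, u₃, v₃} O}
  {H' : DblData.{u₁', v₁', u₂', v₂'} O'} {V' : DblData.{u₁', v₁', u₃', v₃'} O'}

/-- A map on basic cells and cubes. -/
structure SqMap (S : SqData.{u₁, v₁, u₂, v₂, u₃, v₃, u₄, v₄} H V)
    (S' : SqData.{u₁', v₁', u₂', v₂', u₃', v₃', u₄', v₄'} H' V')
    (mH : ArMap H H' T) (mV : ArMap V V' T) where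
  sq : {A B A₁ B₁ : O} → {h : H.Ar A B} → {k : H.Ar A₁ B₁} → {x : V.Ar A A₁} →
    {y : V.Ar B B₁} → S.Sq h k x y → S'.Sq (mH.ar h) (mH.ar k) (mV.ar x) (mV.ar y)
  cube : {A B A₁ B₁ A' B' A₁' B₁' : O} → {h : H.Ar A B} → {k : H.Ar A₁ B₁} → {x : V.Ar A A₁} →
    {y : V.Ar B B₁} → {h' : H.Ar A' B'} → {k' : H.Ar A₁' B₁'} → {x' : V.Ar A' A₁'} →
    {y' : V.Ar B' B₁'} → {α : S.Sq h k x y} → {α' : S.Sq h' k' x' y'} → S.Cube α α' →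
    S'.Cube (sq α) (sq α')

variable {S : SqData.{u₁, v₁, u₂, v₂, u₃, v₃, u₄, v₄} H V}
  {S' : SqData.{u₁', v₁', u₂', v₂', u₃', v₃', u₄', v₄'} H' V'}
  {mH : ArMap H H' T} {mV : ArMap V V' T}

@[reducible] def SqMap.transpose (m : SqMap S S' mH mV) :
    SqMap S.transpose S'.transpose mV mH where
  sq α := m.sq α
  cube Φ := m.cube Φ

/-- Functoriality on cubes, compatibly with faces. -/
structure IsSqMap (m : SqMap S S' mH mV) : Prop where
  faces_cube : ∀ {A B A₁ B₁ A' B' A₁' B₁' : O} {h : H.Ar A B} {k : H.Ar A₁ B₁} {x : V.Ar A A₁}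
    {y : V.Ar B B₁} {h' : H.Ar A' B'} {k' : H.Ar A₁' B₁'} {x' : V.Ar A' A₁'} {y' : V.Ar B' B₁'}
    {α : S.Sq h k x y} {α' : S.Sq h' k' x' y'} (Φ : S.Cube α α'),
    S'.top (m.cube Φ) = mH.cell (S.top Φ) ∧ S'.bot (m.cube Φ) = mH.cell (S.bot Φ) ∧
    S'.left (m.cube Φ) = mV.cell (S.left Φ) ∧ S'.right (m.cube Φ) = mV.cell (S.right Φ)
  cube_one : ∀ {A B A₁ B₁ : O} {h : H.Ar A B} {k : H.Ar A₁ B₁} {x : V.Ar A A₁}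
    {y : V.Ar B B₁} (α : S.Sq h k x y), m.cube (S.one α) = S'.one (m.sq α)
  cube_comp : ∀ {A B A₁ B₁ A' B' A₁' B₁' A'' B'' A₁'' B₁'' : O} {h : H.Ar A B}
    {k : H.Ar A₁ B₁} {x : V.Ar A A₁} {y : V.Ar B B₁} {h' : H.Ar A' B'} {k' : H.Ar A₁' B₁'}
    {x' : V.Ar A' A₁'} {y' : V.Ar B' B₁'} {h'' : H.Ar A'' B''} {k'' : H.Ar A₁'' B₁''}
    {x'' : V.Ar A'' A₁''} {y'' : V.Ar B'' B₁''} {α : S.Sq h k x y} {α' : S.Sq h' k' x' y'}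
    {α'' : S.Sq h'' k'' x'' y''} (Φ : S.Cube α α') (Ψ : S.Cube α' α''),
    m.cube (S.comp Φ Ψ) = S'.comp (m.cube Φ) (m.cube Ψ)

/-- Colax comparison cubes for (horizontal) composition. -/
structure SqColax (m : SqMap S S' mH mV) (P : HStr S) (P' : HStr S')
    (c : ColaxData mH) where
  mul : {A B E A₁ B₁ E₁ : O} → {h : H.Ar A B} → {k : H.Ar B E} → {h₁ : H.Ar A₁ B₁} →
    {k₁ : H.Ar B₁ E₁} → {x : V.Ar A A₁} → {y : V.Ar B B₁} → {z : V.Ar E E₁} →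
    (α : S.Sq h h₁ x y) → (β : S.Sq k k₁ y z) →
    S'.Cube (m.sq (P.mul α β)) (P'.mul (m.sq α) (m.sq β))
  unit : {A A₁ : O} → (x : V.Ar A A₁) → S'.Cube (m.sq (P.unit x)) (P'.unit (mV.ar x))

/-- The laws of a colax double functor on the level of basic cells and cubes, lying over the
colax structure `c` on the level of arrows. -/
structure IsSqColax {m : SqMap S S' mH mV} {P : HStr S} {P' : HStr S'} {c : ColaxData mH}
    (s : SqColax m P P' c) : Prop where
  faces_mul : ∀ {A B E A₁ B₁ E₁ : O} {h : H.Ar A B} {k : H.Ar B E} {h₁ : H.Ar A₁ B₁}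
    {k₁ : H.Ar B₁ E₁} {x : V.Ar A A₁} {y : V.Ar B B₁} {z : V.Ar E E₁}
    (α : S.Sq h h₁ x y) (β : S.Sq k k₁ y z),
    S'.top (s.mul α β) = c.mul h k ∧ S'.bot (s.mul α β) = c.mul h₁ k₁ ∧
    S'.left (s.mul α β) = V'.one (mV.ar x) ∧ S'.right (s.mul α β) = V'.one (mV.ar z)
  faces_unit : ∀ {A A₁ : O} (x : V.Ar A A₁),
    S'.top (s.unit x) = c.unit A ∧ S'.bot (s.unit x) = c.unit A₁ ∧
    S'.left (s.unit x) = V'.one (mV.ar x) ∧ S'.right (s.unit x) = V'.one (mV.ar x)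
  mul_nat : ∀ {A B E A₁ B₁ E₁ A' B' E' A₁' B₁' E₁' : O} {h : H.Ar A B} {k : H.Ar B E}
    {h₁ : H.Ar A₁ B₁} {k₁ : H.Ar B₁ E₁} {x : V.Ar A A₁} {y : V.Ar B B₁} {z : V.Ar E E₁}
    {h' : H.Ar A' B'} {k' : H.Ar B' E'} {h₁' : H.Ar A₁' B₁'} {k₁' : H.Ar B₁' E₁'}
    {x' : V.Ar A' A₁'} {y' : V.Ar B' B₁'} {z' : V.Ar E' E₁'} {α : S.Sq h h₁ x y}
    {β : S.Sq k k₁ y z} {α' : S.Sq h' h₁' x' y'} {β' : S.Sq k' k₁' y' z'}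
    (Φ : S.Cube α α') (Ψ : S.Cube β β') (e : S.right Φ = S.left Ψ)
    (e' : S'.right (m.cube Φ) = S'.left (m.cube Ψ)),
    S'.comp (m.cube (P.mulCube Φ Ψ e)) (s.mul α' β') =
      S'.comp (s.mul α β) (P'.mulCube (m.cube Φ) (m.cube Ψ) e')
  unit_nat : ∀ {A A₁ A' A₁' : O} {x : V.Ar A A₁} {x' : V.Ar A' A₁'} (φ : V.Cell x x'),
    S'.comp (m.cube (P.unitCube φ)) (s.unit x') =
      S'.comp (s.unit x) (P'.unitCube (mV.cell φ))
  assoc : ∀ {A B E G A₁ B₁ E₁ G₁ : O} {h : H.Ar A B} {k : H.Ar B E} {l : H.Ar E G}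
    {h₁ : H.Ar A₁ B₁} {k₁ : H.Ar B₁ E₁} {l₁ : H.Ar E₁ G₁} {x : V.Ar A A₁}
    {y : V.Ar B B₁} {z : V.Ar E E₁} {t : V.Ar G G₁}
    (α : S.Sq h h₁ x y) (β : S.Sq k k₁ y z) (γ : S.Sq l l₁ z t)
    (e₁ : S'.right (s.mul α β) = S'.left (S'.one (m.sq γ)))
    (e₂ : S'.right (S'.one (m.sq α)) = S'.left (s.mul β γ)),
    S'.comp (s.mul (P.mul α β) γ)
        (S'.comp (P'.mulCube (s.mul α β) (S'.one (m.sq γ)) e₁)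
          (P'.assoc (m.sq α) (m.sq β) (m.sq γ))) =
      S'.comp (m.cube (P.assoc α β γ))
        (S'.comp (s.mul α (P.mul β γ)) (P'.mulCube (S'.one (m.sq α)) (s.mul β γ) e₂))
  lam : ∀ {A B A₁ B₁ : O} {h : H.Ar A B} {h₁ : H.Ar A₁ B₁} {x : V.Ar A A₁}
    {y : V.Ar B B₁} (α : S.Sq h h₁ x y) (e : S'.right (s.unit x) = S'.left (S'.one (m.sq α))),
    S'.comp (s.mul (P.unit x) α)
        (S'.comp (P'.mulCube (s.unit x) (S'.one (m.sq α)) e) (P'.lam (m.sq α))) =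
      m.cube (P.lam α)
  rho : ∀ {A B A₁ B₁ : O} {h : H.Ar A B} {h₁ : H.Ar A₁ B₁} {x : V.Ar A A₁}
    {y : V.Ar B B₁} (α : S.Sq h h₁ x y) (e : S'.right (S'.one (m.sq α)) = S'.left (s.unit y)),
    S'.comp (s.mul α (P.unit y))
        (S'.comp (P'.mulCube (S'.one (m.sq α)) (s.unit y) e) (P'.rho (m.sq α))) =
      m.cube (P.rho α)

/-- Lax comparison cubes for (horizontal) composition. -/
structure SqLax (m : SqMap S S' mH mV) (P : HStr S) (P' : HStr S')
    (c : LaxData mH) where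
  mul : {A B E A₁ B₁ E₁ : O} → {h : H.Ar A B} → {k : H.Ar B E} → {h₁ : H.Ar A₁ B₁} →
    {k₁ : H.Ar B₁ E₁} → {x : V.Ar A A₁} → {y : V.Ar B B₁} → {z : V.Ar E E₁} →
    (α : S.Sq h h₁ x y) → (β : S.Sq k k₁ y z) →
    S'.Cube (P'.mul (m.sq α) (m.sq β)) (m.sq (P.mul α β))
  unit : {A A₁ : O} → (x : V.Ar A A₁) → S'.Cube (P'.unit (mV.ar x)) (m.sq (P.unit x))

/-- The laws of a lax double functor on the level of basic cells and cubes, lying over the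
lax structure `c` on the level of arrows. -/
structure IsSqLax {m : SqMap S S' mH mV} {P : HStr S} {P' : HStr S'} {c : LaxData mH}
    (s : SqLax m P P' c) : Prop where
  faces_mul : ∀ {A B E A₁ B₁ E₁ : O} {h : H.Ar A B} {k : H.Ar B E} {h₁ : H.Ar A₁ B₁}
    {k₁ : H.Ar B₁ E₁} {x : V.Ar A A₁} {y : V.Ar B B₁} {z : V.Ar E E₁}
    (α : S.Sq h h₁ x y) (β : S.Sq k k₁ y z),
    S'.top (s.mul α β) = c.mul h k ∧ S'.bot (s.mul α β) = c.mul h₁ k₁ ∧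
    S'.left (s.mul α β) = V'.one (mV.ar x) ∧ S'.right (s.mul α β) = V'.one (mV.ar z)
  faces_unit : ∀ {A A₁ : O} (x : V.Ar A A₁),
    S'.top (s.unit x) = c.unit A ∧ S'.bot (s.unit x) = c.unit A₁ ∧
    S'.left (s.unit x) = V'.one (mV.ar x) ∧ S'.right (s.unit x) = V'.one (mV.ar x)
  mul_nat : ∀ {A B E A₁ B₁ E₁ A' B' E' A₁' B₁' E₁' : O} {h : H.Ar A B} {k : H.Ar B E}
    {h₁ : H.Ar A₁ B₁} {k₁ : H.Ar B₁ E₁} {x : V.Ar A A₁} {y : V.Ar B B₁} {z : V.Ar E E₁}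
    {h' : H.Ar A' B'} {k' : H.Ar B' E'} {h₁' : H.Ar A₁' B₁'} {k₁' : H.Ar B₁' E₁'}
    {x' : V.Ar A' A₁'} {y' : V.Ar B' B₁'} {z' : V.Ar E' E₁'} {α : S.Sq h h₁ x y}
    {β : S.Sq k k₁ y z} {α' : S.Sq h' h₁' x' y'} {β' : S.Sq k' k₁' y' z'}
    (Φ : S.Cube α α') (Ψ : S.Cube β β') (e : S.right Φ = S.left Ψ)
    (e' : S'.right (m.cube Φ) = S'.left (m.cube Ψ)),
    S'.comp (P'.mulCube (m.cube Φ) (m.cube Ψ) e') (s.mul α' β') =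
      S'.comp (s.mul α β) (m.cube (P.mulCube Φ Ψ e))
  unit_nat : ∀ {A A₁ A' A₁' : O} {x : V.Ar A A₁} {x' : V.Ar A' A₁'} (φ : V.Cell x x'),
    S'.comp (P'.unitCube (mV.cell φ)) (s.unit x') =
      S'.comp (s.unit x) (m.cube (P.unitCube φ))
  assoc : ∀ {A B E G A₁ B₁ E₁ G₁ : O} {h : H.Ar A B} {k : H.Ar B E} {l : H.Ar E G}
    {h₁ : H.Ar A₁ B₁} {k₁ : H.Ar B₁ E₁} {l₁ : H.Ar E₁ G₁} {x : V.Ar A A₁}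
    {y : V.Ar B B₁} {z : V.Ar E E₁} {t : V.Ar G G₁}
    (α : S.Sq h h₁ x y) (β : S.Sq k k₁ y z) (γ : S.Sq l l₁ z t)
    (e₁ : S'.right (s.mul α β) = S'.left (S'.one (m.sq γ)))
    (e₂ : S'.right (S'.one (m.sq α)) = S'.left (s.mul β γ)),
    S'.comp (P'.mulCube (s.mul α β) (S'.one (m.sq γ)) e₁)
        (S'.comp (s.mul (P.mul α β) γ) (m.cube (P.assoc α β γ))) =
      S'.comp (P'.assoc (m.sq α) (m.sq β) (m.sq γ))
        (S'.comp (P'.mulCube (S'.one (m.sq α)) (s.mul β γ) e₂) (s.mul α (P.mul β γ)))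
  lam : ∀ {A B A₁ B₁ : O} {h : H.Ar A B} {h₁ : H.Ar A₁ B₁} {x : V.Ar A A₁}
    {y : V.Ar B B₁} (α : S.Sq h h₁ x y) (e : S'.right (s.unit x) = S'.left (S'.one (m.sq α))),
    S'.comp (P'.mulCube (s.unit x) (S'.one (m.sq α)) e)
        (S'.comp (s.mul (P.unit x) α) (m.cube (P.lam α))) =
      P'.lam (m.sq α)
  rho : ∀ {A B A₁ B₁ : O} {h : H.Ar A B} {h₁ : H.Ar A₁ B₁} {x : V.Ar A A₁}
    {y : V.Ar B B₁} (α : S.Sq h h₁ x y) (e : S'.right (S'.one (m.sq α)) = S'.left (s.unit y)),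
    S'.comp (P'.mulCube (S'.one (m.sq α)) (s.unit y) e)
        (S'.comp (s.mul α (P.unit y)) (m.cube (P.rho α))) =
      P'.rho (m.sq α)

end Maps

/-! ## Morphisms of intercategories -/

/-- The data of a morphism of intercategories without vertical comparisons: it is strict
transversally and has colax comparisons horizontally. -/
structure HColax (I : InterData.{u₁, v₁, u₂, v₂, u₃, v₃, u₄, v₄})
    (J : InterData.{u₁', v₁', u₂', v₂', u₃', v₃', u₄', v₄'}) where
  T : I.O ⥤ J.O
  mH : ArMap I.H J.H T
  mV : ArMap I.V J.V T
  m : SqMap I.S J.S mH mV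
  hc : ColaxData mH
  hsc : SqColax m I.hs J.hs hc

/-- The data of a colax-lax morphism: colax horizontally, lax vertically. -/
structure ColaxLax (I : InterData.{u₁, v₁, u₂, v₂, u₃, v₃, u₄, v₄})
    (J : InterData.{u₁', v₁', u₂', v₂', u₃', v₃', u₄', v₄'}) extends HColax I J where
  vl : LaxData mV
  vsl : SqLax m.transpose I.vs J.vs vl

/-- The data of a colax-colax morphism: colax horizontally, colax vertically. -/
structure ColaxColax (I : InterData.{u₁, v₁, u₂, v₂, u₃, v₃, u₄, v₄})
    (J : InterData.{u₁', v₁', u₂', v₂', u₃', v₃', u₄', v₄'}) extends HColax I J where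
  vc : ColaxData mV
  vsc : SqColax m.transpose I.vs J.vs vc

section Morphisms

variable {I : InterData.{u₁, v₁, u₂, v₂, u₃, v₃, u₄, v₄}}
  {J : InterData.{u₁', v₁', u₂', v₂', u₃', v₃', u₄', v₄'}}

structure HColax.IsHColax (F : HColax I J) : Prop where
  isH : IsArMap F.mH
  isV : IsArMap F.mV
  isS : IsSqMap F.m
  isColaxH : IsColax F.hc
  isColaxHS : IsSqColax F.hsc

/-- The laws of a colax-lax morphism, including compatibility with the four interchangers. -/
structure ColaxLax.IsColaxLax (F : ColaxLax I J) : Prop where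
  isHColax : F.toHColax.IsHColax
  isLaxV : IsLax F.vl
  isLaxVS : IsSqLax F.vsl
  chi : ∀ {A B E A₁ B₁ E₁ A₂ B₂ E₂ : I.O} {h : I.H.Ar A B} {k : I.H.Ar B E}
    {h₁ : I.H.Ar A₁ B₁} {k₁ : I.H.Ar B₁ E₁} {h₂ : I.H.Ar A₂ B₂} {k₂ : I.H.Ar B₂ E₂}
    {x : I.V.Ar A A₁} {y : I.V.Ar B B₁} {z : I.V.Ar E E₁} {x₁ : I.V.Ar A₁ A₂}
    {y₁ : I.V.Ar B₁ B₂} {z₁ : I.V.Ar E₁ E₂} (α : I.S.Sq h h₁ x y) (β : I.S.Sq k k₁ y z)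
    (α₁ : I.S.Sq h₁ h₂ x₁ y₁) (β₁ : I.S.Sq k₁ k₂ y₁ z₁)
    (e₁ : J.S.bot (F.hsc.mul α β) = J.S.top (F.hsc.mul α₁ β₁))
    (e₂ : J.S.right (F.vsl.mul α α₁) = J.S.left (F.vsl.mul β β₁)),
    J.S.comp (F.vsl.mul (I.hs.mul α β) (I.hs.mul α₁ β₁))
        (J.S.comp (F.m.cube (I.chi α β α₁ β₁))
          (F.hsc.mul (I.vs.mul α α₁) (I.vs.mul β β₁))) =
      J.S.comp (J.vs.mulCube (F.hsc.mul α β) (F.hsc.mul α₁ β₁) e₁)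
        (J.S.comp (J.chi (F.m.sq α) (F.m.sq β) (F.m.sq α₁) (F.m.sq β₁))
          (J.hs.mulCube (F.vsl.mul α α₁) (F.vsl.mul β β₁) e₂))
  mu : ∀ {A A₁ A₂ : I.O} (x : I.V.Ar A A₁) (y : I.V.Ar A₁ A₂)
    (e : J.S.bot (F.hsc.unit x) = J.S.top (F.hsc.unit y)),
    J.S.comp (F.vsl.mul (I.hs.unit x) (I.hs.unit y))
        (J.S.comp (F.m.cube (I.mu x y)) (F.hsc.unit (I.V.mul x y))) =
      J.S.comp (J.vs.mulCube (F.hsc.unit x) (F.hsc.unit y) e)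
        (J.S.comp (J.mu (F.mV.ar x) (F.mV.ar y)) (J.hs.unitCube (F.vl.mul x y)))
  delta : ∀ {A B E : I.O} (h : I.H.Ar A B) (k : I.H.Ar B E)
    (e : J.S.right (F.vsl.unit h) = J.S.left (F.vsl.unit k)),
    J.S.comp (F.vsl.unit (I.H.mul h k))
        (J.S.comp (F.m.cube (I.delta h k)) (F.hsc.mul (I.vs.unit h) (I.vs.unit k))) =
      J.S.comp (J.vs.unitCube (F.hc.mul h k))
        (J.S.comp (J.delta (F.mH.ar h) (F.mH.ar k))
          (J.hs.mulCube (F.vsl.unit h) (F.vsl.unit k) e))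
  tau : ∀ A : I.O,
    J.S.comp (F.vsl.unit (I.H.unit A))
        (J.S.comp (F.m.cube (I.tau A)) (F.hsc.unit (I.V.unit A))) =
      J.S.comp (J.vs.unitCube (F.hc.unit A))
        (J.S.comp (J.tau (F.T.obj A)) (J.hs.unitCube (F.vl.unit A)))

/-- The laws of a colax-colax morphism, including compatibility with the four interchangers. -/
structure ColaxColax.IsColaxColax (G : ColaxColax I J) : Prop where
  isHColax : G.toHColax.IsHColax
  isColaxV : IsColax G.vc
  isColaxVS : IsSqColax G.vsc
  chi : ∀ {A B E A₁ B₁ E₁ A₂ B₂ E₂ : I.O} {h : I.H.Ar A B} {k : I.H.Ar B E}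
    {h₁ : I.H.Ar A₁ B₁} {k₁ : I.H.Ar B₁ E₁} {h₂ : I.H.Ar A₂ B₂} {k₂ : I.H.Ar B₂ E₂}
    {x : I.V.Ar A A₁} {y : I.V.Ar B B₁} {z : I.V.Ar E E₁} {x₁ : I.V.Ar A₁ A₂}
    {y₁ : I.V.Ar B₁ B₂} {z₁ : I.V.Ar E₁ E₂} (α : I.S.Sq h h₁ x y) (β : I.S.Sq k k₁ y z)
    (α₁ : I.S.Sq h₁ h₂ x₁ y₁) (β₁ : I.S.Sq k₁ k₂ y₁ z₁)
    (e₁ : J.S.right (G.vsc.mul α α₁) = J.S.left (G.vsc.mul β β₁))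
    (e₂ : J.S.bot (G.hsc.mul α β) = J.S.top (G.hsc.mul α₁ β₁)),
    J.S.comp (G.m.cube (I.chi α β α₁ β₁))
        (J.S.comp (G.hsc.mul (I.vs.mul α α₁) (I.vs.mul β β₁))
          (J.hs.mulCube (G.vsc.mul α α₁) (G.vsc.mul β β₁) e₁)) =
      J.S.comp (G.vsc.mul (I.hs.mul α β) (I.hs.mul α₁ β₁))
        (J.S.comp (J.vs.mulCube (G.hsc.mul α β) (G.hsc.mul α₁ β₁) e₂)
          (J.chi (G.m.sq α) (G.m.sq β) (G.m.sq α₁) (G.m.sq β₁)))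
  mu : ∀ {A A₁ A₂ : I.O} (x : I.V.Ar A A₁) (y : I.V.Ar A₁ A₂)
    (e : J.S.bot (G.hsc.unit x) = J.S.top (G.hsc.unit y)),
    J.S.comp (G.m.cube (I.mu x y))
        (J.S.comp (G.hsc.unit (I.V.mul x y)) (J.hs.unitCube (G.vc.mul x y))) =
      J.S.comp (G.vsc.mul (I.hs.unit x) (I.hs.unit y))
        (J.S.comp (J.vs.mulCube (G.hsc.unit x) (G.hsc.unit y) e)
          (J.mu (G.mV.ar x) (G.mV.ar y)))
  delta : ∀ {A B E : I.O} (h : I.H.Ar A B) (k : I.H.Ar B E)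
    (e : J.S.right (G.vsc.unit h) = J.S.left (G.vsc.unit k)),
    J.S.comp (G.m.cube (I.delta h k))
        (J.S.comp (G.hsc.mul (I.vs.unit h) (I.vs.unit k))
          (J.hs.mulCube (G.vsc.unit h) (G.vsc.unit k) e)) =
      J.S.comp (G.vsc.unit (I.H.mul h k))
        (J.S.comp (J.vs.unitCube (G.hc.mul h k)) (J.delta (G.mH.ar h) (G.mH.ar k)))
  tau : ∀ A : I.O,
    J.S.comp (G.m.cube (I.tau A))
        (J.S.comp (G.hsc.unit (I.V.unit A)) (J.hs.unitCube (G.vc.unit A))) =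
      J.S.comp (G.vsc.unit (I.H.unit A))
        (J.S.comp (J.vs.unitCube (G.hc.unit A)) (J.tau (G.T.obj A)))

/-- A morphism is horizontally strong if its horizontal comparisons are invertible. -/
structure HColax.IsStrong (F : HColax I J) : Prop where
  mul_inv : ∀ {A B E : I.O} (h : I.H.Ar A B) (k : I.H.Ar B E), J.H.IsInv (F.hc.mul h k)
  unit_inv : ∀ A : I.O, J.H.IsInv (F.hc.unit A)
  sqmul_inv : ∀ {A B E A₁ B₁ E₁ : I.O} {h : I.H.Ar A B} {k : I.H.Ar B E} {h₁ : I.H.Ar A₁ B₁}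
    {k₁ : I.H.Ar B₁ E₁} {x : I.V.Ar A A₁} {y : I.V.Ar B B₁} {z : I.V.Ar E E₁}
    (α : I.S.Sq h h₁ x y) (β : I.S.Sq k k₁ y z), J.S.IsInv (F.hsc.mul α β)
  squnit_inv : ∀ {A A₁ : I.O} (x : I.V.Ar A A₁), J.S.IsInv (F.hsc.unit x)

/-- A full inclusion: injective on objects, horizontal and vertical arrows and basic cells, and
bijective on transversal arrows, horizontal and vertical cells and cubes with given transversal
domain and codomain. -/
structure HColax.IsFullInclusion (F : HColax I J) : Prop where
  obj_inj : Function.Injective F.T.obj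
  hor_inj : ∀ A B : I.O, Function.Injective (F.mH.ar : I.H.Ar A B → _)
  ver_inj : ∀ A B : I.O, Function.Injective (F.mV.ar : I.V.Ar A B → _)
  sq_inj : ∀ {A B A₁ B₁ : I.O} (h : I.H.Ar A B) (k : I.H.Ar A₁ B₁) (x : I.V.Ar A A₁)
    (y : I.V.Ar B B₁), Function.Injective (F.m.sq : I.S.Sq h k x y → _)
  map_bij : ∀ A B : I.O, Function.Bijective (F.T.map : (A ⟶ B) → _)
  horCell_bij : ∀ {A B A' B' : I.O} (h : I.H.Ar A B) (h' : I.H.Ar A' B'),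
    Function.Bijective (F.mH.cell : I.H.Cell h h' → _)
  verCell_bij : ∀ {A B A' B' : I.O} (x : I.V.Ar A B) (x' : I.V.Ar A' B'),
    Function.Bijective (F.mV.cell : I.V.Cell x x' → _)
  cube_bij : ∀ {A B A₁ B₁ A' B' A₁' B₁' : I.O} {h : I.H.Ar A B} {k : I.H.Ar A₁ B₁}
    {x : I.V.Ar A A₁} {y : I.V.Ar B B₁} {h' : I.H.Ar A' B'} {k' : I.H.Ar A₁' B₁'}
    {x' : I.V.Ar A' A₁'} {y' : I.V.Ar B' B₁'} (α : I.S.Sq h k x y) (α' : I.S.Sq h' k' x' y'),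
    Function.Bijective (F.m.cube : I.S.Cube α α' → _)

/-- The identity morphism. -/
@[reducible] def HColax.id (I : InterData.{u₁, v₁, u₂, v₂, u₃, v₃, u₄, v₄}) : HColax I I where
  T := 𝟭 I.O
  mH := { ar := fun h => h, cell := fun φ => φ }
  mV := { ar := fun x => x, cell := fun φ => φ }
  m := { sq := fun α => α, cube := fun Φ => Φ }
  hc := { mul := fun h k => I.H.one (I.H.mul h k), unit := fun A => I.H.one (I.H.unit A) }
  hsc := { mul := fun α β => I.S.one (I.hs.mul α β), unit := fun x => I.S.one (I.hs.unit x) }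

@[reducible] def ColaxLax.id (I : InterData.{u₁, v₁, u₂, v₂, u₃, v₃, u₄, v₄}) :
    ColaxLax I I where
  toHColax := HColax.id I
  vl := { mul := fun x y => I.V.one (I.V.mul x y), unit := fun A => I.V.one (I.V.unit A) }
  vsl := { mul := fun α β => I.S.one (I.vs.mul α β), unit := fun h => I.S.one (I.vs.unit h) }

@[reducible] def ColaxColax.id (I : InterData.{u₁, v₁, u₂, v₂, u₃, v₃, u₄, v₄}) :
    ColaxColax I I where
  toHColax := HColax.id I
  vc := { mul := fun x y => I.V.one (I.V.mul x y), unit := fun A => I.V.one (I.V.unit A) }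
  vsc := { mul := fun α β => I.S.one (I.vs.mul α β), unit := fun h => I.S.one (I.vs.unit h) }

end Morphisms

/-! ## Double cells -/

section DoubleCells

variable {I : InterData.{u₁, v₁, u₂, v₂, u₃, v₃, u₄, v₄}}
  {J : InterData.{u₁', v₁', u₂', v₂', u₃', v₃', u₄', v₄'}}
  {K : InterData.{u₁'', v₁'', u₂'', v₂'', u₃'', v₃'', u₄'', v₄''}}
  {L : InterData.{u₁₃, v₁₃, u₂₃, v₂₃, u₃₃, v₃₃, u₄₃, v₄₃}}

/-- The data of a double cell `π : R F ⇒ G U` of the double category of pseudocategories in the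
2-category of weak double categories, colax functors and horizontal transformations, with
horizontal sides `F : I → J` (top) and `G : K → L` (bottom) that are colax-lax, and vertical sides
`U : I → K` (left) and `R : J → L` (right) that are colax-colax. -/
structure DblCell (F : ColaxLax I J) (U : ColaxColax I K) (R : ColaxColax J L)
    (G : ColaxLax K L) where
  ob : (A : I.O) → (R.T.obj (F.T.obj A) ⟶ G.T.obj (U.T.obj A))
  hor : {A B : I.O} → (h : I.H.Ar A B) → L.H.Cell (R.mH.ar (F.mH.ar h)) (G.mH.ar (U.mH.ar h))
  ver : {A B : I.O} → (x : I.V.Ar A B) → L.V.Cell (R.mV.ar (F.mV.ar x)) (G.mV.ar (U.mV.ar x))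
  sq : {A B A₁ B₁ : I.O} → {h : I.H.Ar A B} → {k : I.H.Ar A₁ B₁} → {x : I.V.Ar A A₁} →
    {y : I.V.Ar B B₁} → (α : I.S.Sq h k x y) →
    L.S.Cube (R.m.sq (F.m.sq α)) (G.m.sq (U.m.sq α))

/-- The laws of a double cell: compatibility with boundaries, transversal naturality, and coherence
with horizontal and with vertical composition and identities. -/
structure DblCell.IsDblCell {F : ColaxLax I J} {U : ColaxColax I K} {R : ColaxColax J L}
    {G : ColaxLax K L} (π : DblCell F U R G) : Prop where
  dom_hor : ∀ {A B : I.O} (h : I.H.Ar A B), L.H.dom (π.hor h) = π.ob A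
  cod_hor : ∀ {A B : I.O} (h : I.H.Ar A B), L.H.cod (π.hor h) = π.ob B
  dom_ver : ∀ {A B : I.O} (x : I.V.Ar A B), L.V.dom (π.ver x) = π.ob A
  cod_ver : ∀ {A B : I.O} (x : I.V.Ar A B), L.V.cod (π.ver x) = π.ob B
  faces_sq : ∀ {A B A₁ B₁ : I.O} {h : I.H.Ar A B} {k : I.H.Ar A₁ B₁} {x : I.V.Ar A A₁}
    {y : I.V.Ar B B₁} (α : I.S.Sq h k x y),
    L.S.top (π.sq α) = π.hor h ∧ L.S.bot (π.sq α) = π.hor k ∧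
    L.S.left (π.sq α) = π.ver x ∧ L.S.right (π.sq α) = π.ver y
  ob_nat : ∀ {A A' : I.O} (f : A ⟶ A'),
    R.T.map (F.T.map f) ≫ π.ob A' = π.ob A ≫ G.T.map (U.T.map f)
  hor_nat : ∀ {A B A' B' : I.O} {h : I.H.Ar A B} {h' : I.H.Ar A' B'} (φ : I.H.Cell h h'),
    L.H.comp (R.mH.cell (F.mH.cell φ)) (π.hor h') = L.H.comp (π.hor h) (G.mH.cell (U.mH.cell φ))
  ver_nat : ∀ {A B A' B' : I.O} {x : I.V.Ar A B} {x' : I.V.Ar A' B'} (φ : I.V.Cell x x'),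
    L.V.comp (R.mV.cell (F.mV.cell φ)) (π.ver x') = L.V.comp (π.ver x) (G.mV.cell (U.mV.cell φ))
  sq_nat : ∀ {A B A₁ B₁ A' B' A₁' B₁' : I.O} {h : I.H.Ar A B} {k : I.H.Ar A₁ B₁}
    {x : I.V.Ar A A₁} {y : I.V.Ar B B₁} {h' : I.H.Ar A' B'} {k' : I.H.Ar A₁' B₁'}
    {x' : I.V.Ar A' A₁'} {y' : I.V.Ar B' B₁'} {α : I.S.Sq h k x y} {α' : I.S.Sq h' k' x' y'}
    (Φ : I.S.Cube α α'),
    L.S.comp (R.m.cube (F.m.cube Φ)) (π.sq α') = L.S.comp (π.sq α) (G.m.cube (U.m.cube Φ))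
  hor_mul : ∀ {A B E : I.O} (h : I.H.Ar A B) (k : I.H.Ar B E)
    (e : L.H.cod (π.hor h) = L.H.dom (π.hor k)),
    L.H.comp (R.mH.cell (F.hc.mul h k))
        (L.H.comp (R.hc.mul (F.mH.ar h) (F.mH.ar k)) (L.H.mulCell (π.hor h) (π.hor k) e)) =
      L.H.comp (π.hor (I.H.mul h k))
        (L.H.comp (G.mH.cell (U.hc.mul h k)) (G.hc.mul (U.mH.ar h) (U.mH.ar k)))
  hor_unit : ∀ A : I.O,
    L.H.comp (R.mH.cell (F.hc.unit A))
        (L.H.comp (R.hc.unit (F.T.obj A)) (L.H.unitCell (π.ob A))) =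
      L.H.comp (π.hor (I.H.unit A))
        (L.H.comp (G.mH.cell (U.hc.unit A)) (G.hc.unit (U.T.obj A)))
  sq_hmul : ∀ {A B E A₁ B₁ E₁ : I.O} {h : I.H.Ar A B} {k : I.H.Ar B E} {h₁ : I.H.Ar A₁ B₁}
    {k₁ : I.H.Ar B₁ E₁} {x : I.V.Ar A A₁} {y : I.V.Ar B B₁} {z : I.V.Ar E E₁}
    (α : I.S.Sq h h₁ x y) (β : I.S.Sq k k₁ y z)
    (e : L.S.right (π.sq α) = L.S.left (π.sq β)),
    L.S.comp (R.m.cube (F.hsc.mul α β))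
        (L.S.comp (R.hsc.mul (F.m.sq α) (F.m.sq β)) (L.hs.mulCube (π.sq α) (π.sq β) e)) =
      L.S.comp (π.sq (I.hs.mul α β))
        (L.S.comp (G.m.cube (U.hsc.mul α β)) (G.hsc.mul (U.m.sq α) (U.m.sq β)))
  sq_hunit : ∀ {A A₁ : I.O} (x : I.V.Ar A A₁),
    L.S.comp (R.m.cube (F.hsc.unit x))
        (L.S.comp (R.hsc.unit (F.mV.ar x)) (L.hs.unitCube (π.ver x))) =
      L.S.comp (π.sq (I.hs.unit x))
        (L.S.comp (G.m.cube (U.hsc.unit x)) (G.hsc.unit (U.mV.ar x)))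
  ver_mul : ∀ {A B E : I.O} (x : I.V.Ar A B) (y : I.V.Ar B E)
    (e : L.V.cod (π.ver x) = L.V.dom (π.ver y)),
    L.V.comp (R.mV.cell (F.vl.mul x y))
        (L.V.comp (π.ver (I.V.mul x y)) (G.mV.cell (U.vc.mul x y))) =
      L.V.comp (R.vc.mul (F.mV.ar x) (F.mV.ar y))
        (L.V.comp (L.V.mulCell (π.ver x) (π.ver y) e) (G.vl.mul (U.mV.ar x) (U.mV.ar y)))
  ver_unit : ∀ A : I.O,
    L.V.comp (R.mV.cell (F.vl.unit A))
        (L.V.comp (π.ver (I.V.unit A)) (G.mV.cell (U.vc.unit A))) =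
      L.V.comp (R.vc.unit (F.T.obj A))
        (L.V.comp (L.V.unitCell (π.ob A)) (G.vl.unit (U.T.obj A)))
  sq_vmul : ∀ {A B A₁ B₁ A₂ B₂ : I.O} {h : I.H.Ar A B} {h₁ : I.H.Ar A₁ B₁} {h₂ : I.H.Ar A₂ B₂}
    {x : I.V.Ar A A₁} {y : I.V.Ar B B₁} {x₁ : I.V.Ar A₁ A₂} {y₁ : I.V.Ar B₁ B₂}
    (α : I.S.Sq h h₁ x y) (β : I.S.Sq h₁ h₂ x₁ y₁)
    (e : L.S.bot (π.sq α) = L.S.top (π.sq β)),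
    L.S.comp (R.m.cube (F.vsl.mul α β))
        (L.S.comp (π.sq (I.vs.mul α β)) (G.m.cube (U.vsc.mul α β))) =
      L.S.comp (R.vsc.mul (F.m.sq α) (F.m.sq β))
        (L.S.comp (L.vs.mulCube (π.sq α) (π.sq β) e) (G.vsl.mul (U.m.sq α) (U.m.sq β)))
  sq_vunit : ∀ {A B : I.O} (h : I.H.Ar A B),
    L.S.comp (R.m.cube (F.vsl.unit h))
        (L.S.comp (π.sq (I.vs.unit h)) (G.m.cube (U.vsc.unit h))) =
      L.S.comp (R.vsc.unit (F.mH.ar h))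
        (L.S.comp (L.vs.unitCube (π.hor h)) (G.vsl.unit (U.mH.ar h)))

/-- A double cell is (transversally) invertible if all its components are. -/
structure DblCell.IsInv {F : ColaxLax I J} {U : ColaxColax I K} {R : ColaxColax J L}
    {G : ColaxLax K L} (π : DblCell F U R G) : Prop where
  ob : ∀ A : I.O, IsIso (π.ob A)
  hor : ∀ {A B : I.O} (h : I.H.Ar A B), L.H.IsInv (π.hor h)
  ver : ∀ {A B : I.O} (x : I.V.Ar A B), L.V.IsInv (π.ver x)
  sq : ∀ {A B A₁ B₁ : I.O} {h : I.H.Ar A B} {k : I.H.Ar A₁ B₁} {x : I.V.Ar A A₁}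
    {y : I.V.Ar B B₁} (α : I.S.Sq h k x y), L.S.IsInv (π.sq α)

/-- The horizontal (colax-lax) arrow `F` and the vertical (colax-colax) arrow `G` are conjoint, as
witnessed by the double cells `α` (with top `F` and right side `G`, the other sides being
identities) and `β` (with left side `G` and bottom `F`).  The equations say that the horizontal
pasting of `α` and `β`, whose component at `X` is `F (α X) ∘ β (F X)`, is the identity double cell
of `F`, and that the vertical pasting of `β` and `α`, whose component at `X` is
`α (G X) ∘ G (β X)`, is the identity double cell of `G`. -/
structure IsConjoint (F : ColaxLax I J) (G : ColaxColax J I)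
    (α : DblCell F (ColaxColax.id I) G (ColaxLax.id I))
    (β : DblCell (ColaxLax.id J) G (ColaxColax.id J) F) : Prop where
  isColaxLax : F.IsColaxLax
  isColaxColax : G.IsColaxColax
  isDblCell_α : α.IsDblCell
  isDblCell_β : β.IsDblCell
  h_ob : ∀ A : I.O, β.ob (F.T.obj A) ≫ F.T.map (α.ob A) = 𝟙 (F.T.obj A)
  h_hor : ∀ {A B : I.O} (h : I.H.Ar A B),
    J.H.comp (β.hor (F.mH.ar h)) (F.mH.cell (α.hor h)) = J.H.one (F.mH.ar h)
  h_ver : ∀ {A B : I.O} (x : I.V.Ar A B),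
    J.V.comp (β.ver (F.mV.ar x)) (F.mV.cell (α.ver x)) = J.V.one (F.mV.ar x)
  h_sq : ∀ {A B A₁ B₁ : I.O} {h : I.H.Ar A B} {k : I.H.Ar A₁ B₁} {x : I.V.Ar A A₁}
    {y : I.V.Ar B B₁} (σ : I.S.Sq h k x y),
    J.S.comp (β.sq (F.m.sq σ)) (F.m.cube (α.sq σ)) = J.S.one (F.m.sq σ)
  v_ob : ∀ A : J.O, G.T.map (β.ob A) ≫ α.ob (G.T.obj A) = 𝟙 (G.T.obj A)
  v_hor : ∀ {A B : J.O} (h : J.H.Ar A B),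
    I.H.comp (G.mH.cell (β.hor h)) (α.hor (G.mH.ar h)) = I.H.one (G.mH.ar h)
  v_ver : ∀ {A B : J.O} (x : J.V.Ar A B),
    I.V.comp (G.mV.cell (β.ver x)) (α.ver (G.mV.ar x)) = I.V.one (G.mV.ar x)
  v_sq : ∀ {A B A₁ B₁ : J.O} {h : J.H.Ar A B} {k : J.H.Ar A₁ B₁} {x : J.V.Ar A A₁}
    {y : J.V.Ar B B₁} (σ : J.S.Sq h k x y),
    I.S.comp (G.m.cube (β.sq σ)) (α.sq (G.m.sq σ)) = I.S.one (G.m.sq σ)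

end DoubleCells

/-! ## Matrices in a monoidal category -/

section Matrices

variable {C : Type u} [Category.{v} C]

/-- A morphism from an `A × B` matrix to an `A' × B'` matrix: functions `A → A'` and `B → B'`, and
a matrix of morphisms. -/
structure MatHom {A B A' B' : Type w} (M : A → B → C) (N : A' → B' → C) where
  fst : A → A'
  snd : B → B'
  app : (a : A) → (b : B) → (M a b ⟶ N (fst a) (snd b))

namespace MatHom

variable {A B A' B' A'' B'' : Type w} {M : A → B → C} {N : A' → B' → C} {P : A'' → B'' → C}

/-- The identification of two entries of a matrix with equal indices. -/
def re (N : A' → B' → C) {a a' : A'} {b b' : B'} (ha : a = a') (hb : b = b') :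
    N a b ⟶ N a' b' :=
  eqToHom (by rw [ha, hb])

@[simp] theorem re_rfl (N : A' → B' → C) (a : A') (b : B') : re N (rfl : a = a) (rfl : b = b) = 𝟙 _ :=
  rfl

theorem ext_re {φ ψ : MatHom M N} (h₁ : ∀ a, φ.fst a = ψ.fst a) (h₂ : ∀ b, φ.snd b = ψ.snd b)
    (h : ∀ a b, φ.app a b ≫ re N (h₁ a) (h₂ b) = ψ.app a b) : φ = ψ := by
  obtain ⟨f, g, x⟩ := φ
  obtain ⟨f', g', x'⟩ := ψ
  obtain rfl : f = f' := funext h₁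
  obtain rfl : g = g' := funext h₂
  congr
  funext a b
  simpa using h a b

theorem mk_ext {f : A → A'} {g : B → B'} {x y : (a : A) → (b : B) → (M a b ⟶ N (f a) (g b))}
    (h : ∀ a b, x a b = y a b) : (⟨f, g, x⟩ : MatHom M N) = ⟨f, g, y⟩ := by
  obtain rfl : x = y := funext fun a => funext fun b => h a b
  rfl

theorem app_re {φ ψ : MatHom M N} (h : φ = ψ) (a : A) (b : B) (h₁ : φ.fst a = ψ.fst a)
    (h₂ : φ.snd b = ψ.snd b) : φ.app a b ≫ re N h₁ h₂ = ψ.app a b := by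
  subst h
  simp

def id (M : A → B → C) : MatHom M M := ⟨fun a => a, fun b => b, fun _ _ => 𝟙 _⟩

def comp (φ : MatHom M N) (ψ : MatHom N P) : MatHom M P :=
  ⟨fun a => ψ.fst (φ.fst a), fun b => ψ.snd (φ.snd b),
    fun a b => φ.app a b ≫ ψ.app (φ.fst a) (φ.snd b)⟩

theorem id_comp (φ : MatHom M N) : (id M).comp φ = φ := by
  obtain ⟨f, g, x⟩ := φ
  simp [comp, id]

theorem comp_id (φ : MatHom M N) : φ.comp (id N) = φ := by
  obtain ⟨f, g, x⟩ := φ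
  simp [comp, id]

theorem comp_assoc {A₃ B₃ : Type w} {Q : A₃ → B₃ → C} (φ : MatHom M N) (ψ : MatHom N P)
    (ω : MatHom P Q) : (φ.comp ψ).comp ω = φ.comp (ψ.comp ω) := by
  simp [comp]

theorem comp_match {A B D A' B' D' A'' B'' D'' : Type w} {M : A → B → C} {N : B → D → C}
    {M' : A' → B' → C} {N' : B' → D' → C} {M'' : A'' → B'' → C} {N'' : B'' → D'' → C}
    {φ : MatHom M M'} {φ' : MatHom M' M''} {ψ : MatHom N N'} {ψ' : MatHom N' N''}
    (e : φ.snd = ψ.fst) (e' : φ'.snd = ψ'.fst) : (φ.comp φ').snd = (ψ.comp ψ').fst :=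
  funext fun b => (congrArg φ'.snd (congrFun e b)).trans (congrFun e' _)

end MatHom

open MatHom

/-! ### Pullbacks of matrices -/

section Pullbacks

variable [HasPullbacks C] {S T S' T' A B X Y : Type w} {M : S → T → C} {M' : S' → T' → C}
  {N : A → B → C} {Q : X → Y → C}

/-- The entrywise pullback of two matrix morphisms, indexed by the pullbacks of the index sets. -/
noncomputable def pbMat (φ : MatHom M N) (ψ : MatHom M' N) :
    {p : S × S' // φ.fst p.1 = ψ.fst p.2} → {q : T × T' // φ.snd q.1 = ψ.snd q.2} → C :=
  fun p q => pullback (φ.app p.1.1 q.1.1 ≫ re N p.2 q.2) (ψ.app p.1.2 q.1.2)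

noncomputable def pb₁ (φ : MatHom M N) (ψ : MatHom M' N) : MatHom (pbMat φ ψ) M :=
  ⟨fun p => p.1.1, fun q => q.1.1, fun _ _ => pullback.fst _ _⟩

noncomputable def pb₂ (φ : MatHom M N) (ψ : MatHom M' N) : MatHom (pbMat φ ψ) M' :=
  ⟨fun p => p.1.2, fun q => q.1.2, fun _ _ => pullback.snd _ _⟩

theorem pb_condition (φ : MatHom M N) (ψ : MatHom M' N) :
    (pb₁ φ ψ).comp φ = (pb₂ φ ψ).comp ψ :=
  ext_re (fun p => p.2) (fun q => q.2) fun p q => by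
    refine (Category.assoc _ _ _).trans ?_
    exact pullback.condition

/-- The morphism to the pullback induced by a commutative square. -/
noncomputable def pbLift {φ : MatHom M N} {ψ : MatHom M' N} (ξ : MatHom Q M) (ζ : MatHom Q M')
    (h : ξ.comp φ = ζ.comp ψ) : MatHom Q (pbMat φ ψ) where
  fst x := ⟨(ξ.fst x, ζ.fst x), congrFun (congrArg MatHom.fst h) x⟩
  snd y := ⟨(ξ.snd y, ζ.snd y), congrFun (congrArg MatHom.snd h) y⟩
  app x y := pullback.lift (ξ.app x y) (ζ.app x y) (by
    rw [← Category.assoc]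
    exact app_re h x y (congrFun (congrArg MatHom.fst h) x) (congrFun (congrArg MatHom.snd h) y))

theorem pbLift_pb₁ {φ : MatHom M N} {ψ : MatHom M' N} (ξ : MatHom Q M) (ζ : MatHom Q M')
    (h : ξ.comp φ = ζ.comp ψ) : (pbLift ξ ζ h).comp (pb₁ φ ψ) = ξ :=
  mk_ext fun _ _ => pullback.lift_fst _ _ _

theorem pbLift_pb₂ {φ : MatHom M N} {ψ : MatHom M' N} (ξ : MatHom Q M) (ζ : MatHom Q M')
    (h : ξ.comp φ = ζ.comp ψ) : (pbLift ξ ζ h).comp (pb₂ φ ψ) = ζ :=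
  mk_ext fun _ _ => pullback.lift_snd _ _ _

theorem pb_ext {φ : MatHom M N} {ψ : MatHom M' N} {ξ ζ : MatHom Q (pbMat φ ψ)}
    (h₁ : ξ.comp (pb₁ φ ψ) = ζ.comp (pb₁ φ ψ)) (h₂ : ξ.comp (pb₂ φ ψ) = ζ.comp (pb₂ φ ψ)) :
    ξ = ζ := by
  have f₁ := fun x => congrFun (congrArg MatHom.fst h₁) x
  have f₂ := fun x => congrFun (congrArg MatHom.fst h₂) x
  have g₁ := fun x => congrFun (congrArg MatHom.snd h₁) x
  have g₂ := fun x => congrFun (congrArg MatHom.snd h₂) x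
  obtain ⟨f, g, x⟩ := ξ
  obtain ⟨f', g', x'⟩ := ζ
  obtain rfl : f = f' := funext fun a => Subtype.ext (Prod.ext (f₁ a) (f₂ a))
  obtain rfl : g = g' := funext fun a => Subtype.ext (Prod.ext (g₁ a) (g₂ a))
  refine mk_ext fun a b => pullback.hom_ext ?_ ?_
  · exact (Category.comp_id _).symm.trans (app_re h₁ a b rfl rfl)
  · exact (Category.comp_id _).symm.trans (app_re h₂ a b rfl rfl)

end Pullbacks

/-! ### Products of matrices -/

section Products

variable (C) in
/-- `0`, the coproduct of the empty family. -/
noncomputable def zeroObj [HasCoproducts.{w} C] : C := ∐ (fun x : PEmpty.{w + 1} => x.elim)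

variable [MonoidalCategory C] [HasCoproducts.{w} C]

open Classical in
variable (C) in
/-- The identity matrix: `I` on the diagonal and `0` elsewhere. -/
noncomputable def unitMat (A : Type w) : A → A → C :=
  fun a a' => if a = a' then 𝟙_ C else zeroObj.{u, v, w} C

theorem unitMat_pos {A : Type w} {a a' : A} (h : a = a') : 𝟙_ C = unitMat C A a a' :=
  (if_pos h).symm

theorem unitMat_neg {A : Type w} {a a' : A} (h : ¬ a = a') :
    unitMat C A a a' = zeroObj.{u, v, w} C :=
  if_neg h

/-- The identification of the entries on the diagonal with `I`. -/
noncomputable def unitIn {A : Type w} {a a' : A} (h : a = a') : 𝟙_ C ⟶ unitMat C A a a' :=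
  eqToHom (unitMat_pos h)

open Classical in
/-- A morphism out of an entry of the identity matrix is given by a morphism out of `I` on the
diagonal, and is the unique morphism out of `0` off the diagonal. -/
noncomputable def unitDesc {A : Type w} (a a' : A) {X : C} (f : a = a' → (𝟙_ C ⟶ X)) :
    unitMat C A a a' ⟶ X :=
  if h : a = a' then eqToHom (unitMat_pos h).symm ≫ f h
  else eqToHom (unitMat_neg h) ≫ Sigma.desc (fun x : PEmpty.{w + 1} => x.elim)

theorem unitIn_desc {A : Type w} {a a' : A} (h : a = a') {X : C} (f : a = a' → (𝟙_ C ⟶ X)) :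
    unitIn h ≫ unitDesc a a' f = f h := by
  simp [unitIn, unitDesc, h]

theorem unit_ext {A : Type w} {a a' : A} {X : C} {f g : unitMat C A a a' ⟶ X}
    (h : ∀ e : a = a', unitIn e ≫ f = unitIn e ≫ g) : f = g := by
  by_cases e : a = a'
  · have := h e
    rwa [unitIn, cancel_epi] at this
  · rw [← cancel_epi (eqToHom (unitMat_neg e).symm)]
    exact Sigma.hom_ext _ _ fun x => x.elim

/-- The action of a function on identity matrices. -/
noncomputable def unitHom {A A' : Type w} (f : A → A') : MatHom (unitMat C A) (unitMat C A') :=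
  ⟨f, f, fun a a' => unitDesc a a' fun h => unitIn (congrArg f h)⟩

theorem unitHom_id (A : Type w) : unitHom (C := C) (fun a : A => a) = MatHom.id _ :=
  mk_ext fun a a' =>
    unit_ext fun h => by simp [unitIn_desc]

theorem unitHom_comp {A A' A'' : Type w} (f : A → A') (g : A' → A'') :
    (unitHom (C := C) f).comp (unitHom g) = unitHom fun a => g (f a) :=
  mk_ext fun a a' =>
    unit_ext fun h => by
      simp only [unitHom, ← Category.assoc, unitIn_desc]

/-- The product of an `A × B` and a `B × D` matrix. -/
noncomputable def mulMat {A B D : Type w} (M : A → B → C) (N : B → D → C) : A → D → C :=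
  fun a d => ∐ fun b => M a b ⊗ N b d

/-- The inclusion of a summand of an entry of a product of matrices. -/
noncomputable def mulIn {A B D : Type w} (M : A → B → C) (N : B → D → C) (a : A) (b : B) (d : D) :
    M a b ⊗ N b d ⟶ mulMat M N a d :=
  Sigma.ι (fun b => M a b ⊗ N b d) b

noncomputable def mulDesc {A B D : Type w} {M : A → B → C} {N : B → D → C} {a : A} {d : D} {X : C}
    (f : (b : B) → (M a b ⊗ N b d ⟶ X)) : mulMat M N a d ⟶ X :=
  Sigma.desc f

@[simp] theorem mulIn_desc {A B D : Type w} {M : A → B → C} {N : B → D → C} {a : A} {d : D} {X : C}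
    (f : (b : B) → (M a b ⊗ N b d ⟶ X)) (b : B) : mulIn M N a b d ≫ mulDesc f = f b :=
  Sigma.ι_desc f b

@[simp] theorem mulIn_desc_assoc {A B D : Type w} {M : A → B → C} {N : B → D → C} {a : A} {d : D}
    {X Y : C} (f : (b : B) → (M a b ⊗ N b d ⟶ X)) (b : B) (g : X ⟶ Y) :
    mulIn M N a b d ≫ mulDesc f ≫ g = f b ≫ g := by
  rw [← Category.assoc, mulIn_desc]

theorem mul_ext {A B D : Type w} {M : A → B → C} {N : B → D → C} {a : A} {d : D} {X : C}
    {f g : mulMat M N a d ⟶ X} (h : ∀ b, mulIn M N a b d ≫ f = mulIn M N a b d ≫ g) : f = g :=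
  Sigma.hom_ext _ _ h

/-- The product of two matrix morphisms that agree on the middle index set. -/
noncomputable def mulHom {A B D A' B' D' : Type w} {M : A → B → C} {N : B → D → C}
    {M' : A' → B' → C} {N' : B' → D' → C} (φ : MatHom M M') (ψ : MatHom N N')
    (e : φ.snd = ψ.fst) : MatHom (mulMat M N) (mulMat M' N') :=
  ⟨φ.fst, ψ.snd, fun a d => mulDesc fun b =>
    (φ.app a b ⊗ₘ (ψ.app b d ≫ re N' (congrFun e b).symm rfl)) ≫
      mulIn M' N' (φ.fst a) (φ.snd b) (ψ.snd d)⟩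

theorem mulHom_congr {A B D A' B' D' : Type w} {M : A → B → C} {N : B → D → C}
    {M' : A' → B' → C} {N' : B' → D' → C} {φ φ' : MatHom M M'} {ψ ψ' : MatHom N N'}
    (e : φ.snd = ψ.fst) (hφ : φ = φ') (hψ : ψ = ψ') :
    mulHom φ ψ e = mulHom φ' ψ' (hφ ▸ hψ ▸ e) := by
  subst hφ hψ
  rfl

theorem mulHom_id {A B D : Type w} (M : A → B → C) (N : B → D → C) :
    mulHom (MatHom.id M) (MatHom.id N) rfl = MatHom.id (mulMat M N) :=
  mk_ext fun a d =>
    mul_ext fun b => by simp [MatHom.id]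

theorem mulHom_comp {A B D A' B' D' A'' B'' D'' : Type w} {M : A → B → C} {N : B → D → C}
    {M' : A' → B' → C} {N' : B' → D' → C} {M'' : A'' → B'' → C} {N'' : B'' → D'' → C}
    (φ : MatHom M M') (φ' : MatHom M' M'') (ψ : MatHom N N') (ψ' : MatHom N' N'')
    (e : φ.snd = ψ.fst) (e' : φ'.snd = ψ'.fst) (e'' : (φ.comp φ').snd = (ψ.comp ψ').fst) :
    (mulHom φ ψ e).comp (mulHom φ' ψ' e') = mulHom (φ.comp φ') (ψ.comp ψ') e'' := by
  obtain ⟨f, g, x⟩ := φ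
  obtain ⟨g₁, h, y⟩ := ψ
  obtain ⟨f', g', x'⟩ := φ'
  obtain ⟨g₁', h', y'⟩ := ψ'
  dsimp only at e e'
  subst e e'
  refine mk_ext fun a d => mul_ext fun b => ?_
  simp [mulHom, MatHom.comp]

theorem mulHom_comm {A B D A' B' D' A'' B'' D'' A₁ B₁ D₁ : Type w} {M : A → B → C}
    {N : B → D → C} {M' : A' → B' → C} {N' : B' → D' → C} {M'' : A'' → B'' → C}
    {N'' : B'' → D'' → C} {M₁ : A₁ → B₁ → C} {N₁ : B₁ → D₁ → C}
    {φ : MatHom M M'} {φ' : MatHom M' M''} {ψ : MatHom N N'} {ψ' : MatHom N' N''}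
    {ξ : MatHom M M₁} {ξ' : MatHom M₁ M''} {ζ : MatHom N N₁} {ζ' : MatHom N₁ N''}
    (e : φ.snd = ψ.fst) (e' : φ'.snd = ψ'.fst) (e₁ : ξ.snd = ζ.fst) (e₁' : ξ'.snd = ζ'.fst)
    (hM : φ.comp φ' = ξ.comp ξ') (hN : ψ.comp ψ' = ζ.comp ζ') :
    (mulHom φ ψ e).comp (mulHom φ' ψ' e') = (mulHom ξ ζ e₁).comp (mulHom ξ' ζ' e₁') :=
  (mulHom_comp φ φ' ψ ψ' e e' (comp_match e e')).trans
    ((mulHom_congr (comp_match e e') hM hN).trans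
      (mulHom_comp ξ ξ' ζ ζ' e₁ e₁' (comp_match e₁ e₁')).symm)

section Right

variable [∀ (X : C) (J : Type w), PreservesColimitsOfShape (Discrete J) (tensorRight X)]

/-- A morphism out of `(∐ f) ⊗ X`, by distributivity. -/
noncomputable def descR {J : Type w} {f : J → C} {X Y : C} (g : (j : J) → (f j ⊗ X ⟶ Y)) :
    (∐ f) ⊗ X ⟶ Y :=
  inv (sigmaComparison (tensorRight X) f) ≫ Sigma.desc g

theorem ι_descR {J : Type w} {f : J → C} {X Y : C} (g : (j : J) → (f j ⊗ X ⟶ Y)) (j : J) :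
    Sigma.ι f j ▷ X ≫ descR g = g j := by
  have h : Sigma.ι f j ▷ X = Sigma.ι (fun j => (tensorRight X).obj (f j)) j ≫
      sigmaComparison (tensorRight X) f := (ι_comp_sigmaComparison (tensorRight X) f j).symm
  rw [h, descR, Category.assoc, IsIso.hom_inv_id_assoc]
  exact Sigma.ι_desc _ _

theorem descR_ext {J : Type w} {f : J → C} {X Y : C} {g g' : (∐ f) ⊗ X ⟶ Y}
    (h : ∀ j, Sigma.ι f j ▷ X ≫ g = Sigma.ι f j ▷ X ≫ g') : g = g' := by
  rw [← cancel_epi (sigmaComparison (tensorRight X) f)]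
  refine Sigma.hom_ext _ _ fun j => ?_
  have := h j
  have e : Sigma.ι (fun j => (tensorRight X).obj (f j)) j ≫
      sigmaComparison (tensorRight X) f = Sigma.ι f j ▷ X :=
    ι_comp_sigmaComparison (tensorRight X) f j
  rw [← Category.assoc, ← Category.assoc, e]
  exact this

/-- A morphism out of the tensor product of an entry of a product of matrices with `X`. -/
noncomputable def mulDescR {A B D : Type w} {M : A → B → C} {N : B → D → C} {a : A} {d : D}
    {X Y : C} (g : (b : B) → ((M a b ⊗ N b d) ⊗ X ⟶ Y)) : mulMat M N a d ⊗ X ⟶ Y :=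
  descR g

theorem mulIn_descR {A B D : Type w} {M : A → B → C} {N : B → D → C} {a : A} {d : D}
    {X Y : C} (g : (b : B) → ((M a b ⊗ N b d) ⊗ X ⟶ Y)) (b : B) :
    (mulIn M N a b d ▷ X) ≫ mulDescR g = g b :=
  ι_descR g b

noncomputable def assocApp {A B D E : Type w} (M : A → B → C) (N : B → D → C) (P : D → E → C)
    (a : A) (e : E) : mulMat (mulMat M N) P a e ⟶ mulMat M (mulMat N P) a e :=
  mulDesc fun d => mulDescR fun b =>
    (α_ (M a b) (N b d) (P d e)).hom ≫ (M a b ◁ mulIn N P b d e) ≫ mulIn M (mulMat N P) a b e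

/-- The associativity isomorphism `(M N) P ≅ M (N P)`, from left to right. -/
noncomputable def assocMat {A B D E : Type w} (M : A → B → C) (N : B → D → C) (P : D → E → C) :
    MatHom (mulMat (mulMat M N) P) (mulMat M (mulMat N P)) :=
  ⟨fun a => a, fun e => e, assocApp M N P⟩

theorem ι_assocApp {A B D E : Type w} (M : A → B → C) (N : B → D → C) (P : D → E → C)
    (a : A) (b : B) (d : D) (e : E) :
    (mulIn M N a b d ▷ P d e) ≫ mulIn (mulMat M N) P a d e ≫ assocApp M N P a e =
      (α_ (M a b) (N b d) (P d e)).hom ≫ (M a b ◁ mulIn N P b d e) ≫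
        mulIn M (mulMat N P) a b e := by
  rw [assocApp, mulIn_desc, mulIn_descR]

theorem mulMul_ext {A B D E : Type w} {M : A → B → C} {N : B → D → C} {P : D → E → C}
    {a : A} {e : E} {X : C} {f g : mulMat (mulMat M N) P a e ⟶ X}
    (h : ∀ b d, (mulIn M N a b d ▷ P d e) ≫ mulIn (mulMat M N) P a d e ≫ f =
      (mulIn M N a b d ▷ P d e) ≫ mulIn (mulMat M N) P a d e ≫ g) : f = g :=
  mul_ext fun d => descR_ext fun b => h b d

theorem assocMat_nat {A B D E A' B' D' E' : Type w} {M : A → B → C} {N : B → D → C}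
    {P : D → E → C} {M' : A' → B' → C} {N' : B' → D' → C} {P' : D' → E' → C}
    (φ : MatHom M M') (ψ : MatHom N N') (ω : MatHom P P') (e₁ : φ.snd = ψ.fst)
    (e₂ : ψ.snd = ω.fst) :
    (mulHom (mulHom φ ψ e₁) ω e₂).comp (assocMat M' N' P') =
      (assocMat M N P).comp (mulHom φ (mulHom ψ ω e₂) e₁) := by
  obtain ⟨f, g, x⟩ := φ
  obtain ⟨g₁, h, y⟩ := ψ
  obtain ⟨h₁, k, z⟩ := ω
  dsimp only at e₁ e₂
  subst e₁ e₂
  refine mk_ext fun a e => mulMul_ext fun b d => ?_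
  have h₁ := ι_assocApp M' N' P' (f a) (g b) (h d) (k e)
  have h₂ := ι_assocApp M N P a b d e
  dsimp only [mulHom, MatHom.comp, assocMat]
  simp only [re_rfl, Category.comp_id, mulIn_desc_assoc, reassoc_of% h₂, mulIn_desc,
    Category.assoc, whiskerRight_comp_tensorHom_assoc, whiskerLeft_comp_tensorHom_assoc]
  rw [← tensorHom_comp_whiskerRight_assoc, h₁, ← tensorHom_comp_whiskerLeft_assoc,
    associator_naturality_assoc]

/-- A morphism out of the tensor product of an entry of the identity matrix with `X`. -/
noncomputable def unitDescR {A : Type w} (a a' : A) {X Y : C} (f : a = a' → (X ⟶ Y)) :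
    unitMat C A a a' ⊗ X ⟶ Y :=
  open Classical in
  if h : a = a' then (eqToHom (unitMat_pos h).symm ▷ X) ≫ (λ_ X).hom ≫ f h
  else (eqToHom (unitMat_neg h) ▷ X) ≫ descR fun x : PEmpty.{w + 1} => x.elim

theorem unitIn_descR {A : Type w} {a a' : A} (h : a = a') {X Y : C} (f : a = a' → (X ⟶ Y)) :
    (unitIn h ▷ X) ≫ unitDescR a a' f = (λ_ X).hom ≫ f h := by
  simp [unitIn, unitDescR, h]

theorem unitR_ext {A : Type w} {a a' : A} {X Y : C} {f g : unitMat C A a a' ⊗ X ⟶ Y}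
    (h : ∀ e : a = a', (unitIn e ▷ X) ≫ f = (unitIn e ▷ X) ≫ g) : f = g := by
  by_cases e : a = a'
  · have := h e
    rwa [unitIn, cancel_epi] at this
  · rw [← cancel_epi (eqToHom (unitMat_neg e).symm ▷ X)]
    exact descR_ext fun x => x.elim

/-- The left unit isomorphism `1 M ≅ M`, from left to right. -/
noncomputable def lamMat {A B : Type w} (M : A → B → C) : MatHom (mulMat (unitMat C A) M) M :=
  ⟨fun a => a, fun b => b, fun a _ => mulDesc fun a' =>
    unitDescR a a' fun h => re M h.symm rfl⟩

theorem lamMat_nat {A B A' B' : Type w} {M : A → B → C} {M' : A' → B' → C} (φ : MatHom M M') :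
    (mulHom (unitHom φ.fst) φ rfl).comp (lamMat M') = (lamMat M).comp φ := by
  refine mk_ext fun a b => mul_ext fun a' => unitR_ext fun h => ?_
  subst h
  dsimp only [mulHom, MatHom.comp, lamMat, unitHom]
  simp only [re_rfl, Category.comp_id, mulIn_desc_assoc, mulIn_desc, Category.assoc,
    whiskerRight_comp_tensorHom_assoc, unitIn_desc]
  rw [tensorHom_def'_assoc, unitIn_descR, reassoc_of% unitIn_descR]
  simp

end Right

section Left

variable [∀ (X : C) (J : Type w), PreservesColimitsOfShape (Discrete J) (tensorLeft X)]

/-- A morphism out of `X ⊗ (∐ f)`, by distributivity. -/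
noncomputable def descL {J : Type w} {f : J → C} {X Y : C} (g : (j : J) → (X ⊗ f j ⟶ Y)) :
    X ⊗ (∐ f) ⟶ Y :=
  inv (sigmaComparison (tensorLeft X) f) ≫ Sigma.desc g

theorem descL_ext {J : Type w} {f : J → C} {X Y : C} {g g' : X ⊗ (∐ f) ⟶ Y}
    (h : ∀ j, X ◁ Sigma.ι f j ≫ g = X ◁ Sigma.ι f j ≫ g') : g = g' := by
  rw [← cancel_epi (sigmaComparison (tensorLeft X) f)]
  refine Sigma.hom_ext _ _ fun j => ?_
  have := h j
  have e : Sigma.ι (fun j => (tensorLeft X).obj (f j)) j ≫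
      sigmaComparison (tensorLeft X) f = X ◁ Sigma.ι f j :=
    ι_comp_sigmaComparison (tensorLeft X) f j
  rw [← Category.assoc, ← Category.assoc, e]
  exact this

/-- A morphism out of the tensor product of `X` with an entry of the identity matrix. -/
noncomputable def unitDescL {A : Type w} (a a' : A) {X Y : C} (f : a = a' → (X ⟶ Y)) :
    X ⊗ unitMat C A a a' ⟶ Y :=
  open Classical in
  if h : a = a' then (X ◁ eqToHom (unitMat_pos h).symm) ≫ (ρ_ X).hom ≫ f h
  else (X ◁ eqToHom (unitMat_neg h)) ≫ descL fun x : PEmpty.{w + 1} => x.elim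

theorem unitIn_descL {A : Type w} {a a' : A} (h : a = a') {X Y : C} (f : a = a' → (X ⟶ Y)) :
    (X ◁ unitIn h) ≫ unitDescL a a' f = (ρ_ X).hom ≫ f h := by
  simp [unitIn, unitDescL, h]

theorem unitL_ext {A : Type w} {a a' : A} {X Y : C} {f g : X ⊗ unitMat C A a a' ⟶ Y}
    (h : ∀ e : a = a', (X ◁ unitIn e) ≫ f = (X ◁ unitIn e) ≫ g) : f = g := by
  by_cases e : a = a'
  · have := h e
    rwa [unitIn, cancel_epi] at this
  · rw [← cancel_epi (X ◁ eqToHom (unitMat_neg e).symm)]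
    exact descL_ext fun x => x.elim

/-- The right unit isomorphism `M 1 ≅ M`, from left to right. -/
noncomputable def rhoMat {A B : Type w} (M : A → B → C) : MatHom (mulMat M (unitMat C B)) M :=
  ⟨fun a => a, fun b => b, fun _ b => mulDesc fun b' =>
    unitDescL b' b fun h => re M rfl h⟩

theorem rhoMat_nat {A B A' B' : Type w} {M : A → B → C} {M' : A' → B' → C} (φ : MatHom M M') :
    (mulHom φ (unitHom φ.snd) rfl).comp (rhoMat M') = (rhoMat M).comp φ := by
  refine mk_ext fun a b => mul_ext fun b' => unitL_ext fun h => ?_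
  subst h
  dsimp only [mulHom, MatHom.comp, rhoMat, unitHom]
  simp only [re_rfl, Category.comp_id, mulIn_desc_assoc, mulIn_desc, Category.assoc,
    whiskerLeft_comp_tensorHom_assoc, unitIn_desc]
  rw [tensorHom_def_assoc, unitIn_descL, reassoc_of% unitIn_descL]
  simp

end Left

end Products

end Matrices

/-! ## The intercategory of sets, spans and matrices -/

section SM

/-- Sets and functions. -/
def SetOb : Type (w + 1) := Type w

instance : Category.{w, w + 1} SetOb.{w} where
  Hom A B := (show Type w from A) → (show Type w from B)
  id _ := fun a => a
  comp f g := fun a => g (f a)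

/-- Spans of sets. -/
structure Spn (A B : Type w) where
  apex : Type w
  l : apex → A
  r : apex → B

/-- Morphisms of spans (with variable feet). -/
structure SpnHom {A B A' B' : Type w} (h : Spn A B) (h' : Spn A' B') where
  fst : A → A'
  mid : h.apex → h'.apex
  snd : B → B'
  comm_l : ∀ s, h'.l (mid s) = fst (h.l s)
  comm_r : ∀ s, h'.r (mid s) = snd (h.r s)

open MatHom

variable {C : Type u} [Category.{v} C]

/-- Spans of matrices, lying over given spans of sets and having given feet. -/
structure MatSq {A B A₁ B₁ : Type w} (h : Spn A B) (k : Spn A₁ B₁) (x : A → A₁ → C)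
    (y : B → B₁ → C) where
  mat : h.apex → k.apex → C
  l : (s : h.apex) → (t : k.apex) → (mat s t ⟶ x (h.l s) (k.l t))
  r : (s : h.apex) → (t : k.apex) → (mat s t ⟶ y (h.r s) (k.r t))

def MatSq.L {A B A₁ B₁ : Type w} {h : Spn A B} {k : Spn A₁ B₁} {x : A → A₁ → C}
    {y : B → B₁ → C} (α : MatSq h k x y) : MatHom α.mat x := ⟨h.l, k.l, α.l⟩

def MatSq.R {A B A₁ B₁ : Type w} {h : Spn A B} {k : Spn A₁ B₁} {x : A → A₁ → C}
    {y : B → B₁ → C} (α : MatSq h k x y) : MatHom α.mat y := ⟨h.r, k.r, α.r⟩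

/-- Morphisms of spans of matrices. -/
structure MatCube {A B A₁ B₁ A' B' A₁' B₁' : Type w} {h : Spn A B} {k : Spn A₁ B₁}
    {x : A → A₁ → C} {y : B → B₁ → C} {h' : Spn A' B'} {k' : Spn A₁' B₁'} {x' : A' → A₁' → C}
    {y' : B' → B₁' → C} (α : MatSq h k x y) (α' : MatSq h' k' x' y') where
  left : MatHom x x'
  mid : MatHom α.mat α'.mat
  right : MatHom y y'
  comm_l : α.L.comp left = mid.comp α'.L
  comm_r : α.R.comp right = mid.comp α'.R

namespace MatCube

section Basic

variable {A B A₁ B₁ A' B' A₁' B₁' A'' B'' A₁'' B₁'' : Type w} {h : Spn A B} {k : Spn A₁ B₁}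
    {x : A → A₁ → C} {y : B → B₁ → C} {h' : Spn A' B'} {k' : Spn A₁' B₁'} {x' : A' → A₁' → C}
    {y' : B' → B₁' → C} {h'' : Spn A'' B''} {k'' : Spn A₁'' B₁''} {x'' : A'' → A₁'' → C}
    {y'' : B'' → B₁'' → C} {α : MatSq h k x y} {α' : MatSq h' k' x' y'}
    {α'' : MatSq h'' k'' x'' y''}

def top (Φ : MatCube α α') : SpnHom h h' :=
  ⟨Φ.left.fst, Φ.mid.fst, Φ.right.fst,
    fun s => (congrFun (congrArg MatHom.fst Φ.comm_l) s).symm,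
    fun s => (congrFun (congrArg MatHom.fst Φ.comm_r) s).symm⟩

def bot (Φ : MatCube α α') : SpnHom k k' :=
  ⟨Φ.left.snd, Φ.mid.snd, Φ.right.snd,
    fun t => (congrFun (congrArg MatHom.snd Φ.comm_l) t).symm,
    fun t => (congrFun (congrArg MatHom.snd Φ.comm_r) t).symm⟩

def one (α : MatSq h k x y) : MatCube α α :=
  ⟨MatHom.id _, MatHom.id _, MatHom.id _,
    by rw [MatHom.comp_id, MatHom.id_comp], by rw [MatHom.comp_id, MatHom.id_comp]⟩

def comp (Φ : MatCube α α') (Ψ : MatCube α' α'') : MatCube α α'' :=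
  ⟨Φ.left.comp Ψ.left, Φ.mid.comp Ψ.mid, Φ.right.comp Ψ.right,
    by rw [← MatHom.comp_assoc, Φ.comm_l, MatHom.comp_assoc, Ψ.comm_l, MatHom.comp_assoc],
    by rw [← MatHom.comp_assoc, Φ.comm_r, MatHom.comp_assoc, Ψ.comm_r, MatHom.comp_assoc]⟩

end Basic

end MatCube

/-! Composition of spans -/

section Spans

variable {A B D E A' B' D' : Type w}

def SpnHom.one (h : Spn A B) : SpnHom h h :=
  ⟨fun a => a, fun s => s, fun b => b, fun _ => rfl, fun _ => rfl⟩

def Spn.unit (A : Type w) : Spn A A := ⟨A, fun a => a, fun a => a⟩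

/-- Composition of spans by pullback. -/
def Spn.mul (h : Spn A B) (k : Spn B D) : Spn A D :=
  ⟨{p : h.apex × k.apex // h.r p.1 = k.l p.2}, fun p => h.l p.1.1, fun p => k.r p.1.2⟩

def SpnHom.mul {h : Spn A B} {k : Spn B D} {h' : Spn A' B'} {k' : Spn B' D'} (φ : SpnHom h h')
    (ψ : SpnHom k k') (e : φ.snd = ψ.fst) : SpnHom (h.mul k) (h'.mul k') :=
  ⟨φ.fst, fun p => ⟨(φ.mid p.1.1, ψ.mid p.1.2), by
      rw [φ.comm_r, ψ.comm_l, p.2]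
      exact congrFun e _⟩,
    ψ.snd, fun p => φ.comm_l p.1.1, fun p => ψ.comm_r p.1.2⟩

def Spn.assoc (h : Spn A B) (k : Spn B D) (l : Spn D E) :
    SpnHom ((h.mul k).mul l) (h.mul (k.mul l)) :=
  ⟨fun a => a, fun p => ⟨(p.1.1.1.1, ⟨(p.1.1.1.2, p.1.2), p.2⟩), p.1.1.2⟩,
    fun d => d, fun _ => rfl, fun _ => rfl⟩

def Spn.lam (h : Spn A B) : SpnHom ((Spn.unit A).mul h) h :=
  ⟨fun a => a, fun p => p.1.2, fun b => b, fun p => p.2.symm, fun _ => rfl⟩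

def Spn.rho (h : Spn A B) : SpnHom (h.mul (Spn.unit B)) h :=
  ⟨fun a => a, fun p => p.1.1, fun b => b, fun _ => rfl, fun p => p.2⟩

end Spans

/-! Horizontal composition of spans of matrices, by pullback -/

section Horizontal

variable [HasPullbacks C] {A B D E A₁ B₁ D₁ E₁ A' B' D' A₁' B₁' D₁' : Type w}
  {h : Spn A B} {k : Spn B D} {l : Spn D E} {h₁ : Spn A₁ B₁} {k₁ : Spn B₁ D₁} {l₁ : Spn D₁ E₁}
  {h' : Spn A' B'} {k' : Spn B' D'} {h₁' : Spn A₁' B₁'} {k₁' : Spn B₁' D₁'}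
  {x : A → A₁ → C} {y : B → B₁ → C} {z : D → D₁ → C} {t : E → E₁ → C}
  {x' : A' → A₁' → C} {y' : B' → B₁' → C} {z' : D' → D₁' → C}

def MatSq.hunit (x : A → A₁ → C) : MatSq (Spn.unit A) (Spn.unit A₁) x x :=
  ⟨x, fun _ _ => 𝟙 _, fun _ _ => 𝟙 _⟩

def MatCube.hunit {x : A → A₁ → C} {x' : A' → A₁' → C} (φ : MatHom x x') :
    MatCube (MatSq.hunit x) (MatSq.hunit x') :=
  ⟨φ, φ, φ, (MatHom.id_comp φ).trans (MatHom.comp_id φ).symm,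
    (MatHom.id_comp φ).trans (MatHom.comp_id φ).symm⟩

noncomputable def MatSq.hmul (α : MatSq h h₁ x y) (β : MatSq k k₁ y z) :
    MatSq (h.mul k) (h₁.mul k₁) x z :=
  ⟨pbMat α.R β.L, ((pb₁ α.R β.L).comp α.L).app, ((pb₂ α.R β.L).comp β.R).app⟩

/-- The projections of a horizontal composite. -/
noncomputable def MatSq.p₁ (α : MatSq h h₁ x y) (β : MatSq k k₁ y z) :
    MatHom (α.hmul β).mat α.mat := pb₁ α.R β.L

noncomputable def MatSq.p₂ (α : MatSq h h₁ x y) (β : MatSq k k₁ y z) :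
    MatHom (α.hmul β).mat β.mat := pb₂ α.R β.L

theorem MatSq.p_condition (α : MatSq h h₁ x y) (β : MatSq k k₁ y z) :
    (α.p₁ β).comp α.R = (α.p₂ β).comp β.L := pb_condition α.R β.L

theorem MatSq.hmul_L (α : MatSq h h₁ x y) (β : MatSq k k₁ y z) :
    (α.hmul β).L = (α.p₁ β).comp α.L := rfl

theorem MatSq.hmul_R (α : MatSq h h₁ x y) (β : MatSq k k₁ y z) :
    (α.hmul β).R = (α.p₂ β).comp β.R := rfl

/-- The universal property of a horizontal composite. -/
noncomputable def MatSq.lift {X Y : Type w} {Q : X → Y → C} (α : MatSq h h₁ x y)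
    (β : MatSq k k₁ y z) (ξ : MatHom Q α.mat) (ζ : MatHom Q β.mat)
    (e : ξ.comp α.R = ζ.comp β.L) : MatHom Q (α.hmul β).mat :=
  pbLift ξ ζ e

theorem MatSq.lift_p₁ {X Y : Type w} {Q : X → Y → C} (α : MatSq h h₁ x y)
    (β : MatSq k k₁ y z) (ξ : MatHom Q α.mat) (ζ : MatHom Q β.mat)
    (e : ξ.comp α.R = ζ.comp β.L) : (α.lift β ξ ζ e).comp (α.p₁ β) = ξ :=
  pbLift_pb₁ ξ ζ e

theorem MatSq.lift_p₂ {X Y : Type w} {Q : X → Y → C} (α : MatSq h h₁ x y)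
    (β : MatSq k k₁ y z) (ξ : MatHom Q α.mat) (ζ : MatHom Q β.mat)
    (e : ξ.comp α.R = ζ.comp β.L) : (α.lift β ξ ζ e).comp (α.p₂ β) = ζ :=
  pbLift_pb₂ ξ ζ e

theorem MatSq.lift_ext {X Y : Type w} {Q : X → Y → C} {α : MatSq h h₁ x y}
    {β : MatSq k k₁ y z} {ξ ζ : MatHom Q (α.hmul β).mat}
    (e₁ : ξ.comp (α.p₁ β) = ζ.comp (α.p₁ β)) (e₂ : ξ.comp (α.p₂ β) = ζ.comp (α.p₂ β)) : ξ = ζ :=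
  pb_ext e₁ e₂

noncomputable def MatCube.hmul {α : MatSq h h₁ x y} {β : MatSq k k₁ y z}
    {α' : MatSq h' h₁' x' y'} {β' : MatSq k' k₁' y' z'} (Φ : MatCube α α') (Ψ : MatCube β β')
    (e : Φ.right = Ψ.left) : MatCube (α.hmul β) (α'.hmul β') :=
  ⟨Φ.left,
    α'.lift β' ((α.p₁ β).comp Φ.mid) ((α.p₂ β).comp Ψ.mid) (by
      rw [MatHom.comp_assoc, ← Φ.comm_r, ← MatHom.comp_assoc, MatSq.p_condition, e,
        MatHom.comp_assoc, MatHom.comp_assoc, ← Ψ.comm_l]),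
    Ψ.right,
    by rw [MatSq.hmul_L, MatSq.hmul_L, MatHom.comp_assoc, Φ.comm_l, ← MatHom.comp_assoc,
      ← MatHom.comp_assoc, MatSq.lift_p₁],
    by rw [MatSq.hmul_R, MatSq.hmul_R, MatHom.comp_assoc, Ψ.comm_r, ← MatHom.comp_assoc,
      ← MatHom.comp_assoc, MatSq.lift_p₂]⟩

/-- The middle component of the horizontal associativity isomorphism, from left to right. -/
noncomputable def MatSq.hassocMid (α : MatSq h h₁ x y) (β : MatSq k k₁ y z)
    (γ : MatSq l l₁ z t) :
    MatHom ((α.hmul β).hmul γ).mat (α.hmul (β.hmul γ)).mat :=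
  α.lift (β.hmul γ) (((α.hmul β).p₁ γ).comp (α.p₁ β))
    (β.lift γ (((α.hmul β).p₁ γ).comp (α.p₂ β)) ((α.hmul β).p₂ γ)
      ((MatHom.comp_assoc _ _ _).trans ((α.hmul β).p_condition γ)))
    ((MatHom.comp_assoc _ _ _).trans
      ((congrArg (MatHom.comp ((α.hmul β).p₁ γ)) (α.p_condition β)).trans
        ((MatHom.comp_assoc _ _ _).symm.trans
          ((congrArg (fun ξ => MatHom.comp ξ β.L) (β.lift_p₁ γ _ _ _).symm).trans
            (MatHom.comp_assoc _ _ _)))))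

theorem MatSq.hassocMid_p₁ (α : MatSq h h₁ x y) (β : MatSq k k₁ y z) (γ : MatSq l l₁ z t) :
    (α.hassocMid β γ).comp (α.p₁ (β.hmul γ)) = ((α.hmul β).p₁ γ).comp (α.p₁ β) :=
  α.lift_p₁ (β.hmul γ) _ _ _

theorem MatSq.hassocMid_p₂_p₁ (α : MatSq h h₁ x y) (β : MatSq k k₁ y z) (γ : MatSq l l₁ z t) :
    ((α.hassocMid β γ).comp (α.p₂ (β.hmul γ))).comp (β.p₁ γ) =
      ((α.hmul β).p₁ γ).comp (α.p₂ β) :=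
  (congrArg (fun ξ => MatHom.comp ξ (β.p₁ γ)) (α.lift_p₂ (β.hmul γ) _ _ _)).trans
    (β.lift_p₁ γ _ _ _)

theorem MatSq.hassocMid_p₂_p₂ (α : MatSq h h₁ x y) (β : MatSq k k₁ y z) (γ : MatSq l l₁ z t) :
    ((α.hassocMid β γ).comp (α.p₂ (β.hmul γ))).comp (β.p₂ γ) = (α.hmul β).p₂ γ :=
  (congrArg (fun ξ => MatHom.comp ξ (β.p₂ γ)) (α.lift_p₂ (β.hmul γ) _ _ _)).trans
    (β.lift_p₂ γ _ _ _)

noncomputable def MatSq.hassoc (α : MatSq h h₁ x y) (β : MatSq k k₁ y z) (γ : MatSq l l₁ z t) :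
    MatCube ((α.hmul β).hmul γ) (α.hmul (β.hmul γ)) :=
  ⟨MatHom.id _, α.hassocMid β γ, MatHom.id _,
    by
      rw [MatHom.comp_id, MatSq.hmul_L, MatSq.hmul_L, MatSq.hmul_L α (β.hmul γ),
        ← MatHom.comp_assoc, ← MatHom.comp_assoc, MatSq.hassocMid_p₁],
    by
      rw [MatHom.comp_id, MatSq.hmul_R, MatSq.hmul_R α (β.hmul γ), MatSq.hmul_R β γ,
        ← MatHom.comp_assoc, ← MatHom.comp_assoc, MatSq.hassocMid_p₂_p₂]⟩

noncomputable def MatSq.hlam (α : MatSq h h₁ x y) : MatCube ((MatSq.hunit x).hmul α) α :=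
  ⟨MatHom.id _, (MatSq.hunit x).p₂ α, MatHom.id _,
    (MatHom.comp_id _).trans (MatSq.p_condition (MatSq.hunit x) α),
    by rw [MatHom.comp_id, MatSq.hmul_R]⟩

noncomputable def MatSq.hrho (α : MatSq h h₁ x y) : MatCube (α.hmul (MatSq.hunit y)) α :=
  ⟨MatHom.id _, α.p₁ (MatSq.hunit y), MatHom.id _,
    by rw [MatHom.comp_id, MatSq.hmul_L],
    (MatHom.comp_id _).trans (MatSq.p_condition α (MatSq.hunit y)).symm⟩

end Horizontal

section Match

variable {A B D A₁ B₁ D₁ A₂ B₂ D₂ : Type w} {h : Spn A B} {k : Spn B D} {h₁ : Spn A₁ B₁}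
  {k₁ : Spn B₁ D₁} {h₂ : Spn A₂ B₂} {k₂ : Spn B₂ D₂} {x : A → A₁ → C} {y : B → B₁ → C}
  {z : D → D₁ → C} {x₁ : A₁ → A₂ → C} {y₁ : B₁ → B₂ → C} {z₁ : D₁ → D₂ → C}

theorem LL (α : MatSq h h₁ x y) (β : MatSq h₁ h₂ x₁ y₁) : α.L.snd = β.L.fst := rfl

theorem RR (α : MatSq h h₁ x y) (β : MatSq h₁ h₂ x₁ y₁) : α.R.snd = β.R.fst := rfl

variable [HasPullbacks C]

theorem p₁_match (α : MatSq h h₁ x y) (β : MatSq k k₁ y z) (α₁ : MatSq h₁ h₂ x₁ y₁)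
    (β₁ : MatSq k₁ k₂ y₁ z₁) : (α.p₁ β).snd = (α₁.p₁ β₁).fst := rfl

theorem p₂_match (α : MatSq h h₁ x y) (β : MatSq k k₁ y z) (α₁ : MatSq h₁ h₂ x₁ y₁)
    (β₁ : MatSq k₁ k₂ y₁ z₁) : (α.p₂ β).snd = (α₁.p₂ β₁).fst := rfl

end Match

/-! Vertical composition of spans of matrices, by matrix multiplication -/

section Vertical

variable [MonoidalCategory C] [HasCoproducts.{w} C]
  {A B A₁ B₁ A₂ B₂ A₃ B₃ A' B' A₁' B₁' A₂' B₂' : Type w}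
  {h : Spn A B} {h₁ : Spn A₁ B₁} {h₂ : Spn A₂ B₂} {h₃ : Spn A₃ B₃}
  {h' : Spn A' B'} {h₁' : Spn A₁' B₁'} {h₂' : Spn A₂' B₂'}
  {x : A → A₁ → C} {y : B → B₁ → C} {x₁ : A₁ → A₂ → C} {y₁ : B₁ → B₂ → C}
  {x₂ : A₂ → A₃ → C} {y₂ : B₂ → B₃ → C}
  {x' : A' → A₁' → C} {y' : B' → B₁' → C} {x₁' : A₁' → A₂' → C} {y₁' : B₁' → B₂' → C}

variable (C) in
noncomputable def MatSq.vunit (h : Spn A B) : MatSq h h (unitMat C A) (unitMat C B) :=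
  ⟨unitMat C h.apex, (unitHom h.l).app, (unitHom h.r).app⟩

noncomputable def MatCube.vunit (φ : SpnHom h h') :
    MatCube (MatSq.vunit C h) (MatSq.vunit C h') :=
  ⟨unitHom φ.fst, unitHom φ.mid, unitHom φ.snd,
    (unitHom_comp h.l φ.fst).trans ((congrArg unitHom (funext fun s => (φ.comm_l s).symm)).trans
      (unitHom_comp φ.mid h'.l).symm),
    (unitHom_comp h.r φ.snd).trans ((congrArg unitHom (funext fun s => (φ.comm_r s).symm)).trans
      (unitHom_comp φ.mid h'.r).symm)⟩

noncomputable def MatSq.vmul (α : MatSq h h₁ x y) (β : MatSq h₁ h₂ x₁ y₁) :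
    MatSq h h₂ (mulMat x x₁) (mulMat y y₁) :=
  ⟨mulMat α.mat β.mat, (mulHom α.L β.L (LL α β)).app, (mulHom α.R β.R (RR α β)).app⟩

theorem MatSq.vmul_L (α : MatSq h h₁ x y) (β : MatSq h₁ h₂ x₁ y₁) :
    (α.vmul β).L = mulHom α.L β.L (LL α β) := rfl

theorem MatSq.vmul_R (α : MatSq h h₁ x y) (β : MatSq h₁ h₂ x₁ y₁) :
    (α.vmul β).R = mulHom α.R β.R (RR α β) := rfl

noncomputable def MatCube.vmul {α : MatSq h h₁ x y} {β : MatSq h₁ h₂ x₁ y₁}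
    {α' : MatSq h' h₁' x' y'} {β' : MatSq h₁' h₂' x₁' y₁'} (Φ : MatCube α α') (Ψ : MatCube β β')
    (e : Φ.bot = Ψ.top) : MatCube (α.vmul β) (α'.vmul β') :=
  ⟨mulHom Φ.left Ψ.left (congrArg SpnHom.fst e), mulHom Φ.mid Ψ.mid (congrArg SpnHom.mid e),
    mulHom Φ.right Ψ.right (congrArg SpnHom.snd e),
    mulHom_comm (LL α β) (congrArg SpnHom.fst e) (congrArg SpnHom.mid e) (LL α' β')
      Φ.comm_l Ψ.comm_l,
    mulHom_comm (RR α β) (congrArg SpnHom.snd e) (congrArg SpnHom.mid e) (RR α' β')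
      Φ.comm_r Ψ.comm_r⟩

noncomputable def MatSq.vassoc
    [∀ (X : C) (J : Type w), PreservesColimitsOfShape (Discrete J) (tensorRight X)]
    (α : MatSq h h₁ x y) (β : MatSq h₁ h₂ x₁ y₁) (γ : MatSq h₂ h₃ x₂ y₂) :
    MatCube ((α.vmul β).vmul γ) (α.vmul (β.vmul γ)) :=
  ⟨assocMat _ _ _, assocMat _ _ _, assocMat _ _ _,
    assocMat_nat α.L β.L γ.L rfl rfl, assocMat_nat α.R β.R γ.R rfl rfl⟩

noncomputable def MatSq.vlam
    [∀ (X : C) (J : Type w), PreservesColimitsOfShape (Discrete J) (tensorRight X)]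
    (α : MatSq h h₁ x y) : MatCube ((MatSq.vunit C h).vmul α) α :=
  ⟨lamMat _, lamMat _, lamMat _, lamMat_nat α.L, lamMat_nat α.R⟩

noncomputable def MatSq.vrho
    [∀ (X : C) (J : Type w), PreservesColimitsOfShape (Discrete J) (tensorLeft X)]
    (α : MatSq h h₁ x y) : MatCube (α.vmul (MatSq.vunit C h₁)) α :=
  ⟨rhoMat _, rhoMat _, rhoMat _, rhoMat_nat α.L, rhoMat_nat α.R⟩

end Vertical

/-! The interchangers -/

section Interchange

variable [HasPullbacks C] [MonoidalCategory C] [HasCoproducts.{w} C]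
  {A B D A₁ B₁ D₁ A₂ B₂ D₂ : Type w} {h : Spn A B} {k : Spn B D} {h₁ : Spn A₁ B₁}
  {k₁ : Spn B₁ D₁} {h₂ : Spn A₂ B₂} {k₂ : Spn B₂ D₂} {x : A → A₁ → C} {y : B → B₁ → C}
  {z : D → D₁ → C} {x₁ : A₁ → A₂ → C} {y₁ : B₁ → B₂ → C} {z₁ : D₁ → D₂ → C}

/-- The middle component of `χ` compares a sum of tensor products of pullbacks with a pullback of
sums of tensor products. -/
noncomputable def MatSq.chi (α : MatSq h h₁ x y) (β : MatSq k k₁ y z)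
    (α₁ : MatSq h₁ h₂ x₁ y₁) (β₁ : MatSq k₁ k₂ y₁ z₁) :
    MatCube ((α.hmul β).vmul (α₁.hmul β₁)) ((α.vmul α₁).hmul (β.vmul β₁)) :=
  ⟨MatHom.id _,
    (α.vmul α₁).lift (β.vmul β₁) (mulHom (α.p₁ β) (α₁.p₁ β₁) (p₁_match α β α₁ β₁))
      (mulHom (α.p₂ β) (α₁.p₂ β₁) (p₂_match α β α₁ β₁))
      (mulHom_comm (p₁_match α β α₁ β₁) (RR α α₁) (p₂_match α β α₁ β₁) (LL β β₁)
        (α.p_condition β) (α₁.p_condition β₁)),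
    MatHom.id _,
    by
      refine (MatHom.comp_id _).trans (Eq.trans (Eq.symm ?_) ((congrArg (fun ξ => MatHom.comp ξ
        (α.vmul α₁).L) ((α.vmul α₁).lift_p₁ (β.vmul β₁) _ _ _)).symm.trans
        (MatHom.comp_assoc _ _ _)))
      exact (mulHom_comp (α.p₁ β) α.L (α₁.p₁ β₁) α₁.L (p₁_match α β α₁ β₁) (LL α α₁)
        (LL (α.hmul β) (α₁.hmul β₁))),
    by
      refine (MatHom.comp_id _).trans (Eq.trans (Eq.symm ?_) ((congrArg (fun ξ => MatHom.comp ξ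
        (β.vmul β₁).R) ((α.vmul α₁).lift_p₂ (β.vmul β₁) _ _ _)).symm.trans
        (MatHom.comp_assoc _ _ _)))
      exact (mulHom_comp (α.p₂ β) β.R (α₁.p₂ β₁) β₁.R (p₂_match α β α₁ β₁) (RR β β₁)
        (RR (α.hmul β) (α₁.hmul β₁)))⟩

noncomputable def MatSq.mu (x : A → A₁ → C) (x₁ : A₁ → A₂ → C) :
    MatCube ((MatSq.hunit x).vmul (MatSq.hunit x₁)) (MatSq.hunit (mulMat x x₁)) :=
  ⟨MatHom.id _, MatHom.id _, MatHom.id _,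
    congrArg (fun ξ => MatHom.comp ξ (MatHom.id _)) (mulHom_id x x₁),
    congrArg (fun ξ => MatHom.comp ξ (MatHom.id _)) (mulHom_id x x₁)⟩

variable (C) in
theorem delta_aux (h : Spn A B) (k : Spn B D) :
    (unitHom (C := C) fun p : (h.mul k).apex => p.1.1).comp (MatSq.vunit C h).R =
      (unitHom fun p : (h.mul k).apex => p.1.2).comp (MatSq.vunit C k).L :=
  (unitHom_comp _ _).trans ((congrArg unitHom (funext fun p => p.2)).trans
    (unitHom_comp _ _).symm)

variable (C) in
noncomputable def MatSq.delta (h : Spn A B) (k : Spn B D) :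
    MatCube (MatSq.vunit C (h.mul k)) ((MatSq.vunit C h).hmul (MatSq.vunit C k)) :=
  ⟨MatHom.id _,
    (MatSq.vunit C h).lift (MatSq.vunit C k) (unitHom fun p : (h.mul k).apex => p.1.1)
      (unitHom fun p : (h.mul k).apex => p.1.2) (delta_aux C h k),
    MatHom.id _,
    by
      refine (MatHom.comp_id _).trans (Eq.trans (Eq.symm ?_) ((congrArg (fun ξ => MatHom.comp ξ
        (MatSq.vunit C h).L) ((MatSq.vunit C h).lift_p₁ (MatSq.vunit C k) _ _ _)).symm.trans
        (MatHom.comp_assoc _ _ _)))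
      exact unitHom_comp _ _,
    by
      refine (MatHom.comp_id _).trans (Eq.trans (Eq.symm ?_) ((congrArg (fun ξ => MatHom.comp ξ
        (MatSq.vunit C k).R) ((MatSq.vunit C h).lift_p₂ (MatSq.vunit C k) _ _ _)).symm.trans
        (MatHom.comp_assoc _ _ _)))
      exact unitHom_comp _ _⟩

variable (C) in
noncomputable def MatSq.tau (A : Type w) :
    MatCube (MatSq.vunit C (Spn.unit A)) (MatSq.hunit (unitMat C A)) :=
  ⟨MatHom.id _, MatHom.id _, MatHom.id _,
    congrArg (fun ξ => MatHom.comp ξ (MatHom.id _)) (unitHom_id A),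
    congrArg (fun ξ => MatHom.comp ξ (MatHom.id _)) (unitHom_id A)⟩

end Interchange

/-! The intercategory -/

/-- The weak double category of sets, functions and spans. -/
def spanDbl : DblData.{w + 1, w, w + 1, w} SetOb.{w} where
  Ar A B := Spn.{w} A B
  Cell h h' := SpnHom h h'
  dom φ := φ.fst
  cod φ := φ.snd
  one h := SpnHom.one h
  comp φ ψ := ⟨fun a => ψ.fst (φ.fst a), fun s => ψ.mid (φ.mid s), fun b => ψ.snd (φ.snd b),
    fun s => by rw [ψ.comm_l, φ.comm_l], fun s => by rw [ψ.comm_r, φ.comm_r]⟩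
  unit A := Spn.unit A
  unitCell f := ⟨f, f, f, fun _ => rfl, fun _ => rfl⟩
  mul h k := h.mul k
  mulCell φ ψ e := φ.mul ψ e
  assoc h k l := h.assoc k l
  lam h := h.lam
  rho h := h.rho

variable (C) [MonoidalCategory C] [HasCoproducts.{w} C]
  [∀ (X : C) (J : Type w), PreservesColimitsOfShape (Discrete J) (tensorLeft X)]
  [∀ (X : C) (J : Type w), PreservesColimitsOfShape (Discrete J) (tensorRight X)]

/-- The weak double category of sets, functions and matrices of objects of `C`. -/
noncomputable def matDbl : DblData.{w + 1, w, max u w, max v w} SetOb.{w} where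
  Ar A B := (show Type w from A) → (show Type w from B) → C
  Cell M N := MatHom M N
  dom φ := φ.fst
  cod φ := φ.snd
  one M := MatHom.id M
  comp φ ψ := φ.comp ψ
  unit A := unitMat C A
  unitCell f := unitHom f
  mul M N := mulMat M N
  mulCell φ ψ e := mulHom φ ψ e
  assoc M N P := assocMat M N P
  lam M := lamMat M
  rho M := rhoMat M

/-- Basic cells are spans of matrices and cubes are morphisms of such. -/
noncomputable def spanMatSq :
    SqData.{w + 1, w, w + 1, w, max u w, max v w, max u v w, max v w}
      spanDbl.{w} (matDbl.{u, v, w} C) where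
  Sq h k x y := MatSq h k x y
  Cube α α' := MatCube α α'
  top Φ := Φ.top
  bot Φ := Φ.bot
  left Φ := Φ.left
  right Φ := Φ.right
  one α := MatCube.one α
  comp Φ Ψ := Φ.comp Ψ

/-- The intercategory `SM(C)` of sets, functions, spans and matrices. -/
noncomputable def SM [HasPullbacks C] :
    InterData.{w + 1, w, w + 1, w, max u w, max v w, max u v w, max v w} where
  O := SetOb.{w}
  H := spanDbl.{w}
  V := matDbl.{u, v, w} C
  S := spanMatSq.{u, v, w} C
  hs :=
    { unit := fun x => MatSq.hunit x
      unitCube := fun φ => MatCube.hunit φ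
      mul := fun α β => α.hmul β
      mulCube := fun Φ Ψ e => Φ.hmul Ψ e
      assoc := fun α β γ => α.hassoc β γ
      lam := fun α => α.hlam
      rho := fun α => α.hrho }
  vs :=
    { unit := fun h => MatSq.vunit C h
      unitCube := fun φ => MatCube.vunit φ
      mul := fun α β => α.vmul β
      mulCube := fun Φ Ψ e => Φ.vmul Ψ e
      assoc := fun α β γ => α.vassoc β γ
      lam := fun α => α.vlam
      rho := fun α => α.vrho }
  chi α β α₁ β₁ := α.chi β α₁ β₁
  mu x x₁ := MatSq.mu x x₁
  delta h k := MatSq.delta C h k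
  tau A := MatSq.tau C A

end SM

/-! ## The intercategory of a monoidal category with finite products -/

section Duoidal

/-- The weak double category with one object, one transversal, one weak arrow and one cell. -/
def trivDbl : DblData.{0, 0, 0, 0} (Discrete PUnit.{1}) where
  Ar _ _ := PUnit
  Cell _ _ := PUnit
  dom {_ _ _ _ _ _} _ := eqToHom (Subsingleton.elim _ _)
  cod {_ _ _ _ _ _} _ := eqToHom (Subsingleton.elim _ _)
  one _ := ⟨⟩
  comp _ _ := ⟨⟩
  unit _ := ⟨⟩
  unitCell _ := ⟨⟩
  mul _ _ := ⟨⟩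
  mulCell _ _ _ := ⟨⟩
  assoc _ _ _ := ⟨⟩
  lam _ := ⟨⟩
  rho _ := ⟨⟩

variable (C : Type u) [Category.{v} C]

/-- The objects and morphisms of `C` as basic cells and cubes. -/
@[reducible] def objSq : SqData.{0, 0, 0, 0, 0, 0, u, v} trivDbl trivDbl where
  Sq _ _ _ _ := C
  Cube X Y := (show C from X) ⟶ (show C from Y)
  top _ := ⟨⟩
  bot _ := ⟨⟩
  left _ := ⟨⟩
  right _ := ⟨⟩
  one X := 𝟙 (show C from X)
  comp f g := CategoryStruct.comp (obj := C) f g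

attribute [local instance] hasBinaryProducts_of_hasTerminal_and_pullbacks

variable [MonoidalCategory C] [HasTerminal C] [HasPullbacks C]

/-- A monoidal category `C` with finite products as an intercategory `(C, ×, ⊗)` with one object:
horizontal composition is `×`, vertical composition is `⊗`. -/
@[reducible] noncomputable def prodTensor : InterData.{0, 0, 0, 0, 0, 0, u, v} where
  O := Discrete PUnit.{1}
  H := trivDbl
  V := trivDbl
  S := objSq C
  hs :=
    { unit := fun _ => ⊤_ C
      unitCube := fun _ => 𝟙 (⊤_ C)
      mul := fun (X : C) (Y : C) => X ⨯ Y
      mulCube := fun f g _ => prod.map (C := C) f g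
      assoc := fun (X : C) (Y : C) (Z : C) => (prod.associator X Y Z).hom
      lam := fun (X : C) => (prod.leftUnitor X).hom
      rho := fun (X : C) => (prod.rightUnitor X).hom }
  vs :=
    { unit := fun _ => 𝟙_ C
      unitCube := fun _ => 𝟙 (𝟙_ C)
      mul := fun (X : C) (Y : C) => X ⊗ Y
      mulCube := fun f g _ => tensorHom (C := C) f g
      assoc := fun (X : C) (Y : C) (Z : C) => (α_ X Y Z).hom
      lam := fun (X : C) => (λ_ X).hom
      rho := fun (X : C) => (ρ_ X).hom }
  chi (X : C) (Y : C) (Z : C) (W : C) :=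
    prod.lift ((prod.fst : X ⨯ Y ⟶ X) ⊗ₘ (prod.fst : Z ⨯ W ⟶ Z))
      ((prod.snd : X ⨯ Y ⟶ Y) ⊗ₘ (prod.snd : Z ⨯ W ⟶ W))
  mu _ _ := terminal.from ((⊤_ C) ⊗ (⊤_ C))
  delta _ _ := prod.lift (𝟙 (𝟙_ C)) (𝟙 (𝟙_ C))
  tau _ := terminal.from (𝟙_ C)

variable {C}

/-! ### The embedding `F` -/

/-- The one-element set. -/
abbrev pt : Type w := PUnit.{w + 1}

/-- The `1 × 1` matrix with entry `X`. -/
def single (X : C) : pt.{w} → pt.{w} → C := fun _ _ => X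

/-- The morphism of `1 × 1` matrices given by a morphism. -/
def singleHom {X Y : C} (f : X ⟶ Y) : MatHom (single.{u, w} X) (single.{u, w} Y) :=
  ⟨fun a => a, fun b => b, fun _ _ => f⟩

/-- The span of matrices `[1] ← [X] → [1]`. -/
noncomputable def singleSq (X : C) :
    MatSq (Spn.unit pt.{w}) (Spn.unit pt.{w}) (single (⊤_ C)) (single (⊤_ C)) :=
  ⟨single X, fun _ _ => terminal.from X, fun _ _ => terminal.from X⟩

/-- The morphism from any matrix to the `1 × 1` matrix with terminal entry. -/
noncomputable def toPt {A B : Type w} (M : A → B → C) : MatHom M (single (⊤_ C)) :=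
  ⟨fun _ => ⟨⟩, fun _ => ⟨⟩, fun a b => terminal.from (M a b)⟩

theorem toPt_unique {A B : Type w} {M : A → B → C} (φ ψ : MatHom M (single (⊤_ C))) : φ = ψ :=
  MatHom.ext_re (fun _ => rfl) (fun _ => rfl) fun _ _ => terminal.hom_ext _ _

variable [HasCoproducts.{w} C]
  [∀ (X : C) (J : Type w), PreservesColimitsOfShape (Discrete J) (tensorLeft X)]
  [∀ (X : C) (J : Type w), PreservesColimitsOfShape (Discrete J) (tensorRight X)]

/-- The unique morphism to the identity span of the one-element set. -/
def Spn.toPt {A B : Type w} (h : Spn A B) : SpnHom h (Spn.unit pt.{w}) :=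
  ⟨fun _ => ⟨⟩, fun _ => ⟨⟩, fun _ => ⟨⟩, fun _ => rfl, fun _ => rfl⟩

/-- A cube to `[1] ← [X] → [1]` is given by its middle component. -/
noncomputable def cubeTo {A B A₁ B₁ : Type w} {h : Spn A B} {k : Spn A₁ B₁} {x : A → A₁ → C}
    {y : B → B₁ → C} (α : MatSq h k x y) (X : C) (f : MatHom α.mat (single X)) :
    MatCube α (singleSq X) :=
  ⟨toPt x, f, toPt y, toPt_unique _ _, toPt_unique _ _⟩

/-- The comparison `[X × Y] → [X] ×_{[1]} [Y]`. -/
noncomputable def singleProd (X Y : C) :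
    MatCube (singleSq.{u, v, w} (X ⨯ Y)) ((singleSq X).hmul (singleSq Y)) :=
  ⟨toPt _, (singleSq X).lift (singleSq Y) (singleHom prod.fst) (singleHom prod.snd)
    (toPt_unique _ _), toPt _, toPt_unique _ _, toPt_unique _ _⟩

variable (C) in
/-- The comparison `[1] = [1]` of horizontal identities. -/
noncomputable def singleOne :
    MatCube (singleSq.{u, v, w} (⊤_ C)) (MatSq.hunit (single (⊤_ C))) :=
  ⟨toPt _, singleHom (𝟙 _), toPt _, toPt_unique _ _, toPt_unique _ _⟩

variable (C) in
/-- The embedding `F`. -/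
noncomputable def embF : ColaxLax (prodTensor C) (SM.{u, v, w} C) where
  T := (Functor.const (Discrete PUnit.{1})).obj (show SetOb.{w} from pt.{w})
  mH := { ar := fun _ => Spn.unit pt.{w}, cell := fun _ => SpnHom.one (Spn.unit pt.{w}) }
  mV := { ar := fun _ => single (⊤_ C), cell := fun _ => MatHom.id (single.{u, w} (⊤_ C)) }
  m :=
    { sq := fun (X : C) => singleSq.{u, v, w} X
      cube := fun f => cubeTo _ _ (singleHom.{u, v, w} (C := C) f) }
  hc :=
    { mul := fun _ _ => ⟨fun a => a, fun s => ⟨(s, s), rfl⟩, fun b => b, fun _ => rfl,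
        fun _ => rfl⟩
      unit := fun _ => SpnHom.one (Spn.unit pt.{w}) }
  hsc :=
    { mul := fun (X : C) (Y : C) => singleProd.{u, v, w} X Y
      unit := fun _ => singleOne.{u, v, w} C }
  vl :=
    { mul := fun _ _ => toPt.{u, v, w} (mulMat (single (⊤_ C)) (single (⊤_ C)))
      unit := fun _ => toPt.{u, v, w} (unitMat C pt.{w}) }
  vsl :=
    { mul := fun (X : C) (Y : C) => cubeTo ((singleSq.{u, v, w} X).vmul (singleSq Y)) (X ⊗ Y)
        ⟨fun a => a, fun b => b, fun _ _ => mulDesc fun _ => 𝟙 (X ⊗ Y)⟩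
      unit := fun _ => cubeTo (MatSq.vunit C (Spn.unit pt.{w})) (𝟙_ C)
        ⟨fun a => a, fun b => b, fun a b => unitDesc a b fun _ => 𝟙 (𝟙_ C)⟩ }

/-! ### The sum `G` -/

/-- The sum of all the entries of a matrix. -/
noncomputable def total {A B : Type w} (M : A → B → C) : C := ∐ fun p : A × B => M p.1 p.2

noncomputable def totalIn {A B : Type w} (M : A → B → C) (a : A) (b : B) : M a b ⟶ total M :=
  Sigma.ι (fun p : A × B => M p.1 p.2) (a, b)

noncomputable def totalDesc {A B : Type w} {M : A → B → C} {X : C}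
    (f : (a : A) → (b : B) → (M a b ⟶ X)) : total M ⟶ X :=
  Sigma.desc fun p => f p.1 p.2

/-- The action of a morphism of matrices on sums. -/
noncomputable def totalMap {A B A' B' : Type w} {M : A → B → C} {N : A' → B' → C}
    (φ : MatHom M N) : total M ⟶ total N :=
  totalDesc fun a b => φ.app a b ≫ totalIn N (φ.fst a) (φ.snd b)

variable (C) in
/-- The morphism `G`. -/
noncomputable def sumG : ColaxColax (SM.{u, v, w} C) (prodTensor C) where
  T := (Functor.const _).obj ⟨⟨⟩⟩
  mH := { ar := fun _ => ⟨⟩, cell := fun _ => ⟨⟩ }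
  mV := { ar := fun _ => ⟨⟩, cell := fun _ => ⟨⟩ }
  m :=
    { sq := fun α => total (MatSq.mat α)
      cube := fun Φ => totalMap (MatCube.mid Φ) }
  hc := { mul := fun _ _ => ⟨⟩, unit := fun _ => ⟨⟩ }
  hsc :=
    { mul := fun α β => prod.lift (totalMap (MatSq.p₁ α β)) (totalMap (MatSq.p₂ α β))
      unit := fun x => terminal.from (total (MatSq.hunit x).mat) }
  vc := { mul := fun _ _ => ⟨⟩, unit := fun _ => ⟨⟩ }
  vsc :=
    { mul := fun α β => totalDesc fun s u => mulDesc fun t =>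
        totalIn (MatSq.mat α) s t ⊗ₘ totalIn (MatSq.mat β) t u
      unit := fun h => totalDesc fun s s' =>
        unitDesc (A := Spn.apex h) s s' fun _ => 𝟙 (𝟙_ C) }

/-! ### The double cells `α` and `β` -/

variable (C) in
/-- The double cell `α : GF → id`, the identification of the sum of the only entry of a `1 × 1`
matrix with this entry. -/
noncomputable def cellα :
    DblCell (embF.{u, v, w} C) (ColaxColax.id (prodTensor C)) (sumG.{u, v, w} C)
      (ColaxLax.id (prodTensor C)) where
  ob _ := eqToHom (Subsingleton.elim (α := Discrete PUnit.{1}) _ _)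
  hor _ := ⟨⟩
  ver _ := ⟨⟩
  sq := fun (X : C) => totalDesc (M := single.{u, w} X) fun _ _ => 𝟙 X

variable (C) in
/-- The double cell `β : id → FG`, given by the coproduct injections. -/
noncomputable def cellβ :
    DblCell (ColaxLax.id (SM.{u, v, w} C)) (sumG.{u, v, w} C) (ColaxColax.id (SM.{u, v, w} C))
      (embF.{u, v, w} C) where
  ob _ := fun _ => PUnit.unit
  hor h := Spn.toPt h
  ver x := toPt x
  sq α := cubeTo α (total (MatSq.mat α))
    ⟨fun _ => ⟨⟩, fun _ => ⟨⟩, fun s t => totalIn (MatSq.mat α) s t⟩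

end Duoidal

end Intercat

/-! Vertical composition is built from colimits (coproducts, over which ⊗ distributes) and
horizontal composition from limits (pullbacks of matrices, products in `C`); χ and δ are the
canonical comparisons between the two. So every law is checked by restricting maps out of a matrix
product to summands and by projecting maps into a horizontal composite.

Vertical laws. Tensoring on either side preserves coproducts, so a map out of an iterated matrix
product is determined on the summands M_ab ⊗ N_bd ⊗ P_de, and likewise for more factors
(`mulMul_ext`, `mulMulMul_ext`). The empty coproduct is preserved too, so an identity matrix
contributes only its diagonal (`unitR_ext`, `unitL_ext`). On summands the laws become naturality,
pentagon and triangle in `C` (`assocMat_pentagon`, `assocMat_triangle`). A span of matrices is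
multiplied component by component, so the vertical laws of `SM` are three copies of those for
matrices.

Horizontal laws. The projections of a pullback are jointly monic (`MatSq.lift_ext`), and all
structural cubes are computed by them.

Interchange. `MatSq.chi_p₁`, `MatSq.chi_p₂`, `MatSq.delta_p₁` and `MatSq.delta_p₂` say that
projecting turns χ into a product of projections and δ into a re-indexing of identity matrices. The
coherence conditions then reduce to functoriality of `mulHom` and `unitHom`, or to naturality of
`assocMat`, `lamMat` and `rhoMat` at projections. In `SM` the cubes μ and τ are identities. For
`prodTensor` the same arguments work with products, and μ, τ land in a terminal object.

F. The matrix [1] is terminal (`toPt_unique`), so a cube into a span of matrices with feet [1] is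
determined by its middle component (`MatCube.ext_pt`); this gives fullness. A pullback over [1] is a
product, so F is strong horizontally. Vertically the feet contribute 1 ⊗ 1 → 1 and I → 1, which are
not invertible in general, so F is only lax.

G. The sum of the entries of M N involves only the M_ab ⊗ N_bd with a common index b, and the tensor
products of injections map it to the tensor product of the two sums (`totalMul`); hence the
direction of the vertical comparison. Horizontally one sums along the two projections (`totalProd`).

Conjointness. A morphism from M to the 1 × 1 matrix [X] is a cocone on the entries of M, that is, a
map from their sum to X. Thus β consists of the coproduct injections (`totalCone`) and α collapses a
sum with one term (`collapse`). The triangle equalities express that an injection followed by an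
induced map is the given component. Coherence of β is `sqCone_hmul`, `totalCone_mul` and
`totalCone_unit`; that of α is `collapse_hmul`, `collapse_vmul` and `collapse_vunit`. -/

namespace Intercat

/-! ### Coherence of matrix multiplication, from distributivity of ⊗ over coproducts. -/

section MatrixLemmas

variable {C : Type u} [Category.{v} C]

section Preservation

variable {D : Type u₁} [Category.{v₁} D] [HasCoproducts.{w} C]

/-- The images of the coproduct injections under a coproduct preserving functor are jointly
epimorphic. -/
theorem map_sigma_ext {J : Type w} (F : C ⥤ D) [PreservesColimitsOfShape (Discrete J) F] {f : J → C}
    {Y : D} {g g' : F.obj (∐ f) ⟶ Y}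
    (h : ∀ j, F.map (Sigma.ι f j) ≫ g = F.map (Sigma.ι f j) ≫ g') : g = g' :=
  (isColimitOfPreserves F (coproductIsCoproduct f)).hom_ext fun ⟨j⟩ => h j

/-- An arbitrary coproduct preserving functor is allowed so that composites of `tensorLeft` and
`tensorRight`, which arise for products of four matrices, are covered. -/
theorem map_mulIn_ext [MonoidalCategory C] {A B E : Type w} (F : C ⥤ D)
    [PreservesColimitsOfShape (Discrete B) F] {M : A → B → C} {N : B → E → C} {a : A} {e : E}
    {Y : D} {g g' : F.obj (mulMat M N a e) ⟶ Y}
    (h : ∀ b, F.map (mulIn M N a b e) ≫ g = F.map (mulIn M N a b e) ≫ g') : g = g' :=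
  map_sigma_ext F h

/-- On the diagonal `unitIn` is an isomorphism. Off the diagonal the entry is the empty coproduct,
which `F` preserves, so its image admits at most one map to any object. -/
theorem map_unitIn_ext [MonoidalCategory C] {A : Type w} (F : C ⥤ D)
    [PreservesColimitsOfShape (Discrete PEmpty.{w + 1}) F] {a a' : A} {Y : D}
    {g g' : F.obj (unitMat C A a a') ⟶ Y}
    (h : ∀ e : a = a', F.map (unitIn e) ≫ g = F.map (unitIn e) ≫ g') : g = g' := by
  by_cases e : a = a'
  · have := h e
    rwa [unitIn, cancel_epi] at this
  · rw [← cancel_epi (F.map (eqToHom (unitMat_neg e).symm))]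
    exact map_sigma_ext F fun x => x.elim

end Preservation

namespace MatHom

/-- When all index functions are identities no transport of indices intervenes, and the inverse laws
for associativity and units can be verified entry by entry. -/
theorem ext_iso_inv {A B : Type w} {M N : A → B → C} {x : (a : A) → (b : B) → (M a b ⟶ N a b)}
    {y : (a : A) → (b : B) → (N a b ⟶ M a b)} (h : ∀ a b, x a b ≫ y a b = 𝟙 _) :
    MatHom.comp (⟨fun a => a, fun b => b, x⟩ : MatHom M N) ⟨fun a => a, fun b => b, y⟩ =
      MatHom.id M :=
  mk_ext h

end MatHom

variable [MonoidalCategory C] [HasCoproducts.{w} C]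

theorem unitIn_desc_assoc {A : Type w} {a a' : A} (h : a = a') {X Y : C}
    (f : a = a' → (𝟙_ C ⟶ X)) (g : X ⟶ Y) : unitIn h ≫ unitDesc a a' f ≫ g = f h ≫ g := by
  rw [← Category.assoc, unitIn_desc]

theorem mulHom_comp' {A B D A' B' D' A'' B'' D'' : Type w} {M : A → B → C} {N : B → D → C}
    {M' : A' → B' → C} {N' : B' → D' → C} {M'' : A'' → B'' → C} {N'' : B'' → D'' → C}
    (φ : MatHom M M') (φ' : MatHom M' M'') (ψ : MatHom N N') (ψ' : MatHom N' N'')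
    (e : φ.snd = ψ.fst) (e' : φ'.snd = ψ'.fst) :
    (mulHom φ ψ e).comp (mulHom φ' ψ' e') =
      mulHom (φ.comp φ') (ψ.comp ψ') (MatHom.comp_match e e') :=
  mulHom_comp φ φ' ψ ψ' e e' _

section Right

variable [∀ (X : C) (J : Type w), PreservesColimitsOfShape (Discrete J) (tensorRight X)]

theorem mulIn_mulIn_assocApp {A B D E : Type w} (M : A → B → C) (N : B → D → C) (P : D → E → C)
    (a : A) (b : B) (d : D) (e : E) {X : C} (g : mulMat M (mulMat N P) a e ⟶ X) :
    (mulIn M N a b d ▷ P d e) ≫ mulIn (mulMat M N) P a d e ≫ assocApp M N P a e ≫ g =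
      (α_ (M a b) (N b d) (P d e)).hom ≫ (M a b ◁ mulIn N P b d e) ≫
        mulIn M (mulMat N P) a b e ≫ g := by
  have := ι_assocApp M N P a b d e =≫ g
  simpa only [Category.assoc] using this

/-- The three coproducts are peeled off from the outside: the last one directly, the next because −
⊗ Q_eg preserves it, the innermost because the composite of − ⊗ P_de and − ⊗ Q_eg does. -/
theorem mulMulMul_ext {A B D E G : Type w} {M : A → B → C} {N : B → D → C} {P : D → E → C}
    {Q : E → G → C} {a : A} {g : G} {X : C}
    {f f' : mulMat (mulMat (mulMat M N) P) Q a g ⟶ X}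
    (h : ∀ b d e, ((mulIn M N a b d ▷ P d e) ▷ Q e g) ≫ (mulIn (mulMat M N) P a d e ▷ Q e g) ≫
        mulIn (mulMat (mulMat M N) P) Q a e g ≫ f =
      ((mulIn M N a b d ▷ P d e) ▷ Q e g) ≫ (mulIn (mulMat M N) P a d e ▷ Q e g) ≫
        mulIn (mulMat (mulMat M N) P) Q a e g ≫ f') : f = f' :=
  mul_ext fun e => descR_ext fun d =>
    map_mulIn_ext (tensorRight (P d e) ⋙ tensorRight (Q e g)) fun b => h b d e

/-- On the summand ((M_ab ⊗ N_bd) ⊗ P_de) ⊗ Q_eg each step is an associator of `C` followed by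
injections. Sliding the injections to the end by naturality leaves the pentagon of `C`. -/
theorem assocMat_pentagon {A B D E G : Type w} (M : A → B → C) (N : B → D → C) (P : D → E → C)
    (Q : E → G → C) :
    (mulHom (assocMat M N P) (MatHom.id Q) rfl).comp ((assocMat M (mulMat N P) Q).comp
        (mulHom (MatHom.id M) (assocMat N P Q) rfl)) =
      (assocMat (mulMat M N) P Q).comp (assocMat M N (mulMat P Q)) := by
  refine MatHom.mk_ext fun a g => mulMulMul_ext fun b d e => ?_
  dsimp only [mulHom, MatHom.comp, assocMat, MatHom.id]
  simp only [MatHom.re_rfl, Category.comp_id, mulIn_desc_assoc, Category.assoc, tensorHom_id,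
    id_tensorHom]
  have h₁ := ι_assocApp M N P a b d e
  -- The value of the associativity on a summand, tensored with Q_eg and followed by an arbitrary
  -- map, so that it can be used inside a longer composite.
  have h₂ := fun (X : C) (f : _ ⟶ X) =>
    congrArg (fun t => (t ▷ Q e g) ≫ f) h₁
  simp only [comp_whiskerRight, Category.assoc] at h₂
  rw [h₂, mulIn_mulIn_assocApp, mulIn_desc]
  -- The injections of M_ab ⊗ N_bd and of P_de ⊗ Q_eg are exchanged, so that the associativity for
  -- M, N and P Q meets a summand it can be evaluated on.
  rw [mulIn_mulIn_assocApp, associator_naturality_left_assoc, ← whisker_exchange_assoc]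
  rw [ι_assocApp M N (mulMat P Q), associator_naturality_middle_assoc]
  have h₃ := fun (X : C) (f : _ ⟶ X) =>
    congrArg (fun t => (M a b ◁ t) ≫ f) (ι_assocApp N P Q b d e g)
  simp only [whiskerLeft_comp, Category.assoc] at h₃
  rw [h₃, pentagon_assoc, associator_naturality_right_assoc]

theorem assocApp_comp_mulDesc {A B D E : Type w} (M : A → B → C) (N : B → D → C)
    (P : D → E → C) (a : A) (b : B) (d : D) (e : E) {X : C}
    (f : ∀ b, M a b ⊗ mulMat N P b e ⟶ X) :
    (mulIn M N a b d ▷ P d e) ≫ mulIn (mulMat M N) P a d e ≫ assocApp M N P a e ≫ mulDesc f =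
      (α_ (M a b) (N b d) (P d e)).hom ≫ (M a b ◁ mulIn N P b d e) ≫ f b := by
  rw [mulIn_mulIn_assocApp, mulIn_desc]

end Right

section Left

variable [∀ (X : C) (J : Type w), PreservesColimitsOfShape (Discrete J) (tensorLeft X)]

theorem ι_descL {J : Type w} {f : J → C} {X Y : C} (g : (j : J) → (X ⊗ f j ⟶ Y)) (j : J) :
    X ◁ Sigma.ι f j ≫ descL g = g j := by
  have h : X ◁ Sigma.ι f j = Sigma.ι (fun j => (tensorLeft X).obj (f j)) j ≫
      sigmaComparison (tensorLeft X) f := (ι_comp_sigmaComparison (tensorLeft X) f j).symm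
  rw [h, descL, Category.assoc, IsIso.hom_inv_id_assoc]
  exact Sigma.ι_desc _ _

/-- A morphism out of the tensor product of `X` with an entry of a product of matrices. -/
noncomputable def mulDescL {B D E : Type w} {N : B → D → C} {P : D → E → C} {b : B} {e : E}
    {X Y : C} (g : (d : D) → (X ⊗ (N b d ⊗ P d e) ⟶ Y)) : X ⊗ mulMat N P b e ⟶ Y :=
  descL g

theorem mulIn_descL {B D E : Type w} {N : B → D → C} {P : D → E → C} {b : B} {e : E}
    {X Y : C} (g : (d : D) → (X ⊗ (N b d ⊗ P d e) ⟶ Y)) (d : D) :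
    (X ◁ mulIn N P b d e) ≫ mulDescL g = g d :=
  ι_descL g d

/-- The inverse of the associativity isomorphism of matrix multiplication. -/
noncomputable def assocInvApp {A B D E : Type w} (M : A → B → C) (N : B → D → C) (P : D → E → C)
    (a : A) (e : E) : mulMat M (mulMat N P) a e ⟶ mulMat (mulMat M N) P a e :=
  mulDesc fun b => mulDescL fun d =>
    (α_ (M a b) (N b d) (P d e)).inv ≫ (mulIn M N a b d ▷ P d e) ≫ mulIn (mulMat M N) P a d e

theorem ι_assocInvApp {A B D E : Type w} (M : A → B → C) (N : B → D → C) (P : D → E → C)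
    (a : A) (b : B) (d : D) (e : E) {X : C} (f : mulMat (mulMat M N) P a e ⟶ X) :
    (M a b ◁ mulIn N P b d e) ≫ mulIn M (mulMat N P) a b e ≫ assocInvApp M N P a e ≫ f =
      (α_ (M a b) (N b d) (P d e)).inv ≫ (mulIn M N a b d ▷ P d e) ≫
        mulIn (mulMat M N) P a d e ≫ f := by
  rw [assocInvApp, mulIn_desc_assoc, ← Category.assoc, mulIn_descL, Category.assoc, Category.assoc]

theorem mulMul_ext' {A B D E : Type w} {M : A → B → C} {N : B → D → C} {P : D → E → C}
    {a : A} {e : E} {X : C} {f g : mulMat M (mulMat N P) a e ⟶ X}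
    (h : ∀ b d, (M a b ◁ mulIn N P b d e) ≫ mulIn M (mulMat N P) a b e ≫ f =
      (M a b ◁ mulIn N P b d e) ≫ mulIn M (mulMat N P) a b e ≫ g) : f = g :=
  mul_ext fun b => descL_ext fun d => h b d

end Left

section Both

variable [∀ (X : C) (J : Type w), PreservesColimitsOfShape (Discrete J) (tensorLeft X)]
  [∀ (X : C) (J : Type w), PreservesColimitsOfShape (Discrete J) (tensorRight X)]

/-- The inverse of `assocMat`. -/
noncomputable def assocMatInv {A B D E : Type w} (M : A → B → C) (N : B → D → C) (P : D → E → C) :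
    MatHom (mulMat M (mulMat N P)) (mulMat (mulMat M N) P) :=
  ⟨fun a => a, fun e => e, assocInvApp M N P⟩

/-- On each summand the two maps are the associator of `C` and its inverse, up to the same
injections. -/
theorem assocMat_hom_inv {A B D E : Type w} (M : A → B → C) (N : B → D → C) (P : D → E → C) :
    (assocMat M N P).comp (assocMatInv M N P) = MatHom.id _ :=
  MatHom.ext_iso_inv fun a e => mulMul_ext fun b d => by
    have := ι_assocInvApp M N P a b d e (𝟙 _)
    simp only [Category.comp_id] at this
    rw [mulIn_mulIn_assocApp, this, Iso.hom_inv_id_assoc, Category.comp_id]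

theorem assocMat_inv_hom {A B D E : Type w} (M : A → B → C) (N : B → D → C) (P : D → E → C) :
    (assocMatInv M N P).comp (assocMat M N P) = MatHom.id _ :=
  MatHom.ext_iso_inv fun a e => mulMul_ext' fun b d => by
    rw [ι_assocInvApp, ι_assocApp, Iso.inv_hom_id_assoc, Category.comp_id]

/-- A summand of (M 1) N with two different middle indices contains 0 as a tensor factor, hence is
itself an empty coproduct and imposes no condition. -/
theorem mulMat_unitMat_mulMat_ext {A B E : Type w} {M : A → B → C} {N : B → E → C} {a : A} {e : E}
    {X : C} {f g : mulMat (mulMat M (unitMat C B)) N a e ⟶ X}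
    (h : ∀ b, ((M a b ◁ unitIn rfl) ▷ N b e) ≫ (mulIn M (unitMat C B) a b b ▷ N b e) ≫
        mulIn (mulMat M (unitMat C B)) N a b e ≫ f =
      ((M a b ◁ unitIn rfl) ▷ N b e) ≫ (mulIn M (unitMat C B) a b b ▷ N b e) ≫
        mulIn (mulMat M (unitMat C B)) N a b e ≫ g) : f = g :=
  mulMul_ext fun b d => map_unitIn_ext (tensorLeft (M a b) ⋙ tensorRight (N d e)) fun h' => by
    subst h'
    exact h b

theorem unit_ι_lamApp {A B : Type w} (M : A → B → C) (a : A) (b : B) {X : C} (f : M a b ⟶ X) :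
    (unitIn rfl ▷ M a b) ≫ mulIn (unitMat C A) M a a b ≫ (lamMat M).app a b ≫ f =
      (λ_ (M a b)).hom ≫ f := by
  dsimp only [lamMat]
  rw [mulIn_desc_assoc, ← Category.assoc, unitIn_descR]
  simp

theorem unit_ι_rhoApp {A B : Type w} (M : A → B → C) (a : A) (b : B) {X : C} (f : M a b ⟶ X) :
    (M a b ◁ unitIn rfl) ≫ mulIn M (unitMat C B) a b b ≫ (rhoMat M).app a b ≫ f =
      (ρ_ (M a b)).hom ≫ f := by
  dsimp only [rhoMat]
  rw [mulIn_desc_assoc, ← Category.assoc, unitIn_descL]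
  simp

theorem unit_ι_lam {A B : Type w} (M : A → B → C) (a : A) (b : B) :
    (unitIn rfl ▷ M a b) ≫ mulIn (unitMat C A) M a a b ≫ (lamMat M).app a b = (λ_ (M a b)).hom := by
  dsimp only [lamMat]
  rw [mulIn_desc, unitIn_descR]
  simp

theorem unit_ι_rho {A B : Type w} (M : A → B → C) (a : A) (b : B) :
    (M a b ◁ unitIn rfl) ≫ mulIn M (unitMat C B) a b b ≫ (rhoMat M).app a b = (ρ_ (M a b)).hom := by
  dsimp only [rhoMat]
  rw [mulIn_desc, unitIn_descL]
  simp

/-- Of the sum defining an entry of 1 M only the summand I ⊗ M_ab survives; `mulUnit_ext` is the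
mirror image. These two carry all verifications about unit isomorphisms. -/
theorem unitMul_ext {A B : Type w} {M : A → B → C} {a : A} {b : B} {X : C}
    {f g : mulMat (unitMat C A) M a b ⟶ X}
    (h : (unitIn rfl ▷ M a b) ≫ mulIn (unitMat C A) M a a b ≫ f =
      (unitIn rfl ▷ M a b) ≫ mulIn (unitMat C A) M a a b ≫ g) : f = g :=
  mul_ext fun a' => unitR_ext fun e => by
    subst e
    exact h

theorem mulUnit_ext {A B : Type w} {M : A → B → C} {a : A} {b : B} {X : C}
    {f g : mulMat M (unitMat C B) a b ⟶ X}
    (h : (M a b ◁ unitIn rfl) ≫ mulIn M (unitMat C B) a b b ≫ f =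
      (M a b ◁ unitIn rfl) ≫ mulIn M (unitMat C B) a b b ≫ g) : f = g :=
  mul_ext fun b' => unitL_ext fun e => by
    subst e
    exact h

/-- Only the summands (M_ab ⊗ I) ⊗ N_bd matter, and there the claim is the triangle of `C`. -/
theorem assocMat_triangle {A B D : Type w} (M : A → B → C) (N : B → D → C) :
    (assocMat M (unitMat C B) N).comp (mulHom (MatHom.id M) (lamMat N) rfl) =
      mulHom (rhoMat M) (MatHom.id N) rfl := by
  refine MatHom.mk_ext fun a d => mulMat_unitMat_mulMat_ext fun b => ?_
  dsimp only [mulHom, MatHom.comp, assocMat]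
  rw [assocApp_comp_mulDesc]
  refine Eq.trans ?_ (congrArg (CategoryStruct.comp _) (congrArg (CategoryStruct.comp _)
    (mulIn_desc _ b))).symm
  -- The unit isomorphisms enter only through their values on the diagonal summands, so they are
  -- replaced by arbitrary `l` and `r` with these values.
  have key : ∀ (l : mulMat (unitMat C B) N b d ⟶ N b d) (r : mulMat M (unitMat C B) a b ⟶ M a b)
      (_ : (unitIn rfl ▷ N b d) ≫ mulIn (unitMat C B) N b b d ≫ l = (λ_ (N b d)).hom)
      (_ : (M a b ◁ unitIn rfl) ≫ mulIn M (unitMat C B) a b b ≫ r = (ρ_ (M a b)).hom),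
      ((M a b ◁ unitIn rfl) ▷ N b d) ≫ (α_ (M a b) (unitMat C B b b) (N b d)).hom ≫
        (M a b ◁ mulIn (unitMat C B) N b b d) ≫ (𝟙 (M a b) ⊗ₘ (l ≫ 𝟙 _)) ≫ mulIn M N a b d =
      ((M a b ◁ unitIn rfl) ▷ N b d) ≫ (mulIn M (unitMat C B) a b b ▷ N b d) ≫
        (r ⊗ₘ (𝟙 (N b d) ≫ 𝟙 _)) ≫ mulIn M N a b d := by
    intro l r hl hr
    have h₃ := congrArg (fun t => (M a b ◁ t) ≫ mulIn M N a b d) hl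
    have h₄ := congrArg (fun t => (t ▷ N b d) ≫ mulIn M N a b d) hr
    simp only [whiskerLeft_comp, comp_whiskerRight, Category.assoc] at h₃ h₄
    simp only [Category.comp_id, tensorHom_id, id_tensorHom]
    rw [h₄, associator_naturality_middle_assoc, h₃, triangle_assoc]
  exact key _ _ (unit_ι_lam N b d) (unit_ι_rho M a b)

/-- The inverse of `lamMat`. -/
noncomputable def lamMatInv {A B : Type w} (M : A → B → C) : MatHom M (mulMat (unitMat C A) M) :=
  ⟨fun a => a, fun b => b, fun a b =>
    (λ_ (M a b)).inv ≫ (unitIn rfl ▷ M a b) ≫ mulIn (unitMat C A) M a a b⟩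

/-- The inverse of `rhoMat`. -/
noncomputable def rhoMatInv {A B : Type w} (M : A → B → C) : MatHom M (mulMat M (unitMat C B)) :=
  ⟨fun a => a, fun b => b, fun a b =>
    (ρ_ (M a b)).inv ≫ (M a b ◁ unitIn rfl) ≫ mulIn M (unitMat C B) a b b⟩

theorem lamMat_hom_inv {A B : Type w} (M : A → B → C) :
    (lamMat M).comp (lamMatInv M) = MatHom.id _ :=
  MatHom.ext_iso_inv fun a b => unitMul_ext <| by
    refine (unit_ι_lamApp M a b _).trans ?_
    rw [Iso.hom_inv_id_assoc, Category.comp_id]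

theorem lamMat_inv_hom {A B : Type w} (M : A → B → C) :
    (lamMatInv M).comp (lamMat M) = MatHom.id _ :=
  MatHom.ext_iso_inv fun a b => by
    rw [Category.assoc, Category.assoc]
    exact (congrArg _ (unit_ι_lam M a b)).trans (Iso.inv_hom_id _)

theorem rhoMat_hom_inv {A B : Type w} (M : A → B → C) :
    (rhoMat M).comp (rhoMatInv M) = MatHom.id _ :=
  MatHom.ext_iso_inv fun a b => mulUnit_ext <| by
    refine (unit_ι_rhoApp M a b _).trans ?_
    rw [Iso.hom_inv_id_assoc, Category.comp_id]

theorem rhoMat_inv_hom {A B : Type w} (M : A → B → C) :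
    (rhoMatInv M).comp (rhoMat M) = MatHom.id _ :=
  MatHom.ext_iso_inv fun a b => by
    rw [Category.assoc, Category.assoc]
    exact (congrArg _ (unit_ι_rho M a b)).trans (Iso.inv_hom_id _)

end Both

end MatrixLemmas

/-! ### The weak double categories of spans and of matrices, and the vertical structure of `SM`. -/

section Doubles

theorem SpnHom.ext {A B A' B' : Type w} {h : Spn A B} {h' : Spn A' B'} {φ ψ : SpnHom h h'}
    (h₁ : φ.fst = ψ.fst) (h₂ : φ.mid = ψ.mid) (h₃ : φ.snd = ψ.snd) : φ = ψ := by
  obtain ⟨_, _, _, _, _⟩ := φ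
  obtain ⟨_, _, _, _, _⟩ := ψ
  dsimp only at h₁ h₂ h₃
  subst h₁ h₂ h₃
  rfl

/-- Composites of spans are subsets of products and all structural maps only rearrange elements, so
nearly all laws hold definitionally. The exceptions are the unit isomorphisms, whose invertibility
uses the equation defining the pullback: one coordinate is the image of the other. -/
theorem spanDbl_isDbl : spanDbl.{w}.IsDbl where
  dom_one _ := rfl
  cod_one _ := rfl
  dom_comp _ _ := rfl
  cod_comp _ _ := rfl
  one_comp _ := rfl
  comp_one _ := rfl
  comp_assoc _ _ _ := rfl
  dom_unitCell _ := rfl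
  cod_unitCell _ := rfl
  unitCell_id _ := rfl
  unitCell_comp _ _ := rfl
  dom_mulCell _ _ _ := rfl
  cod_mulCell _ _ _ := rfl
  mulCell_one _ _ _ := rfl
  mulCell_comp _ _ _ _ _ _ _ := rfl
  dom_assoc _ _ _ := rfl
  cod_assoc _ _ _ := rfl
  dom_lam _ := rfl
  cod_lam _ := rfl
  dom_rho _ := rfl
  cod_rho _ := rfl
  assoc_inv _ _ _ := ⟨⟨fun a => a, fun p => ⟨(⟨(p.1.1, p.1.2.1.1), p.2⟩, p.1.2.1.2), p.1.2.2⟩,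
    fun d => d, fun _ => rfl, fun _ => rfl⟩, rfl, rfl⟩
  lam_inv h := ⟨⟨fun a => a, fun s => ⟨(h.l s, s), rfl⟩, fun b => b, fun _ => rfl, fun _ => rfl⟩,
    SpnHom.ext rfl (funext fun p => Subtype.ext (Prod.ext p.2.symm rfl)) rfl, rfl⟩
  rho_inv h := ⟨⟨fun a => a, fun s => ⟨(s, h.r s), rfl⟩, fun b => b, fun _ => rfl, fun _ => rfl⟩,
    SpnHom.ext rfl (funext fun p => Subtype.ext (Prod.ext rfl p.2)) rfl, rfl⟩
  assoc_nat _ _ _ _ _ _ _ := rfl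
  lam_nat _ _ := rfl
  rho_nat _ _ := rfl
  pentagon _ _ _ _ _ _ := rfl
  triangle _ _ _ _ := SpnHom.ext rfl
    (funext fun _ => Subtype.ext (Prod.ext rfl rfl)) rfl

variable (C : Type u) [Category.{v} C] [MonoidalCategory C] [HasCoproducts.{w} C]
  [∀ (X : C) (J : Type w), PreservesColimitsOfShape (Discrete J) (tensorLeft X)]
  [∀ (X : C) (J : Type w), PreservesColimitsOfShape (Discrete J) (tensorRight X)]

theorem matDbl_isDbl : (matDbl.{u, v, w} C).IsDbl where
  dom_one _ := rfl
  cod_one _ := rfl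
  dom_comp _ _ := rfl
  cod_comp _ _ := rfl
  one_comp φ := MatHom.id_comp φ
  comp_one φ := MatHom.comp_id φ
  comp_assoc φ ψ ω := MatHom.comp_assoc φ ψ ω
  dom_unitCell _ := rfl
  cod_unitCell _ := rfl
  unitCell_id A := unitHom_id A
  unitCell_comp f g := (unitHom_comp f g).symm
  dom_mulCell _ _ _ := rfl
  cod_mulCell _ _ _ := rfl
  mulCell_one M N _ := mulHom_id M N
  mulCell_comp φ φ' ψ ψ' e e' e'' := (mulHom_comp φ φ' ψ ψ' e e' e'').symm
  dom_assoc _ _ _ := rfl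
  cod_assoc _ _ _ := rfl
  dom_lam _ := rfl
  cod_lam _ := rfl
  dom_rho _ := rfl
  cod_rho _ := rfl
  assoc_inv M N P := ⟨assocMatInv M N P, assocMat_hom_inv M N P, assocMat_inv_hom M N P⟩
  lam_inv M := ⟨lamMatInv M, lamMat_hom_inv M, lamMat_inv_hom M⟩
  rho_inv M := ⟨rhoMatInv M, rhoMat_hom_inv M, rhoMat_inv_hom M⟩
  assoc_nat φ ψ ω e₁ _ e₃ _ := assocMat_nat φ ψ ω e₁ e₃
  lam_nat φ _ := lamMat_nat φ
  rho_nat φ _ := rhoMat_nat φ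
  pentagon M N P Q _ _ := assocMat_pentagon M N P Q
  triangle M N _ _ := assocMat_triangle M N

theorem MatCube.ext {C : Type u} [Category.{v} C] {A B A₁ B₁ A' B' A₁' B₁' : Type w} {h : Spn A B}
    {k : Spn A₁ B₁} {x : A → A₁ → C} {y : B → B₁ → C} {h' : Spn A' B'} {k' : Spn A₁' B₁'}
    {x' : A' → A₁' → C} {y' : B' → B₁' → C} {α : MatSq h k x y} {α' : MatSq h' k' x' y'}
    {Φ Ψ : MatCube α α'} (h₁ : Φ.left = Ψ.left) (h₂ : Φ.mid = Ψ.mid) (h₃ : Φ.right = Ψ.right) :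
    Φ = Ψ := by
  obtain ⟨_, _, _, _, _⟩ := Φ
  obtain ⟨_, _, _, _, _⟩ := Ψ
  dsimp only at h₁ h₂ h₃
  subst h₁ h₂ h₃
  rfl

/-- Inverses of the components of a cube assemble to an inverse cube. -/
theorem MatCube.exists_inv {C : Type u} [Category.{v} C] {A B A₁ B₁ A' B' A₁' B₁' : Type w}
    {h : Spn A B} {k : Spn A₁ B₁} {x : A → A₁ → C} {y : B → B₁ → C} {h' : Spn A' B'}
    {k' : Spn A₁' B₁'} {x' : A' → A₁' → C} {y' : B' → B₁' → C} {α : MatSq h k x y}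
    {α' : MatSq h' k' x' y'} (Φ : MatCube α α') {l : MatHom x' x} {m : MatHom α'.mat α.mat}
    {r : MatHom y' y} (hl : Φ.left.comp l = MatHom.id _) (lh : l.comp Φ.left = MatHom.id _)
    (hm : Φ.mid.comp m = MatHom.id _) (mh : m.comp Φ.mid = MatHom.id _)
    (hr : Φ.right.comp r = MatHom.id _) (rh : r.comp Φ.right = MatHom.id _) :
    ∃ Ψ : MatCube α' α, Φ.comp Ψ = MatCube.one α ∧ Ψ.comp Φ = MatCube.one α' := by
  refine ⟨⟨l, m, r, ?_, ?_⟩, MatCube.ext hl hm hr, MatCube.ext lh mh rh⟩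
  -- Inserting `m.comp Φ.mid`, an identity, in front makes the commutative square of `Φ` applicable,
  -- after which `Φ.left` and `l` cancel.
  · rw [← MatHom.id_comp (α'.L.comp l), ← mh, MatHom.comp_assoc, ← MatHom.comp_assoc Φ.mid,
      ← Φ.comm_l, MatHom.comp_assoc, hl, MatHom.comp_id]
  · rw [← MatHom.id_comp (α'.R.comp r), ← mh, MatHom.comp_assoc, ← MatHom.comp_assoc Φ.mid,
      ← Φ.comm_r, MatHom.comp_assoc, hr, MatHom.comp_id]

theorem spanMatSq_isSq : IsSq (spanMatSq.{u, v, w} C) where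
  corner_tl _ := rfl
  corner_tr _ := rfl
  corner_bl _ := rfl
  corner_br _ := rfl
  one_special _ := ⟨rfl, rfl, rfl, rfl⟩
  faces_comp _ _ := ⟨rfl, rfl, rfl, rfl⟩
  one_comp _ := MatCube.ext (MatHom.id_comp _) (MatHom.id_comp _) (MatHom.id_comp _)
  comp_one _ := MatCube.ext (MatHom.comp_id _) (MatHom.comp_id _) (MatHom.comp_id _)
  comp_assoc _ _ _ := MatCube.ext (MatHom.comp_assoc _ _ _) (MatHom.comp_assoc _ _ _)
    (MatHom.comp_assoc _ _ _)

/-- The two feet and the middle matrix of a vertical composite are matrix products, and a cube is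
determined by its three components. Hence each law is three instances of the corresponding law for
matrices. -/
theorem SM_isVStr [HasPullbacks C] : IsHStr (SM.{u, v, w} C).vs where
  faces_unitCube _ := ⟨rfl, rfl, rfl, rfl⟩
  unitCube_one _ := MatCube.ext (unitHom_id _) (unitHom_id _) (unitHom_id _)
  unitCube_comp φ ψ := MatCube.ext (unitHom_comp (SpnHom.fst φ) (SpnHom.fst ψ)).symm
    (unitHom_comp (SpnHom.mid φ) (SpnHom.mid ψ)).symm
    (unitHom_comp (SpnHom.snd φ) (SpnHom.snd ψ)).symm
  faces_mulCube _ _ _ _ _ := ⟨rfl, rfl, rfl, rfl⟩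
  mulCube_one _ _ _ := MatCube.ext (mulHom_id _ _) (mulHom_id _ _) (mulHom_id _ _)
  mulCube_comp _ _ _ _ e e' _ := MatCube.ext
    (mulHom_comp' _ _ _ _ (congrArg SpnHom.fst e) (congrArg SpnHom.fst e')).symm
    (mulHom_comp' _ _ _ _ (congrArg SpnHom.mid e) (congrArg SpnHom.mid e')).symm
    (mulHom_comp' _ _ _ _ (congrArg SpnHom.snd e) (congrArg SpnHom.snd e')).symm
  faces_assoc _ _ _ := ⟨rfl, rfl, rfl, rfl⟩
  faces_lam _ := ⟨rfl, rfl, rfl, rfl⟩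
  faces_rho _ := ⟨rfl, rfl, rfl, rfl⟩
  assoc_inv _ _ _ := MatCube.exists_inv _
    (assocMat_hom_inv _ _ _) (assocMat_inv_hom _ _ _) (assocMat_hom_inv _ _ _)
    (assocMat_inv_hom _ _ _) (assocMat_hom_inv _ _ _) (assocMat_inv_hom _ _ _)
  lam_inv _ := MatCube.exists_inv _ (lamMat_hom_inv _) (lamMat_inv_hom _)
    (lamMat_hom_inv _) (lamMat_inv_hom _) (lamMat_hom_inv _) (lamMat_inv_hom _)
  rho_inv _ := MatCube.exists_inv _ (rhoMat_hom_inv _) (rhoMat_inv_hom _)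
    (rhoMat_hom_inv _) (rhoMat_inv_hom _) (rhoMat_hom_inv _) (rhoMat_inv_hom _)
  assoc_nat _ _ _ e₁ _ e₃ _ := MatCube.ext
    (assocMat_nat _ _ _ (congrArg SpnHom.fst e₁) (congrArg SpnHom.fst e₃))
    (assocMat_nat _ _ _ (congrArg SpnHom.mid e₁) (congrArg SpnHom.mid e₃))
    (assocMat_nat _ _ _ (congrArg SpnHom.snd e₁) (congrArg SpnHom.snd e₃))
  lam_nat _ _ := MatCube.ext (lamMat_nat _) (lamMat_nat _) (lamMat_nat _)
  rho_nat _ _ := MatCube.ext (rhoMat_nat _) (rhoMat_nat _) (rhoMat_nat _)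
  pentagon _ _ _ _ _ _ := MatCube.ext (assocMat_pentagon _ _ _ _) (assocMat_pentagon _ _ _ _)
    (assocMat_pentagon _ _ _ _)
  triangle _ _ _ _ := MatCube.ext (assocMat_triangle _ _) (assocMat_triangle _ _)
    (assocMat_triangle _ _)

end Doubles


/-! ### Horizontal composition of spans of matrices, by pullback. -/

section HorizontalLaws

variable {C : Type u} [Category.{v} C] [HasPullbacks C]
  {A B D E A₁ B₁ D₁ E₁ A' B' D' A₁' B₁' D₁' X Y : Type w}
  {h : Spn A B} {k : Spn B D} {l : Spn D E} {h₁ : Spn A₁ B₁} {k₁ : Spn B₁ D₁} {l₁ : Spn D₁ E₁}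
  {h' : Spn A' B'} {k' : Spn B' D'} {h₁' : Spn A₁' B₁'} {k₁' : Spn B₁' D₁'}
  {x : A → A₁ → C} {y : B → B₁ → C} {z : D → D₁ → C} {t : E → E₁ → C}
  {x' : A' → A₁' → C} {y' : B' → B₁' → C} {z' : D' → D₁' → C} {Q : X → Y → C}
  {α : MatSq h h₁ x y} {β : MatSq k k₁ y z} {γ : MatSq l l₁ z t}
  {α' : MatSq h' h₁' x' y'} {β' : MatSq k' k₁' y' z'}
  {A'' B'' D'' A₁'' B₁'' D₁'' E' E₁' G G₁ : Type w} {h'' : Spn A'' B''} {k'' : Spn B'' D''}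
  {h₁'' : Spn A₁'' B₁''} {k₁'' : Spn B₁'' D₁''} {l' : Spn D' E'} {l₁' : Spn D₁' E₁'}
  {m : Spn E G} {m₁ : Spn E₁ G₁} {x'' : A'' → A₁'' → C} {y'' : B'' → B₁'' → C}
  {z'' : D'' → D₁'' → C} {t' : E' → E₁' → C} {s : G → G₁ → C}
  {α'' : MatSq h'' h₁'' x'' y''} {β'' : MatSq k'' k₁'' y'' z''} {γ' : MatSq l' l₁' z' t'}

/-- The equations for projections stated from here on, together with their reassociated forms, serve
as a rewriting system: once `MatSq.lift_ext` has reduced a horizontal law to projections, both sides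
normalize to the same composite. -/
theorem MatCube.hmul_p₁ (Φ : MatCube α α') (Ψ : MatCube β β') (e : Φ.right = Ψ.left) :
    (Φ.hmul Ψ e).mid.comp (α'.p₁ β') = (α.p₁ β).comp Φ.mid := by
  rw [hmul, MatSq.lift_p₁]

theorem MatCube.hmul_p₂ (Φ : MatCube α α') (Ψ : MatCube β β') (e : Φ.right = Ψ.left) :
    (Φ.hmul Ψ e).mid.comp (α'.p₂ β') = (α.p₂ β).comp Ψ.mid := by
  rw [hmul, MatSq.lift_p₂]

theorem MatCube.hmul_p₁_assoc (Φ : MatCube α α') (Ψ : MatCube β β') (e : Φ.right = Ψ.left)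
    (ξ : MatHom α'.mat Q) :
    (Φ.hmul Ψ e).mid.comp ((α'.p₁ β').comp ξ) = (α.p₁ β).comp (Φ.mid.comp ξ) := by
  rw [← MatHom.comp_assoc, hmul_p₁, MatHom.comp_assoc]

theorem MatCube.hmul_p₂_assoc (Φ : MatCube α α') (Ψ : MatCube β β') (e : Φ.right = Ψ.left)
    (ξ : MatHom β'.mat Q) :
    (Φ.hmul Ψ e).mid.comp ((α'.p₂ β').comp ξ) = (α.p₂ β).comp (Ψ.mid.comp ξ) := by
  rw [← MatHom.comp_assoc, hmul_p₂, MatHom.comp_assoc]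

theorem MatSq.hassoc_p₁ (α : MatSq h h₁ x y) (β : MatSq k k₁ y z) (γ : MatSq l l₁ z t) :
    (α.hassoc β γ).mid.comp (α.p₁ (β.hmul γ)) = ((α.hmul β).p₁ γ).comp (α.p₁ β) :=
  hassocMid_p₁ α β γ

theorem MatSq.hassoc_p₁_assoc (α : MatSq h h₁ x y) (β : MatSq k k₁ y z) (γ : MatSq l l₁ z t)
    (ξ : MatHom α.mat Q) :
    (α.hassoc β γ).mid.comp ((α.p₁ (β.hmul γ)).comp ξ) =
      ((α.hmul β).p₁ γ).comp ((α.p₁ β).comp ξ) := by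
  rw [← MatHom.comp_assoc, hassoc_p₁, MatHom.comp_assoc]

theorem MatSq.hassoc_p₂_p₁ (α : MatSq h h₁ x y) (β : MatSq k k₁ y z) (γ : MatSq l l₁ z t) :
    (α.hassoc β γ).mid.comp ((α.p₂ (β.hmul γ)).comp (β.p₁ γ)) =
      ((α.hmul β).p₁ γ).comp (α.p₂ β) :=
  (MatHom.comp_assoc _ _ _).symm.trans (hassocMid_p₂_p₁ α β γ)

theorem MatSq.hassoc_p₂_p₁_assoc (α : MatSq h h₁ x y) (β : MatSq k k₁ y z) (γ : MatSq l l₁ z t)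
    (ξ : MatHom β.mat Q) :
    (α.hassoc β γ).mid.comp ((α.p₂ (β.hmul γ)).comp ((β.p₁ γ).comp ξ)) =
      ((α.hmul β).p₁ γ).comp ((α.p₂ β).comp ξ) := by
  rw [← MatHom.comp_assoc (α.p₂ (β.hmul γ)), ← MatHom.comp_assoc, hassoc_p₂_p₁, MatHom.comp_assoc]

theorem MatSq.hassoc_p₂_p₂ (α : MatSq h h₁ x y) (β : MatSq k k₁ y z) (γ : MatSq l l₁ z t) :
    (α.hassoc β γ).mid.comp ((α.p₂ (β.hmul γ)).comp (β.p₂ γ)) = (α.hmul β).p₂ γ :=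
  (MatHom.comp_assoc _ _ _).symm.trans (hassocMid_p₂_p₂ α β γ)

theorem MatSq.hassoc_p₂_p₂_assoc (α : MatSq h h₁ x y) (β : MatSq k k₁ y z) (γ : MatSq l l₁ z t)
    (ξ : MatHom γ.mat Q) :
    (α.hassoc β γ).mid.comp ((α.p₂ (β.hmul γ)).comp ((β.p₂ γ).comp ξ)) =
      ((α.hmul β).p₂ γ).comp ξ := by
  rw [← MatHom.comp_assoc (α.p₂ (β.hmul γ)), ← MatHom.comp_assoc, hassoc_p₂_p₂]

/-- The middle component of the inverse of the horizontal associativity. -/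
noncomputable def MatSq.hassocInvMid (α : MatSq h h₁ x y) (β : MatSq k k₁ y z)
    (γ : MatSq l l₁ z t) :
    MatHom (α.hmul (β.hmul γ)).mat ((α.hmul β).hmul γ).mat :=
  (α.hmul β).lift γ
    (α.lift β (α.p₁ (β.hmul γ)) ((α.p₂ (β.hmul γ)).comp (β.p₁ γ))
      (by rw [p_condition, hmul_L, MatHom.comp_assoc]))
    ((α.p₂ (β.hmul γ)).comp (β.p₂ γ))
    (by rw [hmul_R, ← MatHom.comp_assoc, lift_p₂, MatHom.comp_assoc, p_condition,
      MatHom.comp_assoc])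

theorem MatSq.hassocInvMid_p₁ (α : MatSq h h₁ x y) (β : MatSq k k₁ y z) (γ : MatSq l l₁ z t) :
    (α.hassocInvMid β γ).comp (((α.hmul β).p₁ γ).comp (α.p₁ β)) = α.p₁ (β.hmul γ) := by
  rw [← MatHom.comp_assoc, hassocInvMid, lift_p₁, lift_p₁]

theorem MatSq.hassocInvMid_p₁_p₂ (α : MatSq h h₁ x y) (β : MatSq k k₁ y z) (γ : MatSq l l₁ z t) :
    (α.hassocInvMid β γ).comp (((α.hmul β).p₁ γ).comp (α.p₂ β)) =
      (α.p₂ (β.hmul γ)).comp (β.p₁ γ) := by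
  rw [← MatHom.comp_assoc, hassocInvMid, lift_p₁, lift_p₂]

theorem MatSq.hassocInvMid_p₂ (α : MatSq h h₁ x y) (β : MatSq k k₁ y z) (γ : MatSq l l₁ z t) :
    (α.hassocInvMid β γ).comp ((α.hmul β).p₂ γ) = (α.p₂ (β.hmul γ)).comp (β.p₂ γ) := by
  rw [hassocInvMid, lift_p₂]

/-- A map into a threefold composite is tested on its three projections, and the associativity and
its inverse both preserve these. -/
theorem MatSq.hassocMid_comp_inv (α : MatSq h h₁ x y) (β : MatSq k k₁ y z)
    (γ : MatSq l l₁ z t) :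
    (α.hassoc β γ).mid.comp (α.hassocInvMid β γ) = MatHom.id _ := by
  refine lift_ext (lift_ext ?_ ?_) ?_ <;>
    simp only [MatHom.comp_assoc, MatHom.id_comp, hassocInvMid_p₁, hassocInvMid_p₁_p₂,
      hassocInvMid_p₂, hassoc_p₁, hassoc_p₂_p₁, hassoc_p₂_p₂]

theorem MatSq.hassocInvMid_comp (α : MatSq h h₁ x y) (β : MatSq k k₁ y z)
    (γ : MatSq l l₁ z t) :
    (α.hassocInvMid β γ).comp (α.hassoc β γ).mid = MatHom.id _ := by
  refine lift_ext ?_ (lift_ext ?_ ?_) <;>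
    simp only [MatHom.comp_assoc, MatHom.id_comp, hassocInvMid_p₁, hassocInvMid_p₁_p₂,
      hassocInvMid_p₂, hassoc_p₁, hassoc_p₂_p₁, hassoc_p₂_p₂]

/-- The middle component of the inverse of the left horizontal unit isomorphism. -/
noncomputable def MatSq.hlamInvMid (α : MatSq h h₁ x y) :
    MatHom α.mat ((hunit x).hmul α).mat :=
  (hunit x).lift α α.L (MatHom.id _) ((MatHom.comp_id _).trans (MatHom.id_comp _).symm)

/-- The middle component of the inverse of the right horizontal unit isomorphism. -/
noncomputable def MatSq.hrhoInvMid (α : MatSq h h₁ x y) :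
    MatHom α.mat (α.hmul (hunit y)).mat :=
  α.lift (hunit y) (MatHom.id _) α.R ((MatHom.id_comp _).trans (MatHom.comp_id _).symm)

theorem MatSq.hlamInv_p₁ (α : MatSq h h₁ x y) : α.hlamInvMid.comp ((hunit x).p₁ α) = α.L :=
  (hunit x).lift_p₁ α α.L (MatHom.id _) ((MatHom.comp_id _).trans (MatHom.id_comp _).symm)

theorem MatSq.hlamInv_p₂ (α : MatSq h h₁ x y) :
    α.hlamInvMid.comp ((hunit x).p₂ α) = MatHom.id _ :=
  (hunit x).lift_p₂ α α.L (MatHom.id _) ((MatHom.comp_id _).trans (MatHom.id_comp _).symm)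

theorem MatSq.hrhoInv_p₁ (α : MatSq h h₁ x y) :
    α.hrhoInvMid.comp (α.p₁ (hunit y)) = MatHom.id _ :=
  α.lift_p₁ (hunit y) (MatHom.id _) α.R ((MatHom.id_comp _).trans (MatHom.comp_id _).symm)

theorem MatSq.hrhoInv_p₂ (α : MatSq h h₁ x y) : α.hrhoInvMid.comp (α.p₂ (hunit y)) = α.R :=
  α.lift_p₂ (hunit y) (MatHom.id _) α.R ((MatHom.id_comp _).trans (MatHom.comp_id _).symm)

/-- The pullback condition determines the first projection from the second: over the horizontal
identity it equals the second projection followed by the left leg of `α`. So the second projection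
alone is invertible. -/
theorem MatSq.hlam_comp_inv (α : MatSq h h₁ x y) :
    α.hlam.mid.comp α.hlamInvMid = MatHom.id _ := by
  refine lift_ext ?_ ?_
  · rw [MatHom.comp_assoc, hlamInv_p₁]
    exact (p_condition (hunit x) α).symm.trans
      ((MatHom.comp_id _).trans (MatHom.id_comp _).symm)
  · rw [MatHom.comp_assoc, hlamInv_p₂]
    exact (MatHom.comp_id _).trans (MatHom.id_comp _).symm

theorem MatSq.hrho_comp_inv (α : MatSq h h₁ x y) :
    α.hrho.mid.comp α.hrhoInvMid = MatHom.id _ := by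
  refine lift_ext ?_ ?_
  · rw [MatHom.comp_assoc, hrhoInv_p₁]
    exact (MatHom.comp_id _).trans (MatHom.id_comp _).symm
  · rw [MatHom.comp_assoc, hrhoInv_p₂]
    exact (p_condition α (hunit y)).trans ((MatHom.comp_id _).trans (MatHom.id_comp _).symm)

theorem MatCube.hmul_one (α : MatSq h h₁ x y) (β : MatSq k k₁ y z) :
    (one α).hmul (one β) rfl = one (α.hmul β) := by
  refine MatCube.ext rfl (MatSq.lift_ext ?_ ?_) rfl <;>
    simp only [hmul_p₁, hmul_p₂, one, MatHom.comp_id, MatHom.id_comp]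

theorem MatCube.hmul_comp (Φ : MatCube α α') (Φ' : MatCube α' α'') (Ψ : MatCube β β')
    (Ψ' : MatCube β' β'') (e : Φ.right = Ψ.left) (e' : Φ'.right = Ψ'.left)
    (e'' : (Φ.comp Φ').right = (Ψ.comp Ψ').left) :
    (Φ.comp Φ').hmul (Ψ.comp Ψ') e'' = (Φ.hmul Ψ e).comp (Φ'.hmul Ψ' e') := by
  refine MatCube.ext rfl (MatSq.lift_ext ?_ ?_) rfl <;>
    simp only [comp, MatHom.comp_assoc, hmul_p₁, hmul_p₂, hmul_p₁_assoc, hmul_p₂_assoc]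

theorem MatCube.hassoc_nat (Φ : MatCube α α') (Ψ : MatCube β β') (Ω : MatCube γ γ')
    (e₁ : Φ.right = Ψ.left) (e₂ : (Φ.hmul Ψ e₁).right = Ω.left) (e₃ : Ψ.right = Ω.left)
    (e₄ : Φ.right = (Ψ.hmul Ω e₃).left) :
    ((Φ.hmul Ψ e₁).hmul Ω e₂).comp (α'.hassoc β' γ') =
      (α.hassoc β γ).comp (Φ.hmul (Ψ.hmul Ω e₃) e₄) := by
  refine MatCube.ext ((MatHom.comp_id _).trans (MatHom.id_comp _).symm)
    (MatSq.lift_ext ?_ (MatSq.lift_ext ?_ ?_)) ((MatHom.comp_id _).trans (MatHom.id_comp _).symm)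
    <;>
    simp only [comp, MatHom.comp_assoc, hmul_p₁, hmul_p₂, hmul_p₁_assoc,
        MatSq.hassoc_p₁, MatSq.hassoc_p₂_p₁, MatSq.hassoc_p₂_p₂,
        MatSq.hassoc_p₁_assoc, MatSq.hassoc_p₂_p₁_assoc, MatSq.hassoc_p₂_p₂_assoc]

/-- Both composites preserve the four projections, which are jointly monic; no coherence of `C`
enters. -/
theorem MatSq.hpentagon (α : MatSq h h₁ x y) (β : MatSq k k₁ y z) (γ : MatSq l l₁ z t)
    (δ : MatSq m m₁ t s) :
    ((α.hassoc β γ).hmul (MatCube.one δ) rfl).comp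
        ((α.hassoc (β.hmul γ) δ).comp ((MatCube.one α).hmul (β.hassoc γ δ) rfl)) =
      ((α.hmul β).hassoc γ δ).comp (α.hassoc β (γ.hmul δ)) := by
  refine MatCube.ext (MatHom.id_comp _)
    (MatSq.lift_ext ?_ (MatSq.lift_ext ?_ (MatSq.lift_ext ?_ ?_)))
    (MatHom.id_comp _) <;>
    simp only [MatCube.comp, MatCube.one, MatHom.comp_assoc, MatCube.hmul_p₁, MatCube.hmul_p₂,
      MatCube.hmul_p₁_assoc, hassoc_p₁, hassoc_p₂_p₁, hassoc_p₂_p₂,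
      hassoc_p₁_assoc, hassoc_p₂_p₁_assoc, MatHom.comp_id]

theorem MatSq.htriangle (α : MatSq h h₁ x y) (β : MatSq k k₁ y z) :
    (α.hassoc (hunit y) β).comp ((MatCube.one α).hmul β.hlam rfl) =
      α.hrho.hmul (MatCube.one β) rfl := by
  refine MatCube.ext (MatHom.id_comp _) (MatSq.lift_ext ?_ ?_) (MatHom.id_comp _) <;>
    refine (MatHom.comp_assoc _ _ _).trans ?_
  · exact (congrArg (MatHom.comp _) ((MatCube.hmul_p₁ (MatCube.one α) β.hlam rfl).trans
      (MatHom.comp_id _))).trans ((hassoc_p₁ α (hunit y) β).trans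
        (MatCube.hmul_p₁ α.hrho (MatCube.one β) rfl).symm)
  · exact (congrArg (MatHom.comp _) (MatCube.hmul_p₂ (MatCube.one α) β.hlam rfl)).trans
      ((hassoc_p₂_p₂ α (hunit y) β).trans ((MatHom.comp_id _).symm.trans
        (MatCube.hmul_p₂ α.hrho (MatCube.one β) rfl).symm))

end HorizontalLaws

section Bundled

variable (C : Type u) [Category.{v} C] [MonoidalCategory C] [HasCoproducts.{w} C]
  [∀ (X : C) (J : Type w), PreservesColimitsOfShape (Discrete J) (tensorLeft X)]
  [∀ (X : C) (J : Type w), PreservesColimitsOfShape (Discrete J) (tensorRight X)] [HasPullbacks C]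

theorem SM_isHStr : IsHStr (SM.{u, v, w} C).hs where
  faces_unitCube _ := ⟨rfl, rfl, rfl, rfl⟩
  unitCube_one _ := rfl
  unitCube_comp _ _ := rfl
  faces_mulCube _ _ _ _ _ := ⟨rfl, rfl, rfl, rfl⟩
  mulCube_one α β _ := MatCube.hmul_one α β
  mulCube_comp Φ Φ' Ψ Ψ' e e' e'' := MatCube.hmul_comp Φ Φ' Ψ Ψ' e e' e''
  faces_assoc _ _ _ := ⟨rfl, rfl, rfl, rfl⟩
  faces_lam _ := ⟨SpnHom.ext rfl rfl rfl, SpnHom.ext rfl rfl rfl, rfl, rfl⟩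
  faces_rho _ := ⟨SpnHom.ext rfl rfl rfl, SpnHom.ext rfl rfl rfl, rfl, rfl⟩
  assoc_inv α β γ := MatCube.exists_inv _ (MatHom.id_comp _) (MatHom.id_comp _)
    (MatSq.hassocMid_comp_inv α β γ) (MatSq.hassocInvMid_comp α β γ)
    (MatHom.id_comp _) (MatHom.id_comp _)
  lam_inv α := MatCube.exists_inv _ (MatHom.id_comp _) (MatHom.id_comp _)
    (MatSq.hlam_comp_inv α) (MatSq.hlamInv_p₂ α) (MatHom.id_comp _) (MatHom.id_comp _)
  rho_inv α := MatCube.exists_inv _ (MatHom.id_comp _) (MatHom.id_comp _)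
    (MatSq.hrho_comp_inv α) (MatSq.hrhoInv_p₁ α) (MatHom.id_comp _) (MatHom.id_comp _)
  assoc_nat Φ Ψ Ω e₁ e₂ e₃ e₄ := MatCube.hassoc_nat Φ Ψ Ω e₁ e₂ e₃ e₄
  lam_nat Φ e := MatCube.ext ((MatHom.comp_id _).trans (MatHom.id_comp _).symm)
    (MatCube.hmul_p₂ (MatCube.hunit (MatCube.left Φ)) Φ e)
    ((MatHom.comp_id _).trans (MatHom.id_comp _).symm)
  rho_nat Φ e := MatCube.ext ((MatHom.comp_id _).trans (MatHom.id_comp _).symm)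
    (MatCube.hmul_p₁ Φ (MatCube.hunit (MatCube.right Φ)) e)
    ((MatHom.comp_id _).trans (MatHom.id_comp _).symm)
  pentagon α β γ δ _ _ := MatSq.hpentagon α β γ δ
  triangle α β _ _ := MatSq.htriangle α β

end Bundled


open MatHom

/-! ### The interchangers χ and δ of spans of matrices. -/

section InterchangeLaws

variable {C : Type u} [Category.{v} C] [HasPullbacks C] [MonoidalCategory C] [HasCoproducts.{w} C]

/-- The matching condition of a product depends on its factors, which obstructs rewriting inside it.
Equations for the composites, typically those for projections, are therefore passed as hypotheses.
-/
theorem mulHom_comp_eq {A B D A' B' D' A'' B'' D'' : Type w} {M : A → B → C} {N : B → D → C}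
    {M' : A' → B' → C} {N' : B' → D' → C} {M'' : A'' → B'' → C} {N'' : B'' → D'' → C}
    {φ : MatHom M M'} {φ' : MatHom M' M''} {ψ : MatHom N N'} {ψ' : MatHom N' N''}
    {ξ : MatHom M M''} {ζ : MatHom N N''} (e : φ.snd = ψ.fst) (e' : φ'.snd = ψ'.fst)
    (e'' : ξ.snd = ζ.fst) (hM : φ.comp φ' = ξ) (hN : ψ.comp ψ' = ζ) :
    (mulHom φ ψ e).comp (mulHom φ' ψ' e') = mulHom ξ ζ e'' := by
  subst hM hN
  exact mulHom_comp φ φ' ψ ψ' e e' _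

theorem comp_congr_assoc {A B A' B' A'' B'' A₃ B₃ : Type w} {M : A → B → C} {N : A' → B' → C}
    {P : A'' → B'' → C} {Q : A₃ → B₃ → C} {φ : MatHom M N} {ψ : MatHom N P} {ξ : MatHom M P}
    (h : φ.comp ψ = ξ) (ω : MatHom P Q) : φ.comp (ψ.comp ω) = ξ.comp ω := by
  rw [← MatHom.comp_assoc, h]

variable {A B D E A₁ B₁ D₁ E₁ A₂ B₂ D₂ E₂ A₃ B₃ D₃ : Type w}
  {A' B' D' A₁' B₁' D₁' A₂' B₂' D₂' : Type w}
  {h : Spn A B} {k : Spn B D} {l : Spn D E} {h₁ : Spn A₁ B₁} {k₁ : Spn B₁ D₁} {l₁ : Spn D₁ E₁}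
  {h₂ : Spn A₂ B₂} {k₂ : Spn B₂ D₂} {l₂ : Spn D₂ E₂} {h₃ : Spn A₃ B₃} {k₃ : Spn B₃ D₃}
  {x : A → A₁ → C} {y : B → B₁ → C} {z : D → D₁ → C} {t : E → E₁ → C}
  {x₁ : A₁ → A₂ → C} {y₁ : B₁ → B₂ → C} {z₁ : D₁ → D₂ → C} {t₁ : E₁ → E₂ → C}
  {x₂ : A₂ → A₃ → C} {y₂ : B₂ → B₃ → C} {z₂ : D₂ → D₃ → C}
  {h' : Spn A' B'} {k' : Spn B' D'} {h₁' : Spn A₁' B₁'} {k₁' : Spn B₁' D₁'}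
  {h₂' : Spn A₂' B₂'} {k₂' : Spn B₂' D₂'}
  {x' : A' → A₁' → C} {y' : B' → B₁' → C} {z' : D' → D₁' → C}
  {x₁' : A₁' → A₂' → C} {y₁' : B₁' → B₂' → C} {z₁' : D₁' → D₂' → C}

/-- This and the next three equations characterize the middle components of χ and δ by the universal
property of the pullback. The coherence conditions use nothing else about those components. -/
theorem MatSq.chi_p₁ (α : MatSq h h₁ x y) (β : MatSq k k₁ y z) (α₁ : MatSq h₁ h₂ x₁ y₁)
    (β₁ : MatSq k₁ k₂ y₁ z₁) :
    (α.chi β α₁ β₁).mid.comp ((α.vmul α₁).p₁ (β.vmul β₁)) =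
      mulHom (α.p₁ β) (α₁.p₁ β₁) rfl :=
  (α.vmul α₁).lift_p₁ (β.vmul β₁) (mulHom (α.p₁ β) (α₁.p₁ β₁) rfl)
    (mulHom (α.p₂ β) (α₁.p₂ β₁) rfl)
    (mulHom_comm rfl rfl rfl rfl (α.p_condition β) (α₁.p_condition β₁))

theorem MatSq.chi_p₂ (α : MatSq h h₁ x y) (β : MatSq k k₁ y z) (α₁ : MatSq h₁ h₂ x₁ y₁)
    (β₁ : MatSq k₁ k₂ y₁ z₁) :
    (α.chi β α₁ β₁).mid.comp ((α.vmul α₁).p₂ (β.vmul β₁)) =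
      mulHom (α.p₂ β) (α₁.p₂ β₁) rfl :=
  (α.vmul α₁).lift_p₂ (β.vmul β₁) (mulHom (α.p₁ β) (α₁.p₁ β₁) rfl)
    (mulHom (α.p₂ β) (α₁.p₂ β₁) rfl)
    (mulHom_comm rfl rfl rfl rfl (α.p_condition β) (α₁.p_condition β₁))

theorem MatSq.delta_p₁ (h : Spn A B) (k : Spn B D) :
    (delta C h k).mid.comp ((vunit C h).p₁ (vunit C k)) =
      unitHom fun p : (h.mul k).apex => p.1.1 :=
  (vunit C h).lift_p₁ (vunit C k) (unitHom fun p : (h.mul k).apex => p.1.1)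
    (unitHom fun p : (h.mul k).apex => p.1.2)
    (delta_aux C h k)

theorem MatSq.delta_p₂ (h : Spn A B) (k : Spn B D) :
    (delta C h k).mid.comp ((vunit C h).p₂ (vunit C k)) =
      unitHom fun p : (h.mul k).apex => p.1.2 :=
  (vunit C h).lift_p₂ (vunit C k) (unitHom fun p : (h.mul k).apex => p.1.1)
    (unitHom fun p : (h.mul k).apex => p.1.2)
    (delta_aux C h k)

/-- Many coherence diagrams contain χ followed by a horizontal composite of cubes. Projecting
removes both at once and leaves a product of projections followed by a single cube. -/
theorem MatSq.chi_hmul_p₁ {α : MatSq h h₁ x y} {β : MatSq k k₁ y z} {α₁ : MatSq h₁ h₂ x₁ y₁}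
    {β₁ : MatSq k₁ k₂ y₁ z₁} {α' : MatSq h' h₁' x' y'} {β' : MatSq k' k₁' y' z'}
    (Φ : MatCube (α.vmul α₁) α') (Ψ : MatCube (β.vmul β₁) β') (e : Φ.right = Ψ.left) :
    ((α.chi β α₁ β₁).mid.comp (Φ.hmul Ψ e).mid).comp (α'.p₁ β') =
      (mulHom (α.p₁ β) (α₁.p₁ β₁) rfl).comp Φ.mid := by
  rw [MatHom.comp_assoc, MatCube.hmul_p₁]
  exact comp_congr_assoc (chi_p₁ _ _ _ _) _

theorem MatSq.chi_hmul_p₂ {α : MatSq h h₁ x y} {β : MatSq k k₁ y z} {α₁ : MatSq h₁ h₂ x₁ y₁}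
    {β₁ : MatSq k₁ k₂ y₁ z₁} {α' : MatSq h' h₁' x' y'} {β' : MatSq k' k₁' y' z'}
    (Φ : MatCube (α.vmul α₁) α') (Ψ : MatCube (β.vmul β₁) β') (e : Φ.right = Ψ.left) :
    ((α.chi β α₁ β₁).mid.comp (Φ.hmul Ψ e).mid).comp (α'.p₂ β') =
      (mulHom (α.p₂ β) (α₁.p₂ β₁) rfl).comp Ψ.mid := by
  rw [MatHom.comp_assoc, MatCube.hmul_p₂]
  exact comp_congr_assoc (chi_p₂ _ _ _ _) _

theorem MatSq.delta_hmul_p₁ {h : Spn A B} {k : Spn B D} {α' : MatSq h' h₁' x' y'}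
    {β' : MatSq k' k₁' y' z'} (Φ : MatCube (vunit C h) α') (Ψ : MatCube (vunit C k) β')
    (e : Φ.right = Ψ.left) :
    ((delta C h k).mid.comp (Φ.hmul Ψ e).mid).comp (α'.p₁ β') =
      (unitHom fun p : (h.mul k).apex => p.1.1).comp Φ.mid := by
  rw [MatHom.comp_assoc, MatCube.hmul_p₁]
  exact comp_congr_assoc (delta_p₁ _ _) _

theorem MatSq.delta_hmul_p₂ {h : Spn A B} {k : Spn B D} {α' : MatSq h' h₁' x' y'}
    {β' : MatSq k' k₁' y' z'} (Φ : MatCube (vunit C h) α') (Ψ : MatCube (vunit C k) β')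
    (e : Φ.right = Ψ.left) :
    ((delta C h k).mid.comp (Φ.hmul Ψ e).mid).comp (α'.p₂ β') =
      (unitHom fun p : (h.mul k).apex => p.1.2).comp Ψ.mid := by
  rw [MatHom.comp_assoc, MatCube.hmul_p₂]
  exact comp_congr_assoc (delta_p₂ _ _) _

/-- Disposes of the left and right faces in the naturality conditions, where special cubes have
identities. -/
theorem comp_id_id_comp {A B A' B' : Type w} {M : A → B → C} {N : A' → B' → C}
    (φ : MatHom M N) : φ.comp (MatHom.id N) = (MatHom.id M).comp φ :=
  (MatHom.comp_id φ).trans (MatHom.id_comp φ).symm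

/-- After projection, this is functoriality of matrix multiplication applied to the naturality of
the projections. -/
theorem MatSq.chi_nat {α : MatSq h h₁ x y} {β : MatSq k k₁ y z}
    {α₁ : MatSq h₁ h₂ x₁ y₁} {β₁ : MatSq k₁ k₂ y₁ z₁}
    {α' : MatSq h' h₁' x' y'} {β' : MatSq k' k₁' y' z'}
    {α₁' : MatSq h₁' h₂' x₁' y₁'} {β₁' : MatSq k₁' k₂' y₁' z₁'}
    (Φ : MatCube α α') (Ψ : MatCube β β') (Φ₁ : MatCube α₁ α₁') (Ψ₁ : MatCube β₁ β₁')
    (e₁ : Φ.right = Ψ.left) (e₂ : Φ₁.right = Ψ₁.left)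
    (e₃ : (Φ.hmul Ψ e₁).bot = (Φ₁.hmul Ψ₁ e₂).top)
    (e₄ : Φ.bot = Φ₁.top) (e₅ : Ψ.bot = Ψ₁.top)
    (e₆ : (Φ.vmul Φ₁ e₄).right = (Ψ.vmul Ψ₁ e₅).left) :
    ((Φ.hmul Ψ e₁).vmul (Φ₁.hmul Ψ₁ e₂) e₃).comp (α'.chi β' α₁' β₁') =
      (α.chi β α₁ β₁).comp ((Φ.vmul Φ₁ e₄).hmul (Ψ.vmul Ψ₁ e₅) e₆) := by
  refine MatCube.ext (comp_id_id_comp _) (lift_ext ?_ ?_) (comp_id_id_comp _)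
  · refine Eq.trans ?_ (chi_hmul_p₁ _ _ _).symm
    refine (MatHom.comp_assoc _ _ _).trans ?_
    refine (congrArg (MatHom.comp _) (chi_p₁ _ _ _ _)).trans ?_
    exact mulHom_comm (congrArg SpnHom.mid e₃) rfl rfl (congrArg SpnHom.mid e₄)
      (MatCube.hmul_p₁ _ _ _) (MatCube.hmul_p₁ _ _ _)
  · refine Eq.trans ?_ (chi_hmul_p₂ _ _ _).symm
    refine (MatHom.comp_assoc _ _ _).trans ?_
    refine (congrArg (MatHom.comp _) (chi_p₂ _ _ _ _)).trans ?_
    exact mulHom_comm (congrArg SpnHom.mid e₃) rfl rfl (congrArg SpnHom.mid e₅)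
      (MatCube.hmul_p₂ _ _ _) (MatCube.hmul_p₂ _ _ _)

theorem mulHom_id_comp_id {A B D A' D' : Type w} {M : A → B → C} {N : B → D → C} {Q : A' → D' → C}
    (φ : MatHom (mulMat M N) Q) :
    (mulHom (MatHom.id M) (MatHom.id N) rfl).comp ((MatHom.id _).comp φ) = φ := by
  rw [MatHom.id_comp, mulHom_id, MatHom.id_comp]

theorem comp_mulHom_id_id {A B D A' D' : Type w} {M : A → B → C} {N : B → D → C} {Q : A' → D' → C}
    (φ : MatHom Q (mulMat M N)) :
    φ.comp ((mulHom (MatHom.id M) (MatHom.id N) rfl).comp (MatHom.id _)) = φ := by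
  rw [MatHom.comp_id, mulHom_id, MatHom.comp_id]

section Right

variable [∀ (X : C) (J : Type w), PreservesColimitsOfShape (Discrete J) (tensorRight X)]

/-- Projecting turns every occurrence of χ into a product of projections, and the condition into the
naturality of `assocMat` with respect to three projections. -/
theorem MatSq.chi_vassoc (α : MatSq h h₁ x y) (β : MatSq k k₁ y z)
    (α₁ : MatSq h₁ h₂ x₁ y₁) (β₁ : MatSq k₁ k₂ y₁ z₁)
    (α₂ : MatSq h₂ h₃ x₂ y₂) (β₂ : MatSq k₂ k₃ y₂ z₂)
    (e₁ : (α.chi β α₁ β₁).bot = (MatCube.one (α₂.hmul β₂)).top)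
    (e₃ : (MatCube.one (α.hmul β)).bot = (α₁.chi β₁ α₂ β₂).top) :
    ((α.chi β α₁ β₁).vmul (MatCube.one (α₂.hmul β₂)) e₁).comp
        (((α.vmul α₁).chi (β.vmul β₁) α₂ β₂).comp
          ((α.vassoc α₁ α₂).hmul (β.vassoc β₁ β₂) rfl)) =
      ((α.hmul β).vassoc (α₁.hmul β₁) (α₂.hmul β₂)).comp
        (((MatCube.one (α.hmul β)).vmul (α₁.chi β₁ α₂ β₂) e₃).comp
          (α.chi β (α₁.vmul α₂) (β₁.vmul β₂))) := by
  refine MatCube.ext ((mulHom_id_comp_id _).trans (comp_mulHom_id_id _).symm) (lift_ext ?_ ?_)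
    ((mulHom_id_comp_id _).trans (comp_mulHom_id_id _).symm)
  · refine (MatHom.comp_assoc _ _ _).trans ?_
    refine (congrArg (MatHom.comp _) (chi_hmul_p₁ _ _ _)).trans ?_
    refine (comp_congr_assoc (mulHom_comp_eq (congrArg SpnHom.mid e₁) rfl rfl (chi_p₁ α β α₁ β₁)
      (MatHom.id_comp (α₂.p₁ β₂))) _).trans ?_
    refine (assocMat_nat (α.p₁ β) (α₁.p₁ β₁) (α₂.p₁ β₂) rfl rfl).trans ?_
    refine Eq.trans ?_ (MatHom.comp_assoc _ _ _).symm
    refine congrArg (MatHom.comp _) ?_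
    refine Eq.trans ?_ (MatHom.comp_assoc _ _ _).symm
    refine Eq.trans ?_ (congrArg (MatHom.comp _)
      (chi_p₁ α β (α₁.vmul α₂) (β₁.vmul β₂))).symm
    exact (mulHom_comp_eq (congrArg SpnHom.mid e₃) rfl rfl (MatHom.id_comp (α.p₁ β))
      (chi_p₁ α₁ β₁ α₂ β₂)).symm
  · refine (MatHom.comp_assoc _ _ _).trans ?_
    refine (congrArg (MatHom.comp _) (chi_hmul_p₂ _ _ _)).trans ?_
    refine (comp_congr_assoc (mulHom_comp_eq (congrArg SpnHom.mid e₁) rfl rfl (chi_p₂ α β α₁ β₁)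
      (MatHom.id_comp (α₂.p₂ β₂))) _).trans ?_
    refine (assocMat_nat (α.p₂ β) (α₁.p₂ β₁) (α₂.p₂ β₂) rfl rfl).trans ?_
    refine Eq.trans ?_ (MatHom.comp_assoc _ _ _).symm
    refine congrArg (MatHom.comp _) ?_
    refine Eq.trans ?_ (MatHom.comp_assoc _ _ _).symm
    refine Eq.trans ?_ (congrArg (MatHom.comp _)
      (chi_p₂ α β (α₁.vmul α₂) (β₁.vmul β₂))).symm
    exact (mulHom_comp_eq (congrArg SpnHom.mid e₃) rfl rfl (MatHom.id_comp (α.p₂ β))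
      (chi_p₂ α₁ β₁ α₂ β₂)).symm

/-- A projection of δ is the action on identity matrices of the index part of the projection. The
condition thus becomes naturality of `lamMat` at that projection; the right unit works in the same
way with `rhoMat`. -/
theorem MatSq.chi_vlam (α : MatSq h h₁ x y) (β : MatSq k k₁ y z)
    (e₁ : (delta C h k).bot = (MatCube.one (α.hmul β)).top) :
    ((delta C h k).vmul (MatCube.one (α.hmul β)) e₁).comp
        (((vunit C h).chi (vunit C k) α β).comp (α.vlam.hmul β.vlam rfl)) =
      (α.hmul β).vlam := by
  refine MatCube.ext (mulHom_id_comp_id _) (lift_ext ?_ ?_) (mulHom_id_comp_id _)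
  · refine (MatHom.comp_assoc _ _ _).trans ?_
    refine (congrArg (MatHom.comp _) (chi_hmul_p₁ _ _ _)).trans ?_
    refine (comp_congr_assoc (mulHom_comp_eq (congrArg SpnHom.mid e₁) rfl rfl (delta_p₁ h k)
      (MatHom.id_comp (α.p₁ β))) _).trans ?_
    exact lamMat_nat (α.p₁ β)
  · refine (MatHom.comp_assoc _ _ _).trans ?_
    refine (congrArg (MatHom.comp _) (chi_hmul_p₂ _ _ _)).trans ?_
    refine (comp_congr_assoc (mulHom_comp_eq (congrArg SpnHom.mid e₁) rfl rfl (delta_p₂ h k)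
      (MatHom.id_comp (α.p₂ β))) _).trans ?_
    exact lamMat_nat (α.p₂ β)

end Right

theorem MatSq.chi_vrho
    [∀ (X : C) (J : Type w), PreservesColimitsOfShape (Discrete J) (tensorLeft X)]
    (α : MatSq h h₁ x y) (β : MatSq k k₁ y z)
    (e₁ : (MatCube.one (α.hmul β)).bot = (delta C h₁ k₁).top) :
    ((MatCube.one (α.hmul β)).vmul (delta C h₁ k₁) e₁).comp
        ((α.chi β (vunit C h₁) (vunit C k₁)).comp (α.vrho.hmul β.vrho rfl)) =
      (α.hmul β).vrho := by
  refine MatCube.ext (mulHom_id_comp_id _) (lift_ext ?_ ?_) (mulHom_id_comp_id _)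
  · refine (MatHom.comp_assoc _ _ _).trans ?_
    refine (congrArg (MatHom.comp _) (chi_hmul_p₁ _ _ _)).trans ?_
    refine (comp_congr_assoc (mulHom_comp_eq (congrArg SpnHom.mid e₁) rfl rfl
      (MatHom.id_comp (α.p₁ β)) (delta_p₁ h₁ k₁)) _).trans ?_
    exact rhoMat_nat (α.p₁ β)
  · refine (MatHom.comp_assoc _ _ _).trans ?_
    refine (congrArg (MatHom.comp _) (chi_hmul_p₂ _ _ _)).trans ?_
    refine (comp_congr_assoc (mulHom_comp_eq (congrArg SpnHom.mid e₁) rfl rfl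
      (MatHom.id_comp (α.p₂ β)) (delta_p₂ h₁ k₁)) _).trans ?_
    exact rhoMat_nat (α.p₂ β)

/-- After projection both sides come from functions on index sets, and `unitHom` is functorial. -/
theorem MatSq.delta_nat {h : Spn A B} {k : Spn B D} {h' : Spn A' B'} {k' : Spn B' D'}
    (φ : SpnHom h h') (ψ : SpnHom k k') (e₂ : φ.snd = ψ.fst)
    (e₁ : (MatCube.vunit (C := C) φ).right = (MatCube.vunit ψ).left) :
    (MatCube.vunit (φ.mul ψ e₂)).comp (delta C h' k') =
      (delta C h k).comp ((MatCube.vunit φ).hmul (MatCube.vunit ψ) e₁) := by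
  refine MatCube.ext (comp_id_id_comp _) (lift_ext ?_ ?_) (comp_id_id_comp _)
  · refine Eq.trans ?_ (delta_hmul_p₁ _ _ _).symm
    refine (MatHom.comp_assoc _ _ _).trans ?_
    refine (congrArg (MatHom.comp _) (delta_p₁ _ _)).trans ?_
    exact (unitHom_comp _ _).trans
      (unitHom_comp (fun p : (h.mul k).apex => p.1.1) (SpnHom.mid φ)).symm
  · refine Eq.trans ?_ (delta_hmul_p₂ _ _ _).symm
    refine (MatHom.comp_assoc _ _ _).trans ?_
    refine (congrArg (MatHom.comp _) (delta_p₂ _ _)).trans ?_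
    exact (unitHom_comp _ _).trans
      (unitHom_comp (fun p : (h.mul k).apex => p.1.2) (SpnHom.mid ψ)).symm

omit [MonoidalCategory C] [HasCoproducts.{w} C] in
theorem MatSq.comp_hassoc_p₁ {X Y : Type w} {Q : X → Y → C} (α : MatSq h h₁ x y)
    (β : MatSq k k₁ y z) (γ : MatSq l l₁ z t) (ξ : MatHom Q ((α.hmul β).hmul γ).mat) :
    (ξ.comp (α.hassoc β γ).mid).comp (α.p₁ (β.hmul γ)) =
      (ξ.comp ((α.hmul β).p₁ γ)).comp (α.p₁ β) := by
  simp only [MatHom.comp_assoc, hassoc_p₁]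

omit [MonoidalCategory C] [HasCoproducts.{w} C] in
theorem MatSq.comp_hassoc_p₂_p₁ {X Y : Type w} {Q : X → Y → C} (α : MatSq h h₁ x y)
    (β : MatSq k k₁ y z) (γ : MatSq l l₁ z t) (ξ : MatHom Q ((α.hmul β).hmul γ).mat) :
    ((ξ.comp (α.hassoc β γ).mid).comp (α.p₂ (β.hmul γ))).comp (β.p₁ γ) =
      (ξ.comp ((α.hmul β).p₁ γ)).comp (α.p₂ β) := by
  simp only [MatHom.comp_assoc, hassoc_p₂_p₁]

omit [MonoidalCategory C] [HasCoproducts.{w} C] in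
theorem MatSq.comp_hassoc_p₂_p₂ {X Y : Type w} {Q : X → Y → C} (α : MatSq h h₁ x y)
    (β : MatSq k k₁ y z) (γ : MatSq l l₁ z t) (ξ : MatHom Q ((α.hmul β).hmul γ).mat) :
    ((ξ.comp (α.hassoc β γ).mid).comp (α.p₂ (β.hmul γ))).comp (β.p₂ γ) =
      ξ.comp ((α.hmul β).p₂ γ) := by
  simp only [MatHom.comp_assoc, hassoc_p₂_p₂]

/-- Tested on the three projections of the target, both sides become products of composite
projections in the two rows. They agree because the horizontal associativity preserves projections
in each row. -/
theorem MatSq.chi_hassoc (α : MatSq h h₁ x y) (β : MatSq k k₁ y z) (γ : MatSq l l₁ z t)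
    (α₁ : MatSq h₁ h₂ x₁ y₁) (β₁ : MatSq k₁ k₂ y₁ z₁) (γ₁ : MatSq l₁ l₂ z₁ t₁)
    (e₁ : (α.chi β α₁ β₁).right = (MatCube.one (γ.vmul γ₁)).left)
    (e₂ : (α.hassoc β γ).bot = (α₁.hassoc β₁ γ₁).top)
    (e₃ : (MatCube.one (α.vmul α₁)).right = (β.chi γ β₁ γ₁).left) :
    ((α.hmul β).chi γ (α₁.hmul β₁) γ₁).comp
        (((α.chi β α₁ β₁).hmul (MatCube.one (γ.vmul γ₁)) e₁).comp
          ((α.vmul α₁).hassoc (β.vmul β₁) (γ.vmul γ₁))) =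
      ((α.hassoc β γ).vmul (α₁.hassoc β₁ γ₁) e₂).comp
        ((α.chi (β.hmul γ) α₁ (β₁.hmul γ₁)).comp
          ((MatCube.one (α.vmul α₁)).hmul (β.chi γ β₁ γ₁) e₃)) := by
  -- The left and right faces consist of identities only; on the right-hand side of the law one of
  -- them appears as a product of identities.
  have hl : ∀ {A D D' : Type w} {M : A → D → C} {N : D → D' → C},
      (MatHom.id (mulMat M N)).comp ((MatHom.id _).comp (MatHom.id _)) =
        (mulHom (MatHom.id M) (MatHom.id N) rfl).comp ((MatHom.id _).comp (MatHom.id _)) :=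
    ((MatHom.id_comp _).trans (MatHom.id_comp _)).trans (mulHom_id_comp_id (MatHom.id _)).symm
  refine MatCube.ext hl (Eq.trans (MatHom.comp_assoc _ _ _).symm ?_) hl
  refine lift_ext ?_ (lift_ext ?_ ?_)
  · refine (comp_hassoc_p₁ (α.vmul α₁) (β.vmul β₁) (γ.vmul γ₁) _).trans ?_
    refine (congrArg (fun ξ => MatHom.comp ξ ((α.vmul α₁).p₁ (β.vmul β₁)))
      (chi_hmul_p₁ (α.chi β α₁ β₁) (MatCube.one (γ.vmul γ₁)) e₁)).trans ?_
    refine (MatHom.comp_assoc _ _ _).trans ?_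
    refine (congrArg (MatHom.comp _) (chi_p₁ α β α₁ β₁)).trans ?_
    refine Eq.trans ?_ (MatHom.comp_assoc _ _ _).symm
    refine Eq.trans ?_ (congrArg (MatHom.comp _) ((chi_hmul_p₁ (MatCube.one (α.vmul α₁))
      (β.chi γ β₁ γ₁) e₃).trans (MatHom.comp_id _))).symm
    exact mulHom_comm rfl rfl (congrArg SpnHom.mid e₂) rfl
      (hassoc_p₁ α β γ).symm (hassoc_p₁ α₁ β₁ γ₁).symm
  · refine (comp_hassoc_p₂_p₁ (α.vmul α₁) (β.vmul β₁) (γ.vmul γ₁) _).trans ?_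
    refine (congrArg (fun ξ => MatHom.comp ξ ((α.vmul α₁).p₂ (β.vmul β₁)))
      (chi_hmul_p₁ (α.chi β α₁ β₁) (MatCube.one (γ.vmul γ₁)) e₁)).trans ?_
    refine (MatHom.comp_assoc _ _ _).trans ?_
    refine (congrArg (MatHom.comp _) (chi_p₂ α β α₁ β₁)).trans ?_
    refine Eq.trans ?_ (congrArg (fun ξ => MatHom.comp ξ ((β.vmul β₁).p₁ (γ.vmul γ₁)))
      ((MatHom.comp_assoc _ _ _).trans (congrArg (MatHom.comp _)
        (chi_hmul_p₂ (MatCube.one (α.vmul α₁)) (β.chi γ β₁ γ₁) e₃)))).symm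
    refine Eq.trans ?_ ((MatHom.comp_assoc _ _ _).trans (congrArg (MatHom.comp _)
      ((MatHom.comp_assoc _ _ _).trans (congrArg (MatHom.comp _) (chi_p₁ β γ β₁ γ₁))))).symm
    refine Eq.trans ?_ (congrArg (MatHom.comp _) (mulHom_comp_eq rfl rfl rfl rfl rfl)).symm
    exact mulHom_comm rfl rfl (congrArg SpnHom.mid e₂) rfl
      (hassoc_p₂_p₁ α β γ).symm (hassoc_p₂_p₁ α₁ β₁ γ₁).symm
  · refine (comp_hassoc_p₂_p₂ (α.vmul α₁) (β.vmul β₁) (γ.vmul γ₁) _).trans ?_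
    refine ((chi_hmul_p₂ (α.chi β α₁ β₁) (MatCube.one (γ.vmul γ₁)) e₁).trans
      (MatHom.comp_id _)).trans ?_
    refine Eq.trans ?_ (congrArg (fun ξ => MatHom.comp ξ ((β.vmul β₁).p₂ (γ.vmul γ₁)))
      ((MatHom.comp_assoc _ _ _).trans (congrArg (MatHom.comp _)
        (chi_hmul_p₂ (MatCube.one (α.vmul α₁)) (β.chi γ β₁ γ₁) e₃)))).symm
    refine Eq.trans ?_ ((MatHom.comp_assoc _ _ _).trans (congrArg (MatHom.comp _)
      ((MatHom.comp_assoc _ _ _).trans (congrArg (MatHom.comp _) (chi_p₂ β γ β₁ γ₁))))).symm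
    refine Eq.trans ?_ (congrArg (MatHom.comp _) (mulHom_comp_eq rfl rfl rfl rfl rfl)).symm
    exact (mulHom_comp_eq (congrArg SpnHom.mid e₂) rfl rfl (hassoc_p₂_p₂ α β γ)
      (hassoc_p₂_p₂ α₁ β₁ γ₁)).symm

/-- The middle component of the left unit isomorphism is a second projection. So the condition is
the equation for the second projection of χ, which discards μ; for the right unit it is the first
projection. -/
theorem MatSq.chi_hlam (α : MatSq h h₁ x y) (α₁ : MatSq h₁ h₂ x₁ y₁)
    (e₁ : (mu x x₁).right = (MatCube.one (α.vmul α₁)).left)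
    (e₂ : α.hlam.bot = α₁.hlam.top) :
    ((hunit x).chi α (hunit x₁) α₁).comp
        (((mu x x₁).hmul (MatCube.one (α.vmul α₁)) e₁).comp (α.vmul α₁).hlam) =
      α.hlam.vmul α₁.hlam e₂ := by
  refine MatCube.ext ((MatHom.id_comp _).trans ((MatHom.id_comp _).trans (mulHom_id _ _).symm))
    ?_ ((MatHom.id_comp _).trans ((MatHom.id_comp _).trans (mulHom_id _ _).symm))
  refine (MatHom.comp_assoc _ _ _).symm.trans ?_
  exact (chi_hmul_p₂ (mu x x₁) (MatCube.one (α.vmul α₁)) e₁).trans (MatHom.comp_id _)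

theorem MatSq.chi_hrho (α : MatSq h h₁ x y) (α₁ : MatSq h₁ h₂ x₁ y₁)
    (e₁ : (MatCube.one (α.vmul α₁)).right = (mu y y₁).left)
    (e₂ : α.hrho.bot = α₁.hrho.top) :
    (α.chi (hunit y) α₁ (hunit y₁)).comp
        (((MatCube.one (α.vmul α₁)).hmul (mu y y₁) e₁).comp (α.vmul α₁).hrho) =
      α.hrho.vmul α₁.hrho e₂ := by
  refine MatCube.ext ((MatHom.id_comp _).trans ((MatHom.id_comp _).trans (mulHom_id _ _).symm))
    ?_ ((MatHom.id_comp _).trans ((MatHom.id_comp _).trans (mulHom_id _ _).symm))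
  refine (MatHom.comp_assoc _ _ _).symm.trans ?_
  exact (chi_hmul_p₁ (MatCube.one (α.vmul α₁)) (mu y y₁) e₁).trans (MatHom.comp_id _)

/-- As for χ: the unit isomorphism is a projection that discards τ, and what remains is the defining
equation of δ for that projection. -/
theorem MatSq.delta_hlam (h : Spn A B)
    (e : (tau C A).right = (MatCube.one (vunit C h)).left) :
    (delta C (Spn.unit A) h).comp
        (((tau C A).hmul (MatCube.one (vunit C h)) e).comp (vunit C h).hlam) =
      MatCube.vunit h.lam := by
  refine MatCube.ext ((MatHom.id_comp _).trans ((MatHom.id_comp _).trans (unitHom_id _).symm))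
    ?_ ((MatHom.id_comp _).trans ((MatHom.id_comp _).trans (unitHom_id _).symm))
  refine (MatHom.comp_assoc _ _ _).symm.trans ?_
  exact (delta_hmul_p₂ (tau C A) (MatCube.one (vunit C h)) e).trans (MatHom.comp_id _)

theorem MatSq.delta_hrho (h : Spn A B)
    (e : (MatCube.one (vunit C h)).right = (tau C B).left) :
    (delta C h (Spn.unit B)).comp
        (((MatCube.one (vunit C h)).hmul (tau C B) e).comp (vunit C h).hrho) =
      MatCube.vunit h.rho := by
  refine MatCube.ext ((MatHom.id_comp _).trans ((MatHom.id_comp _).trans (unitHom_id _).symm))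
    ?_ ((MatHom.id_comp _).trans ((MatHom.id_comp _).trans (unitHom_id _).symm))
  refine (MatHom.comp_assoc _ _ _).symm.trans ?_
  exact (delta_hmul_p₁ (MatCube.one (vunit C h)) (tau C B) e).trans (MatHom.comp_id _)

end InterchangeLaws


open MatHom

section InterchangeLaws

variable {C : Type u} [Category.{v} C] [HasPullbacks C] [MonoidalCategory C] [HasCoproducts.{w} C]
  {A B D E : Type w} {h : Spn A B} {k : Spn B D} {l : Spn D E}

theorem unitHom_self_comp {A A' D' : Type w} {Q : A' → D' → C} (φ : MatHom (unitMat C A) Q) :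
    (unitHom fun a : A => a).comp φ = φ := by
  rw [unitHom_id, MatHom.id_comp]

/-- The analogue of `MatSq.chi_hassoc` with `unitHom` in the place of `mulHom`. Each of the three
projections reduces to the action of one coordinate function of the threefold pullback of index
sets. -/
theorem MatSq.delta_hassoc (h : Spn A B) (k : Spn B D) (l : Spn D E)
    (e₁ : (delta C h k).right = (MatCube.one (vunit C l)).left)
    (e₂ : (MatCube.one (vunit C h)).right = (delta C k l).left) :
    (delta C (h.mul k) l).comp
        (((delta C h k).hmul (MatCube.one (vunit C l)) e₁).comp
          ((vunit C h).hassoc (vunit C k) (vunit C l))) =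
      (MatCube.vunit (h.assoc k l)).comp
        ((delta C h (k.mul l)).comp
          ((MatCube.one (vunit C h)).hmul (delta C k l) e₂)) := by
  have hl : ∀ {A : Type w}, (MatHom.id (unitMat C A)).comp ((MatHom.id _).comp (MatHom.id _)) =
        (unitHom fun a : A => a).comp ((MatHom.id _).comp (MatHom.id _)) :=
    ((MatHom.id_comp _).trans (MatHom.id_comp _)).trans
      ((unitHom_self_comp _).trans (MatHom.id_comp _)).symm
  have hu : ∀ {A B D : Type w} (f : A → B) (g : B → D),
    (unitHom (C := C) f).comp (unitHom g) = unitHom fun a => g (f a) := unitHom_comp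
  refine MatCube.ext hl (Eq.trans (MatHom.comp_assoc _ _ _).symm ?_) hl
  refine lift_ext ?_ (lift_ext ?_ ?_)
  · refine (comp_hassoc_p₁ (vunit C h) (vunit C k) (vunit C l) _).trans ?_
    refine (congrArg (fun ξ => MatHom.comp ξ ((vunit C h).p₁ (vunit C k)))
      (delta_hmul_p₁ (delta C h k) (MatCube.one (vunit C l)) e₁)).trans ?_
    refine (MatHom.comp_assoc _ _ _).trans ?_
    refine (congrArg (MatHom.comp _) (delta_p₁ h k)).trans ?_
    refine Eq.trans ?_ (MatHom.comp_assoc _ _ _).symm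
    refine Eq.trans ?_ (congrArg (MatHom.comp _) ((delta_hmul_p₁ (MatCube.one (vunit C h))
      (delta C k l) e₂).trans (MatHom.comp_id _))).symm
    exact (hu _ _).trans (unitHom_comp (h.assoc k l).mid
      fun p : (h.mul (k.mul l)).apex => p.1.1).symm
  · refine (comp_hassoc_p₂_p₁ (vunit C h) (vunit C k) (vunit C l) _).trans ?_
    refine (congrArg (fun ξ => MatHom.comp ξ ((vunit C h).p₂ (vunit C k)))
      (delta_hmul_p₁ (delta C h k) (MatCube.one (vunit C l)) e₁)).trans ?_
    refine (MatHom.comp_assoc _ _ _).trans ?_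
    refine (congrArg (MatHom.comp _) (delta_p₂ h k)).trans ?_
    refine Eq.trans ?_ (congrArg (fun ξ => MatHom.comp ξ ((vunit C k).p₁ (vunit C l)))
      ((MatHom.comp_assoc _ _ _).trans (congrArg (MatHom.comp _)
        (delta_hmul_p₂ (MatCube.one (vunit C h)) (delta C k l) e₂)))).symm
    refine Eq.trans ?_ ((MatHom.comp_assoc _ _ _).trans (congrArg (MatHom.comp _)
      ((MatHom.comp_assoc _ _ _).trans (congrArg (MatHom.comp _) (delta_p₁ k l))))).symm
    refine Eq.trans ?_ (congrArg (MatHom.comp _) (hu _ _)).symm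
    exact (hu _ _).trans (unitHom_comp (h.assoc k l).mid
      fun p : (h.mul (k.mul l)).apex => p.1.2.1.1).symm
  · refine (comp_hassoc_p₂_p₂ (vunit C h) (vunit C k) (vunit C l) _).trans ?_
    refine ((delta_hmul_p₂ (delta C h k) (MatCube.one (vunit C l)) e₁).trans
      (MatHom.comp_id _)).trans ?_
    refine Eq.trans ?_ (congrArg (fun ξ => MatHom.comp ξ ((vunit C k).p₂ (vunit C l)))
      ((MatHom.comp_assoc _ _ _).trans (congrArg (MatHom.comp _)
        (delta_hmul_p₂ (MatCube.one (vunit C h)) (delta C k l) e₂)))).symm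
    refine Eq.trans ?_ ((MatHom.comp_assoc _ _ _).trans (congrArg (MatHom.comp _)
      ((MatHom.comp_assoc _ _ _).trans (congrArg (MatHom.comp _) (delta_p₂ k l))))).symm
    refine Eq.trans ?_ (congrArg (MatHom.comp _) (hu _ _)).symm
    exact (unitHom_comp (h.assoc k l).mid
      fun p : (h.mul (k.mul l)).apex => p.1.2.1.2).symm

end InterchangeLaws

/-! ### `SM` is an intercategory. -/

section Bundled

variable (C : Type u) [Category.{v} C] [MonoidalCategory C] [HasCoproducts.{w} C]
  [∀ (X : C) (J : Type w), PreservesColimitsOfShape (Discrete J) (tensorLeft X)]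
  [∀ (X : C) (J : Type w), PreservesColimitsOfShape (Discrete J) (tensorRight X)] [HasPullbacks C]

/-- The conditions on μ and τ need no universal property: their components are identities, and
products of identities are identities. -/
theorem SM_isIntercategory : (SM.{u, v, w} C).IsIntercategory where
  isDblH := spanDbl_isDbl
  isDblV := matDbl_isDbl C
  isSq := spanMatSq_isSq C
  isHStr := SM_isHStr C
  isVStr := SM_isVStr C
  chi_special _ _ _ _ := ⟨rfl, rfl, rfl, rfl⟩
  mu_special _ _ := ⟨rfl, rfl, rfl, rfl⟩
  delta_special _ _ := ⟨rfl, rfl, rfl, rfl⟩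
  tau_special _ := ⟨rfl, rfl, rfl, rfl⟩
  chi_nat Φ Ψ Φ₁ Ψ₁ e₁ e₂ e₃ e₄ e₅ e₆ := MatSq.chi_nat Φ Ψ Φ₁ Ψ₁ e₁ e₂ e₃ e₄ e₅ e₆
  mu_nat _ _ _ _ := MatCube.ext (comp_id_id_comp _) (comp_id_id_comp _) (comp_id_id_comp _)
  delta_nat φ ψ e₁ e₂ := MatSq.delta_nat φ ψ e₂ e₁
  tau_nat _ := MatCube.ext (comp_id_id_comp _) (comp_id_id_comp _) (comp_id_id_comp _)
  chi_vassoc α β α₁ β₁ α₂ β₂ e₁ _ e₃ := MatSq.chi_vassoc α β α₁ β₁ α₂ β₂ e₁ e₃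
  chi_vlam α β e₁ _ := MatSq.chi_vlam α β e₁
  chi_vrho α β e₁ _ := MatSq.chi_vrho α β e₁
  mu_vassoc _ _ _ _ _ := MatCube.ext
    ((mulHom_id_comp_id _).trans (comp_mulHom_id_id _).symm)
    ((mulHom_id_comp_id _).trans (comp_mulHom_id_id _).symm)
    ((mulHom_id_comp_id _).trans (comp_mulHom_id_id _).symm)
  mu_vlam _ _ := MatCube.ext (mulHom_id_comp_id _) (mulHom_id_comp_id _) (mulHom_id_comp_id _)
  mu_vrho _ _ := MatCube.ext (mulHom_id_comp_id _) (mulHom_id_comp_id _) (mulHom_id_comp_id _)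
  chi_hassoc α β γ α₁ β₁ γ₁ e₁ e₂ e₃ := MatSq.chi_hassoc α β γ α₁ β₁ γ₁ e₁ e₂ e₃
  delta_hassoc h k l e₁ e₂ := MatSq.delta_hassoc h k l e₁ e₂
  chi_hlam α α₁ e₁ e₂ := MatSq.chi_hlam α α₁ e₁ e₂
  delta_hlam h e := MatSq.delta_hlam h e
  chi_hrho α α₁ e₁ e₂ := MatSq.chi_hrho α α₁ e₁ e₂
  delta_hrho h e := MatSq.delta_hrho h e

end Bundled

/-! ### The intercategory with × horizontally and ⊗ vertically. -/

section ProdTensor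

theorem trivDbl_isDbl : trivDbl.IsDbl where
  dom_one _ := Subsingleton.elim _ _
  cod_one _ := Subsingleton.elim _ _
  dom_comp _ _ := Subsingleton.elim _ _
  cod_comp _ _ := Subsingleton.elim _ _
  one_comp _ := rfl
  comp_one _ := rfl
  comp_assoc _ _ _ := rfl
  dom_unitCell _ := Subsingleton.elim _ _
  cod_unitCell _ := Subsingleton.elim _ _
  unitCell_id _ := rfl
  unitCell_comp _ _ := rfl
  dom_mulCell _ _ _ := Subsingleton.elim _ _
  cod_mulCell _ _ _ := Subsingleton.elim _ _
  mulCell_one _ _ _ := rfl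
  mulCell_comp _ _ _ _ _ _ _ := rfl
  dom_assoc _ _ _ := Subsingleton.elim _ _
  cod_assoc _ _ _ := Subsingleton.elim _ _
  dom_lam _ := Subsingleton.elim _ _
  cod_lam _ := Subsingleton.elim _ _
  dom_rho _ := Subsingleton.elim _ _
  cod_rho _ := Subsingleton.elim _ _
  assoc_inv _ _ _ := ⟨⟨⟩, rfl, rfl⟩
  lam_inv _ := ⟨⟨⟩, rfl, rfl⟩
  rho_inv _ := ⟨⟨⟩, rfl, rfl⟩
  assoc_nat _ _ _ _ _ _ _ := rfl
  lam_nat _ _ := rfl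
  rho_nat _ _ := rfl
  pentagon _ _ _ _ _ _ := rfl
  triangle _ _ _ _ := rfl

variable (C : Type u) [Category.{v} C]

theorem objSq_isSq : IsSq (objSq C) where
  corner_tl _ := Subsingleton.elim _ _
  corner_tr _ := Subsingleton.elim _ _
  corner_bl _ := Subsingleton.elim _ _
  corner_br _ := Subsingleton.elim _ _
  one_special _ := ⟨rfl, rfl, rfl, rfl⟩
  faces_comp _ _ := ⟨rfl, rfl, rfl, rfl⟩
  one_comp _ := Category.id_comp _
  comp_one _ := Category.comp_id _
  comp_assoc _ _ _ := Category.assoc _ _ _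

attribute [local instance] hasBinaryProducts_of_hasTerminal_and_pullbacks

variable [MonoidalCategory C] [HasTerminal C] [HasPullbacks C]

theorem prodTensor_isHStr : IsHStr (prodTensor C).hs where
  faces_unitCube _ := ⟨rfl, rfl, rfl, rfl⟩
  unitCube_one _ := rfl
  unitCube_comp _ _ := (Category.comp_id _).symm
  faces_mulCube _ _ _ _ _ := ⟨rfl, rfl, rfl, rfl⟩
  mulCube_one _ _ _ := prod.map_id_id
  mulCube_comp _ _ _ _ _ _ _ := (prod.map_map _ _ _ _).symm
  faces_assoc _ _ _ := ⟨rfl, rfl, rfl, rfl⟩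
  faces_lam _ := ⟨rfl, rfl, rfl, rfl⟩
  faces_rho _ := ⟨rfl, rfl, rfl, rfl⟩
  assoc_inv (X : C) (Y : C) (Z : C) := ⟨(Limits.prod.associator X Y Z).inv, Iso.hom_inv_id _,
    Iso.inv_hom_id _⟩
  lam_inv (X : C) := ⟨(prod.leftUnitor X).inv, Iso.hom_inv_id _, Iso.inv_hom_id _⟩
  rho_inv (X : C) := ⟨(prod.rightUnitor X).inv, Iso.hom_inv_id _, Iso.inv_hom_id _⟩
  assoc_nat _ _ _ _ _ _ _ := prod.associator_naturality _ _ _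
  lam_nat _ _ := prod.leftUnitor_hom_naturality _
  rho_nat _ _ := prod.rightUnitor_hom_naturality _
  pentagon (X : C) (Y : C) (Z : C) (W : C) _ _ := prod.pentagon X Y Z W
  triangle (X : C) (Y : C) _ _ := prod.triangle X Y

theorem prodTensor_isVStr : IsHStr (prodTensor C).vs where
  faces_unitCube _ := ⟨rfl, rfl, rfl, rfl⟩
  unitCube_one _ := rfl
  unitCube_comp _ _ := (Category.comp_id _).symm
  faces_mulCube _ _ _ _ _ := ⟨rfl, rfl, rfl, rfl⟩
  mulCube_one _ _ _ := id_tensorHom_id _ _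
  mulCube_comp _ _ _ _ _ _ _ := (tensorHom_comp_tensorHom _ _ _ _).symm
  faces_assoc _ _ _ := ⟨rfl, rfl, rfl, rfl⟩
  faces_lam _ := ⟨rfl, rfl, rfl, rfl⟩
  faces_rho _ := ⟨rfl, rfl, rfl, rfl⟩
  assoc_inv (X : C) (Y : C) (Z : C) := ⟨(α_ X Y Z).inv, Iso.hom_inv_id _, Iso.inv_hom_id _⟩
  lam_inv (X : C) := ⟨(λ_ X).inv, Iso.hom_inv_id _, Iso.inv_hom_id _⟩
  rho_inv (X : C) := ⟨(ρ_ X).inv, Iso.hom_inv_id _, Iso.inv_hom_id _⟩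
  assoc_nat _ _ _ _ _ _ _ := associator_naturality _ _ _
  -- The unit cube is an identity morphism, and a tensor product with an identity has to be read as
  -- a whiskering before naturality of the unitor applies. The same change of form occurs in the
  -- pentagon and the triangle.
  lam_nat f _ := (congrArg (fun t => t ≫ _) (id_tensorHom _ f)).trans (leftUnitor_naturality (C := C) f)
  rho_nat f _ := (congrArg (fun t => t ≫ _) (tensorHom_id f _)).trans (rightUnitor_naturality (C := C) f)
  pentagon (X : C) (Y : C) (Z : C) (W : C) _ _ := by
    have := MonoidalCategory.pentagon X Y Z W
    rwa [← tensorHom_id, ← id_tensorHom] at this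
  triangle (X : C) (Y : C) _ _ := by
    have := MonoidalCategory.triangle X Y
    rwa [← tensorHom_id, ← id_tensorHom] at this

variable {C}

/-- The interchanger `(X × Y) ⊗ (Z × W) ⟶ (X ⊗ Z) × (Y ⊗ W)`. -/
noncomputable abbrev interchange (X Y Z W : C) : (X ⨯ Y) ⊗ (Z ⨯ W) ⟶ (X ⊗ Z) ⨯ (Y ⊗ W) :=
  prod.lift (prod.fst ⊗ₘ prod.fst) (prod.snd ⊗ₘ prod.snd)

/-- On each of the two projections of the target this is naturality of the associator of ⊗ with
respect to product projections. -/
theorem interchange_tensorAssoc (X Y X₁ Y₁ X₂ Y₂ : C) :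
    (interchange X Y X₁ Y₁ ⊗ₘ 𝟙 (X₂ ⨯ Y₂)) ≫ interchange (X ⊗ X₁) (Y ⊗ Y₁) X₂ Y₂ ≫
        prod.map (α_ X X₁ X₂).hom (α_ Y Y₁ Y₂).hom =
      (α_ _ _ _).hom ≫ (𝟙 (X ⨯ Y) ⊗ₘ interchange X₁ Y₁ X₂ Y₂) ≫
        interchange X Y (X₁ ⊗ X₂) (Y₁ ⊗ Y₂) := by
  apply Limits.prod.hom_ext <;>
    simp only [Category.assoc, prod.map_fst, prod.map_snd, prod.lift_fst, prod.lift_snd,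
      prod.lift_fst_assoc, prod.lift_snd_assoc, tensorHom_comp_tensorHom_assoc,
      tensorHom_comp_tensorHom, Category.id_comp, associator_naturality]

theorem interchange_tensorUnit_left (X Y : C) :
    (prod.lift (𝟙 (𝟙_ C)) (𝟙 (𝟙_ C)) ⊗ₘ 𝟙 (X ⨯ Y)) ≫ interchange (𝟙_ C) (𝟙_ C) X Y ≫
      prod.map (λ_ X).hom (λ_ Y).hom = (λ_ (X ⨯ Y)).hom := by
  apply Limits.prod.hom_ext <;>
    simp only [Category.assoc, prod.map_fst, prod.map_snd, prod.lift_fst, prod.lift_snd,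
      prod.lift_fst_assoc, prod.lift_snd_assoc, tensorHom_comp_tensorHom_assoc,
      Category.id_comp, id_tensorHom, leftUnitor_naturality]

theorem interchange_tensorUnit_right (X Y : C) :
    (𝟙 (X ⨯ Y) ⊗ₘ prod.lift (𝟙 (𝟙_ C)) (𝟙 (𝟙_ C))) ≫ interchange X Y (𝟙_ C) (𝟙_ C) ≫
      prod.map (ρ_ X).hom (ρ_ Y).hom = (ρ_ (X ⨯ Y)).hom := by
  apply Limits.prod.hom_ext <;>
    simp only [Category.assoc, prod.map_fst, prod.map_snd, prod.lift_fst, prod.lift_snd,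
      prod.lift_fst_assoc, prod.lift_snd_assoc, tensorHom_comp_tensorHom_assoc,
      Category.id_comp, tensorHom_id, rightUnitor_naturality]

/-- On each of the three projections only the bifunctoriality of ⊗ is needed. -/
theorem interchange_prodAssoc (X Y Z X₁ Y₁ Z₁ : C) :
    interchange (X ⨯ Y) Z (X₁ ⨯ Y₁) Z₁ ≫ prod.map (interchange X Y X₁ Y₁) (𝟙 (Z ⊗ Z₁)) ≫
        (Limits.prod.associator _ _ _).hom =
      ((Limits.prod.associator X Y Z).hom ⊗ₘ (Limits.prod.associator X₁ Y₁ Z₁).hom) ≫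
        interchange X (Y ⨯ Z) X₁ (Y₁ ⨯ Z₁) ≫
          prod.map (𝟙 (X ⊗ X₁)) (interchange Y Z Y₁ Z₁) := by
  refine Limits.prod.hom_ext ?_ (Limits.prod.hom_ext ?_ ?_) <;>
    simp only [Category.assoc, prod.map_fst, prod.map_snd, prod.map_fst_assoc,
      prod.lift_fst, prod.lift_snd, prod.lift_fst_assoc, prod.lift_snd_assoc,
      Limits.prod.associator_hom, tensorHom_comp_tensorHom_assoc, tensorHom_comp_tensorHom,
      Category.comp_id]

/-- The initial identity on the right-hand side is the vertical identity cube on the horizontal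
associativity cell, which is trivial here. -/
theorem diag_prodAssoc (X : C) :
    prod.lift (𝟙 X) (𝟙 X) ≫ prod.map (prod.lift (𝟙 X) (𝟙 X)) (𝟙 X) ≫
        (Limits.prod.associator X X X).hom =
      𝟙 X ≫ prod.lift (𝟙 X) (𝟙 X) ≫ prod.map (𝟙 X) (prod.lift (𝟙 X) (𝟙 X)) := by
  refine Limits.prod.hom_ext ?_ (Limits.prod.hom_ext ?_ ?_) <;>
    simp only [Category.assoc, prod.map_fst, prod.map_snd, prod.map_fst_assoc,
      prod.lift_fst, prod.lift_snd, prod.lift_snd_assoc,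
      Limits.prod.associator_hom, Category.comp_id, Category.id_comp]

variable (C)

theorem prodTensor_isIntercategory : (prodTensor C).IsIntercategory where
  isDblH := trivDbl_isDbl
  isDblV := trivDbl_isDbl
  isSq := objSq_isSq C
  isHStr := prodTensor_isHStr C
  isVStr := prodTensor_isVStr C
  chi_special _ _ _ _ := ⟨rfl, rfl, rfl, rfl⟩
  mu_special _ _ := ⟨rfl, rfl, rfl, rfl⟩
  delta_special _ _ := ⟨rfl, rfl, rfl, rfl⟩
  tau_special _ := ⟨rfl, rfl, rfl, rfl⟩
  chi_nat f g f₁ g₁ _ _ _ _ _ _ := by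
    dsimp only [prodTensor]
    apply Limits.prod.hom_ext <;> simp [tensorHom_comp_tensorHom]
  -- All conditions on μ and τ compare morphisms into the terminal object.
  mu_nat _ _ _ _ := terminal.hom_ext _ _
  delta_nat _ _ _ _ := by
    apply Limits.prod.hom_ext <;> simp
  tau_nat _ := terminal.hom_ext _ _
  chi_vassoc (X : C) (Y : C) (X₁ : C) (Y₁ : C) (X₂ : C) (Y₂ : C) _ _ _ :=
    interchange_tensorAssoc X Y X₁ Y₁ X₂ Y₂
  chi_vlam (X : C) (Y : C) _ _ := interchange_tensorUnit_left X Y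
  chi_vrho (X : C) (Y : C) _ _ := interchange_tensorUnit_right X Y
  mu_vassoc _ _ _ _ _ := terminal.hom_ext _ _
  mu_vlam _ _ := terminal.hom_ext _ _
  mu_vrho _ _ := terminal.hom_ext _ _
  chi_hassoc (X : C) (Y : C) (Z : C) (X₁ : C) (Y₁ : C) (Z₁ : C) _ _ _ :=
    interchange_prodAssoc X Y Z X₁ Y₁ Z₁
  delta_hassoc _ _ _ _ _ := diag_prodAssoc (𝟙_ C)
  -- The unitors of × are projections, so the remaining conditions are the defining equations of χ
  -- and δ.
  chi_hlam _ _ _ _ := by simpa using prod.lift_snd _ _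
  delta_hlam _ _ := by simpa using prod.lift_snd _ _
  chi_hrho _ _ _ _ := by simpa using prod.lift_fst _ _
  delta_hrho _ _ := by simpa using prod.lift_fst _ _

end ProdTensor


open MatHom

/-! ### Spans of 1 × 1 matrices and the comparisons of F. -/

section Embedding

attribute [local instance] hasBinaryProducts_of_hasTerminal_and_pullbacks

variable {C : Type u} [Category.{v} C] [MonoidalCategory C] [HasTerminal C] [HasPullbacks C]
  [HasCoproducts.{w} C]
  [∀ (X : C) (J : Type w), PreservesColimitsOfShape (Discrete J) (tensorLeft X)]
  [∀ (X : C) (J : Type w), PreservesColimitsOfShape (Discrete J) (tensorRight X)]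

set_option linter.unusedSectionVars false

/-- Morphisms to a `1 × 1` matrix are equal if their components are. -/
theorem single_ext {A B : Type w} {M : A → B → C} {X : C} {φ ψ : MatHom M (single.{u, w} X)}
    (h : ∀ a b, φ.app a b = ψ.app a b) : φ = ψ :=
  ext_re (fun _ => rfl) (fun _ => rfl) fun a b => (Category.comp_id _).trans (h a b)

/-- Cubes to a span of matrices with feet `[1]` are equal if their middle components are. -/
theorem MatCube.ext_pt {A B A₁ B₁ : Type w} {h : Spn A B} {k : Spn A₁ B₁}
    {x : A → A₁ → C} {y : B → B₁ → C} {h' : Spn pt pt} {k' : Spn pt pt} {α : MatSq h k x y}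
    {α' : MatSq h' k' (single.{u, w} (⊤_ C)) (single (⊤_ C))} {Φ Ψ : MatCube α α'}
    (e : Φ.mid = Ψ.mid) : Φ = Ψ :=
  MatCube.ext (toPt_unique _ _) e (toPt_unique _ _)

/-- Compatibility over the middle foot is automatic because [1] is terminal, so the comparison is
given freely by the two product projections. -/
theorem singleProd_p₁ (X Y : C) :
    (singleProd.{u, v, w} X Y).mid.comp ((singleSq X).p₁ (singleSq Y)) = singleHom prod.fst :=
  MatSq.lift_p₁ _ _ _ _ (toPt_unique _ _)

theorem singleProd_p₂ (X Y : C) :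
    (singleProd.{u, v, w} X Y).mid.comp ((singleSq X).p₂ (singleSq Y)) = singleHom prod.snd :=
  MatSq.lift_p₂ _ _ _ _ (toPt_unique _ _)

theorem singleProd_p₁_assoc (X Y : C) {A B : Type w} {Q : A → B → C} (ξ : MatHom (single X) Q) :
    (singleProd.{u, v, w} X Y).mid.comp (((singleSq X).p₁ (singleSq Y)).comp ξ) =
      (singleHom prod.fst).comp ξ :=
  comp_congr_assoc (singleProd_p₁ X Y) ξ

theorem singleProd_p₂_assoc (X Y : C) {A B : Type w} {Q : A → B → C} (ξ : MatHom (single Y) Q) :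
    (singleProd.{u, v, w} X Y).mid.comp (((singleSq X).p₂ (singleSq Y)).comp ξ) =
      (singleHom prod.snd).comp ξ :=
  comp_congr_assoc (singleProd_p₂ X Y) ξ

theorem singleProd_nat {X Y X' Y' : C} (f : X ⟶ X') (g : Y ⟶ Y')
    (e : (cubeTo (singleSq.{u, v, w} X) X' (singleHom f)).right =
      (cubeTo (singleSq Y) Y' (singleHom g)).left) :
    (cubeTo (singleSq (X ⨯ Y)) (X' ⨯ Y') (singleHom (prod.map f g))).comp (singleProd X' Y') =
      (singleProd X Y).comp ((cubeTo _ _ (singleHom f)).hmul (cubeTo _ _ (singleHom g)) e) := by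
  refine MatCube.ext_pt (MatSq.lift_ext ?_ ?_)
  · refine (MatHom.comp_assoc _ _ _).trans ((congrArg _ (singleProd_p₁ X' Y')).trans ?_)
    refine Eq.trans ?_ ((MatHom.comp_assoc _ _ _).trans ((congrArg _ (MatCube.hmul_p₁ _ _ e)).trans
      (singleProd_p₁_assoc X Y (singleHom f)))).symm
    exact congrArg singleHom (prod.map_fst f g)
  · refine (MatHom.comp_assoc _ _ _).trans ((congrArg _ (singleProd_p₂ X' Y')).trans ?_)
    refine Eq.trans ?_ ((MatHom.comp_assoc _ _ _).trans ((congrArg _ (MatCube.hmul_p₂ _ _ e)).trans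
      (singleProd_p₂_assoc X Y (singleHom g)))).symm
    exact congrArg singleHom (prod.map_snd f g)

/-- On the three projections of the iterated pullback both sides are the 1 × 1 matrices of the
composite product projections, which is how the associator of × is defined. -/
theorem singleProd_assoc (X Y Z : C)
    (e₁ : (singleProd.{u, v, w} X Y).right = (MatCube.one (singleSq Z)).left)
    (e₂ : (MatCube.one (singleSq X)).right = (singleProd.{u, v, w} Y Z).left) :
    (singleProd (X ⨯ Y) Z).comp (((singleProd X Y).hmul (MatCube.one (singleSq Z)) e₁).comp
        ((singleSq X).hassoc (singleSq Y) (singleSq Z))) =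
      (cubeTo _ _ (singleHom (Limits.prod.associator X Y Z).hom)).comp
        ((singleProd X (Y ⨯ Z)).comp
          ((MatCube.one (singleSq X)).hmul (singleProd Y Z) e₂)) := by
  refine MatCube.ext_pt (MatSq.lift_ext ?_ (MatSq.lift_ext ?_ ?_)) <;>
    simp only [MatCube.comp, MatHom.comp_assoc, MatSq.hassoc_p₁, MatSq.hassoc_p₂_p₁,
      MatSq.hassoc_p₂_p₂, MatCube.hmul_p₁, MatCube.hmul_p₁_assoc, MatCube.hmul_p₂,
      singleProd_p₁, singleProd_p₂]
  · refine (singleProd_p₁_assoc (X ⨯ Y) Z (singleHom prod.fst)).trans ?_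
    refine Eq.trans ?_ (congrArg (MatHom.comp _)
      ((singleProd_p₁_assoc X (Y ⨯ Z) (MatHom.id _)).trans (MatHom.comp_id _))).symm
    exact congrArg singleHom (show prod.fst ≫ prod.fst =
      (Limits.prod.associator X Y Z).hom ≫ prod.fst from (prod.lift_fst _ _).symm)
  · refine (singleProd_p₁_assoc (X ⨯ Y) Z (singleHom prod.snd)).trans ?_
    refine Eq.trans ?_ (congrArg (MatHom.comp _)
      (singleProd_p₂_assoc X (Y ⨯ Z) (singleHom prod.fst))).symm
    exact congrArg singleHom (show prod.fst ≫ prod.snd =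
      (Limits.prod.associator X Y Z).hom ≫ prod.snd ≫ prod.fst from
        ((prod.lift_snd_assoc _ _ _).trans (prod.lift_fst _ _)).symm)
  · refine (congrArg (MatHom.comp _) (MatHom.comp_id _)).trans
      ((singleProd_p₂ (X ⨯ Y) Z).trans ?_)
    refine Eq.trans ?_ (congrArg (MatHom.comp _)
      (singleProd_p₂_assoc X (Y ⨯ Z) (singleHom prod.snd))).symm
    exact congrArg singleHom (show prod.snd =
      (Limits.prod.associator X Y Z).hom ≫ prod.snd ≫ prod.snd from
        ((prod.lift_snd_assoc _ _ _).trans (prod.lift_snd _ _)).symm)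

theorem singleProd_lam (X : C)
    (e : (singleOne.{u, v, w} C).right = (MatCube.one (singleSq X)).left) :
    (singleProd (⊤_ C) X).comp (((singleOne C).hmul (MatCube.one (singleSq X)) e).comp
        (singleSq X).hlam) =
      cubeTo _ _ (singleHom (Limits.prod.leftUnitor X).hom) :=
  MatCube.ext_pt <| (congrArg (MatHom.comp _) ((singleOne C).hmul_p₂ (MatCube.one _) e)).trans <|
    (singleProd_p₂_assoc _ _ _).trans (MatHom.comp_id _)

theorem singleProd_rho (X : C)
    (e : (MatCube.one (singleSq X)).right = (singleOne.{u, v, w} C).left) :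
    (singleProd X (⊤_ C)).comp (((MatCube.one (singleSq X)).hmul (singleOne C) e).comp
        (singleSq X).hrho) =
      cubeTo _ _ (singleHom (Limits.prod.rightUnitor X).hom) :=
  MatCube.ext_pt <| (congrArg (MatHom.comp _) ((MatCube.one _).hmul_p₁ (singleOne C) e)).trans <|
    (singleProd_p₁_assoc _ _ _).trans (MatHom.comp_id _)

/-- The inverse of `singleProd`. -/
noncomputable def singleProdInv (X Y : C) :
    MatCube ((singleSq.{u, v, w} X).hmul (singleSq Y)) (singleSq (X ⨯ Y)) :=
  cubeTo _ _ ⟨fun _ => ⟨⟩, fun _ => ⟨⟩, fun p q =>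
    prod.lift (((singleSq X).p₁ (singleSq Y)).app p q) (((singleSq X).p₂ (singleSq Y)).app p q)⟩

/-- A pullback over a terminal matrix is a product, hence the horizontal strength of F. This
composite is tested on the projections of the product in `C`, the opposite one on those of the
pullback of matrices. -/
theorem singleProd_hom_inv (X Y : C) :
    (singleProd.{u, v, w} X Y).comp (singleProdInv X Y) = MatCube.one _ :=
  -- Entries of the matrix equations for the projections are extracted by `app_re`; the transport
  -- along `rfl` is an identity, whence the inserted `Category.comp_id`.
  MatCube.ext_pt <| single_ext fun a b => Limits.prod.hom_ext
    ((Category.assoc _ _ _).trans <| (congrArg _ (prod.lift_fst _ _)).trans <|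
      (Category.comp_id _).symm.trans <|
      (app_re (singleProd_p₁ X Y) a b rfl rfl).trans (Category.id_comp _).symm)
    ((Category.assoc _ _ _).trans <| (congrArg _ (prod.lift_snd _ _)).trans <|
      (Category.comp_id _).symm.trans <|
      (app_re (singleProd_p₂ X Y) a b rfl rfl).trans (Category.id_comp _).symm)

theorem singleProd_inv_hom (X Y : C) :
    (singleProdInv.{u, v, w} X Y).comp (singleProd X Y) = MatCube.one _ :=
  MatCube.ext_pt <| MatSq.lift_ext
    ((MatHom.comp_assoc _ _ _).trans <| (congrArg _ (singleProd_p₁ X Y)).trans <|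
      Eq.trans (single_ext fun _ _ => prod.lift_fst _ _) (MatHom.id_comp _).symm)
    ((MatHom.comp_assoc _ _ _).trans <| (congrArg _ (singleProd_p₂ X Y)).trans <|
      Eq.trans (single_ext fun _ _ => prod.lift_snd _ _) (MatHom.id_comp _).symm)

/-- The comparison `[X] [Y] → [X ⊗ Y]`. -/
noncomputable def singleMul (X Y : C) :
    MatHom (mulMat (single.{u, w} X) (single.{u, w} Y)) (single.{u, w} (X ⊗ Y)) :=
  ⟨fun a => a, fun b => b, fun _ _ => mulDesc fun _ => 𝟙 (X ⊗ Y)⟩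

variable (C) in
/-- The comparison from the `1 × 1` identity matrix to `[I]`. -/
noncomputable def singleUnit : MatHom (unitMat C pt.{w}) (single.{u, w} (𝟙_ C)) :=
  ⟨fun a => a, fun b => b, fun a b => unitDesc a b fun _ => 𝟙 (𝟙_ C)⟩

/-- The sum over the one-element set has a single summand, on which the comparison is the identity.
-/
theorem mulIn_singleMul (X Y : C) (a b d : pt.{w}) {Z : C} (f : X ⊗ Y ⟶ Z) :
    mulIn (single.{u, w} X) (single.{u, w} Y) a b d ≫ (singleMul X Y).app a d ≫ f = f :=
  (mulIn_desc_assoc _ _ _).trans (Category.id_comp _)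

theorem singleMul_nat {X Y X' Y' : C} (f : X ⟶ X') (g : Y ⟶ Y')
    (e : (singleHom.{u, v, w} f).snd = (singleHom g).fst) :
    (mulHom (singleHom f) (singleHom g) e).comp (singleMul X' Y') =
      (singleMul X Y).comp (singleHom (f ⊗ₘ g)) := by
  refine single_ext fun a d => mul_ext fun b => ?_
  refine Eq.trans ?_ (mulIn_singleMul X Y a b d (f ⊗ₘ g)).symm
  refine (mulIn_desc_assoc _ _ _).trans ((Category.assoc _ _ _).trans ?_)
  refine (congrArg _ (mulIn_desc _ _)).trans ?_
  exact (Category.comp_id _).trans (congrArg _ (Category.comp_id _))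

/-- Every self-map of the one-element set is the identity, definitionally. -/
theorem unitHom_singleUnit (f : pt.{w} → pt.{w}) :
    (unitHom f).comp (singleUnit C) = singleUnit C :=
  unitHom_self_comp _

theorem singleMul_assoc (X Y Z : C) (e₁ : (singleMul.{u, v, w} X Y).snd = (MatHom.id (single Z)).fst)
    (e₂ : (MatHom.id (single X)).snd = (singleMul.{u, v, w} Y Z).fst) :
    (mulHom (singleMul.{u, v, w} X Y) (MatHom.id (single Z)) e₁).comp
        ((singleMul (X ⊗ Y) Z).comp (singleHom (α_ X Y Z).hom)) =
      (assocMat (single X) (single Y) (single Z)).comp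
        ((mulHom (MatHom.id (single X)) (singleMul Y Z) e₂).comp (singleMul X (Y ⊗ Z))) := by
  refine single_ext fun a d => mulMul_ext fun b c => ?_
  dsimp only [mulHom, MatHom.comp, assocMat, MatHom.id]
  rw [mulIn_mulIn_assocApp]
  simp only [mulIn_desc_assoc, Category.assoc]
  -- Each pair consists of the injection of the only summand and the comparison that retracts it.
  -- Beyond these four retractions only the functoriality of whiskering is used.
  have key : ∀ {P Q R S : C} (i : X ⊗ Y ⟶ P) (p : P ⟶ X ⊗ Y) (j : (X ⊗ Y) ⊗ Z ⟶ Q)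
      (q : Q ⟶ (X ⊗ Y) ⊗ Z) (k : Y ⊗ Z ⟶ R) (r : R ⟶ Y ⊗ Z) (l : X ⊗ (Y ⊗ Z) ⟶ S)
      (s : S ⟶ X ⊗ (Y ⊗ Z)) (_ : i ≫ p = 𝟙 _) (_ : j ≫ q = 𝟙 _) (_ : k ≫ r = 𝟙 _)
      (_ : l ≫ s = 𝟙 _), (i ▷ Z) ≫ (p ⊗ₘ (𝟙 Z ≫ 𝟙 Z)) ≫ j ≫ q ≫ (α_ X Y Z).hom =
        (α_ X Y Z).hom ≫ (X ◁ k) ≫ (𝟙 X ⊗ₘ (r ≫ 𝟙 _)) ≫ l ≫ s := by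
    intro P Q R S i p j q k r l s hp hq hr hs
    rw [Category.comp_id, tensorHom_id, Category.comp_id, id_tensorHom, ← comp_whiskerRight_assoc,
      hp, ← whiskerLeft_comp_assoc, hr, hs, reassoc_of% hq]
    simp
  exact key _ _ _ _ _ _ _ _ (mulIn_desc _ _) (mulIn_desc _ _) (mulIn_desc _ _) (mulIn_desc _ _)

theorem singleMul_lam (X : C) (e : (singleUnit.{u, v, w} C).snd = (MatHom.id (single X)).fst) :
    (mulHom (singleUnit.{u, v, w} C) (MatHom.id (single X)) e).comp
        ((singleMul (𝟙_ C) X).comp (singleHom (λ_ X).hom)) = lamMat (single X) := by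
  refine single_ext fun a b => unitMul_ext ?_
  refine Eq.trans ?_ (unit_ι_lam (single X) a b).symm
  dsimp only [mulHom, MatHom.comp, MatHom.id]
  simp only [mulIn_desc_assoc, Category.assoc]
  have key : ∀ {P : C} (i : 𝟙_ C ⟶ P) (p : P ⟶ 𝟙_ C) (_ : i ≫ p = 𝟙 _),
      (i ▷ X) ≫ (p ⊗ₘ (𝟙 X ≫ 𝟙 X)) ≫ (λ_ X).hom = (λ_ X).hom := by
    intro P i p hp
    rw [Category.comp_id, tensorHom_id, ← comp_whiskerRight_assoc, hp, id_whiskerRight,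
      Category.id_comp]
  refine Eq.trans ?_ (key _ _ (unitIn_desc (rfl : a = a) fun _ => 𝟙 (𝟙_ C)))
  exact congrArg _ (congrArg _ (mulIn_singleMul (𝟙_ C) X a a b (λ_ X).hom))

theorem singleMul_rho (X : C) (e : (MatHom.id (single X)).snd = (singleUnit.{u, v, w} C).fst) :
    (mulHom (MatHom.id (single X)) (singleUnit.{u, v, w} C) e).comp
        ((singleMul X (𝟙_ C)).comp (singleHom (ρ_ X).hom)) = rhoMat (single X) := by
  refine single_ext fun a b => mulUnit_ext ?_
  refine Eq.trans ?_ (unit_ι_rho (single X) a b).symm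
  dsimp only [mulHom, MatHom.comp, MatHom.id]
  simp only [mulIn_desc_assoc, Category.assoc]
  have key : ∀ {P : C} (i : 𝟙_ C ⟶ P) (p : P ⟶ 𝟙_ C) (_ : i ≫ p = 𝟙 _),
      (X ◁ i) ≫ (𝟙 X ⊗ₘ (p ≫ 𝟙 _)) ≫ (ρ_ X).hom = (ρ_ X).hom := by
    intro P i p hp
    rw [Category.comp_id, id_tensorHom, ← whiskerLeft_comp_assoc, hp, whiskerLeft_id,
      Category.id_comp]
  refine Eq.trans ?_ (key _ _ (unitIn_desc (rfl : b = b) fun _ => 𝟙 (𝟙_ C)))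
  exact congrArg _ (congrArg _ (mulIn_singleMul X (𝟙_ C) a b b (ρ_ X).hom))

/-- After projection, χ of matrices becomes a product of projections; composed with `singleProd` it
is the product of two 1 × 1 matrices of product projections. Naturality of `singleMul` carries it to
the tensor product of the projections, a component of χ in `C`. -/
theorem singleMul_chi (X Y X₁ Y₁ : C)
    (e₁ : (singleProd.{u, v, w} X Y).bot = (singleProd X₁ Y₁).top)
    (e₂ : (cubeTo ((singleSq.{u, v, w} X).vmul (singleSq X₁)) (X ⊗ X₁) (singleMul X X₁)).right =
      (cubeTo ((singleSq.{u, v, w} Y).vmul (singleSq Y₁)) (Y ⊗ Y₁) (singleMul Y Y₁)).left) :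
    (cubeTo ((singleSq.{u, v, w} (X ⨯ Y)).vmul (singleSq (X₁ ⨯ Y₁))) _ (singleMul _ _)).comp
        ((cubeTo (singleSq _) _ (singleHom (interchange X Y X₁ Y₁))).comp
          (singleProd (X ⊗ X₁) (Y ⊗ Y₁))) =
      ((singleProd X Y).vmul (singleProd X₁ Y₁) e₁).comp
        (((singleSq X).chi (singleSq Y) (singleSq X₁) (singleSq Y₁)).comp
          ((cubeTo ((singleSq X).vmul (singleSq X₁)) (X ⊗ X₁) (singleMul X X₁)).hmul
            (cubeTo ((singleSq Y).vmul (singleSq Y₁)) (Y ⊗ Y₁) (singleMul Y Y₁)) e₂)) := by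
  refine MatCube.ext_pt (MatSq.lift_ext ?_ ?_)
  · refine (MatHom.comp_assoc _ _ _).trans ((congrArg _ ((MatHom.comp_assoc _ _ _).trans
      (congrArg _ (singleProd_p₁ (X ⊗ X₁) (Y ⊗ Y₁))))).trans ?_)
    refine Eq.trans ?_ ((MatHom.comp_assoc _ _ _).trans
      (congrArg _ (MatSq.chi_hmul_p₁ _ _ e₂))).symm
    refine Eq.trans ?_ ((MatHom.comp_assoc _ _ _).symm.trans (congrArg (fun ξ => MatHom.comp ξ
      (singleMul X X₁)) (mulHom_comp_eq (congrArg SpnHom.mid e₁) rfl rfl (singleProd_p₁ X Y)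
        (singleProd_p₁ X₁ Y₁)))).symm
    refine Eq.trans ?_ (singleMul_nat _ _ _).symm
    exact congrArg (fun f => (singleMul _ _).comp (singleHom f)) (prod.lift_fst _ _)
  · refine (MatHom.comp_assoc _ _ _).trans ((congrArg _ ((MatHom.comp_assoc _ _ _).trans
      (congrArg _ (singleProd_p₂ (X ⊗ X₁) (Y ⊗ Y₁))))).trans ?_)
    refine Eq.trans ?_ ((MatHom.comp_assoc _ _ _).trans
      (congrArg _ (MatSq.chi_hmul_p₂ _ _ e₂))).symm
    refine Eq.trans ?_ ((MatHom.comp_assoc _ _ _).symm.trans (congrArg (fun ξ => MatHom.comp ξ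
      (singleMul Y Y₁)) (mulHom_comp_eq (congrArg SpnHom.mid e₁) rfl rfl (singleProd_p₂ X Y)
        (singleProd_p₂ X₁ Y₁)))).symm
    refine Eq.trans ?_ (singleMul_nat _ _ _).symm
    exact congrArg (fun f => (singleMul _ _).comp (singleHom f)) (prod.lift_snd _ _)

/-- The morphism `φ` may be arbitrary: after a projection it only contributes a self-map of the
one-element set, which `unitHom_singleUnit` absorbs. -/
theorem singleUnit_delta (φ : SpnHom (Spn.unit pt.{w}) ((Spn.unit pt).mul (Spn.unit pt)))
    (e : (cubeTo (MatSq.vunit C (Spn.unit pt.{w})) (𝟙_ C) (singleUnit C)).right =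
      (cubeTo (MatSq.vunit C (Spn.unit pt)) (𝟙_ C) (singleUnit C)).left) :
    (cubeTo (MatSq.vunit C (Spn.unit pt)) (𝟙_ C) (singleUnit C)).comp
        ((cubeTo (singleSq _) _ (singleHom (prod.lift (𝟙 (𝟙_ C)) (𝟙 (𝟙_ C))))).comp
          (singleProd (𝟙_ C) (𝟙_ C))) =
      (MatCube.vunit φ).comp ((MatSq.delta C (Spn.unit pt) (Spn.unit pt)).comp
        ((cubeTo (MatSq.vunit C (Spn.unit pt)) (𝟙_ C) (singleUnit C)).hmul
          (cubeTo (MatSq.vunit C (Spn.unit pt)) (𝟙_ C) (singleUnit C)) e)) := by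
  refine MatCube.ext_pt (MatSq.lift_ext ?_ ?_)
  · refine (MatHom.comp_assoc _ _ _).trans ((congrArg _ ((MatHom.comp_assoc _ _ _).trans
      (congrArg _ (singleProd_p₁ (𝟙_ C) (𝟙_ C))))).trans ?_)
    refine Eq.trans ?_ ((MatHom.comp_assoc _ _ _).trans ((congrArg _
      (MatSq.delta_hmul_p₁ _ _ e)).trans (comp_congr_assoc (unitHom_comp φ.mid
        fun p : ((Spn.unit pt).mul (Spn.unit pt)).apex => p.1.1) (singleUnit C)))).symm
    refine Eq.trans ?_ (unitHom_singleUnit _).symm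
    refine (congrArg (fun f => (singleUnit C).comp (singleHom f)) (prod.lift_fst _ _)).trans ?_
    exact MatHom.comp_id _
  · refine (MatHom.comp_assoc _ _ _).trans ((congrArg _ ((MatHom.comp_assoc _ _ _).trans
      (congrArg _ (singleProd_p₂ (𝟙_ C) (𝟙_ C))))).trans ?_)
    refine Eq.trans ?_ ((MatHom.comp_assoc _ _ _).trans ((congrArg _
      (MatSq.delta_hmul_p₂ _ _ e)).trans (comp_congr_assoc (unitHom_comp φ.mid
        fun p : ((Spn.unit pt).mul (Spn.unit pt)).apex => p.1.2) (singleUnit C)))).symm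
    refine Eq.trans ?_ (unitHom_singleUnit _).symm
    refine (congrArg (fun f => (singleUnit C).comp (singleHom f)) (prod.lift_snd _ _)).trans ?_
    exact MatHom.comp_id _

end Embedding


open MatHom

/-! ### F is a colax-lax morphism, horizontally strong and a full inclusion. -/

section EmbeddingLaws

attribute [local instance] hasBinaryProducts_of_hasTerminal_and_pullbacks

variable (C : Type u) [Category.{v} C] [MonoidalCategory C] [HasTerminal C] [HasPullbacks C]
  [HasCoproducts.{w} C]
  [∀ (X : C) (J : Type w), PreservesColimitsOfShape (Discrete J) (tensorLeft X)]
  [∀ (X : C) (J : Type w), PreservesColimitsOfShape (Discrete J) (tensorRight X)]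

theorem embF_isSqColax : IsSqColax (embF.{u, v, w} C).hsc where
  faces_mul _ _ := ⟨rfl, rfl, toPt_unique _ _, toPt_unique _ _⟩
  faces_unit _ := ⟨rfl, rfl, toPt_unique _ _, toPt_unique _ _⟩
  mul_nat f g _ e := singleProd_nat (C := C) f g e
  unit_nat _ := MatCube.ext (toPt_unique _ _) (toPt_unique _ _) (toPt_unique _ _)
  assoc (X : C) (Y : C) (Z : C) e₁ e₂ := singleProd_assoc X Y Z e₁ e₂
  lam (X : C) e := singleProd_lam X e
  rho (X : C) e := singleProd_rho X e

theorem embF_isHColax : (embF.{u, v, w} C).toHColax.IsHColax where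
  isH :=
    { dom_cell := fun _ => rfl
      cod_cell := fun _ => rfl
      cell_one := fun _ => rfl
      cell_comp := fun _ _ => rfl }
  isV :=
    { dom_cell := fun _ => rfl
      cod_cell := fun _ => rfl
      cell_one := fun _ => rfl
      cell_comp := fun _ _ => toPt_unique _ _ }
  isS :=
    { faces_cube := fun _ => ⟨rfl, rfl, toPt_unique _ _, toPt_unique _ _⟩
      cube_one := fun _ => MatCube.ext_pt rfl
      cube_comp := fun _ _ => MatCube.ext_pt rfl }
  isColaxH :=
    { dom_mul := fun _ _ => rfl
      cod_mul := fun _ _ => rfl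
      dom_unit := fun _ => rfl
      cod_unit := fun _ => rfl
      mul_nat := fun _ _ _ _ => rfl
      unit_nat := fun _ => rfl
      assoc := fun _ _ _ _ _ => rfl
      lam := fun _ _ => rfl
      rho := fun _ _ => rfl }
  isColaxHS := embF_isSqColax C

/-- On vertical arrows all equations are between morphisms to the terminal matrix [1]. -/
theorem embF_isLax : IsLax (embF.{u, v, w} C).vl where
  dom_mul _ _ := rfl
  cod_mul _ _ := rfl
  dom_unit _ := rfl
  cod_unit _ := rfl
  mul_nat _ _ _ _ := toPt_unique _ _
  unit_nat _ := toPt_unique _ _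
  assoc _ _ _ _ _ := toPt_unique _ _
  lam _ _ := toPt_unique _ _
  rho _ _ := toPt_unique _ _

theorem embF_isSqLax : IsSqLax (embF.{u, v, w} C).vsl where
  faces_mul _ _ := ⟨rfl, rfl, rfl, rfl⟩
  faces_unit _ := ⟨rfl, rfl, rfl, rfl⟩
  mul_nat f g _ _ := MatCube.ext_pt (singleMul_nat (C := C) f g rfl)
  unit_nat _ := MatCube.ext_pt ((unitHom_singleUnit _).trans (MatHom.comp_id _).symm)
  assoc (X : C) (Y : C) (Z : C) _ _ := MatCube.ext_pt (singleMul_assoc X Y Z rfl rfl)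
  lam (X : C) _ := MatCube.ext_pt (singleMul_lam X rfl)
  rho (X : C) _ := MatCube.ext_pt (singleMul_rho X rfl)

theorem embF_isColaxLax : (embF.{u, v, w} C).IsColaxLax where
  isHColax := embF_isHColax C
  isLaxV := embF_isLax C
  isLaxVS := embF_isSqLax C
  chi (X : C) (Y : C) (X₁ : C) (Y₁ : C) e₁ e₂ := singleMul_chi X Y X₁ Y₁ e₁ e₂
  mu _ _ _ := MatCube.ext (toPt_unique _ _) (toPt_unique _ _) (toPt_unique _ _)
  delta _ _ e := singleUnit_delta _ e
  tau _ := MatCube.ext (toPt_unique _ _) (toPt_unique _ _) (toPt_unique _ _)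

theorem embF_isStrong : (embF.{u, v, w} C).toHColax.IsStrong where
  mul_inv _ _ := ⟨⟨fun a => a, fun _ => ⟨⟩, fun b => b, fun _ => rfl, fun _ => rfl⟩, rfl, rfl⟩
  unit_inv _ := ⟨SpnHom.one _, rfl, rfl⟩
  sqmul_inv (X : C) (Y : C) := ⟨singleProdInv X Y, singleProd_hom_inv X Y, singleProd_inv_hom X Y⟩
  squnit_inv _ := ⟨⟨toPt _, singleHom (𝟙 _), toPt _, toPt_unique _ _, toPt_unique _ _⟩,
    MatCube.ext (toPt_unique _ _) (toPt_unique _ _) (toPt_unique _ _),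
    MatCube.ext (toPt_unique _ _) (toPt_unique _ _) (toPt_unique _ _)⟩

theorem singleSq_injective :
    Function.Injective (singleSq (C := C) : C → MatSq (Spn.unit pt.{w}) _ _ _) :=
  fun _ _ h => congrFun (congrFun (congrArg MatSq.mat h) PUnit.unit) PUnit.unit

theorem singleHom_injective (X Y : C) :
    Function.Injective (singleHom : (X ⟶ Y) → MatHom (single.{u, w} X) (single Y)) :=
  fun _ _ h => (Category.comp_id _).symm.trans (app_re h PUnit.unit PUnit.unit rfl rfl)

/-- The feet of such a cube are forced by terminality and its index functions by the one-element
index sets, so the single middle entry is all its data. -/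
theorem cubeTo_singleHom_bijective (X Y : C) :
    Function.Bijective fun f : X ⟶ Y => cubeTo (singleSq.{u, v, w} X) Y (singleHom f) :=
  ⟨fun _ _ h => singleHom_injective C X Y (congrArg MatCube.mid h), fun Φ =>
    ⟨Φ.mid.app PUnit.unit PUnit.unit, MatCube.ext_pt (single_ext fun _ _ => rfl)⟩⟩

theorem embF_isFullInclusion : (embF.{u, v, w} C).toHColax.IsFullInclusion where
  obj_inj _ _ _ := Subsingleton.elim (α := Discrete PUnit) _ _
  hor_inj _ _ _ _ _ := rfl
  ver_inj _ _ _ _ _ := rfl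
  sq_inj _ _ _ _ _ _ h := singleSq_injective C h
  -- Any two endofunctions of the one-element set agree definitionally, so every one of them is the
  -- image of the only transversal arrow.
  map_bij _ _ := ⟨fun _ _ _ => Subsingleton.elim _ _, fun _ => ⟨eqToHom (Subsingleton.elim (α := Discrete PUnit) _ _), rfl⟩⟩
  horCell_bij _ _ := ⟨fun _ _ _ => rfl, fun _ => ⟨⟨⟩, rfl⟩⟩
  verCell_bij _ _ := ⟨fun _ _ _ => rfl, fun _ => ⟨⟨⟩, toPt_unique _ _⟩⟩
  cube_bij (X : C) (Y : C) := cubeTo_singleHom_bijective C X Y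

end EmbeddingLaws

/-! ### Sums of all entries of a matrix, and their behaviour under products. -/

section Sums

attribute [local instance] hasBinaryProducts_of_hasTerminal_and_pullbacks

variable {C : Type u} [Category.{v} C] [MonoidalCategory C] [HasTerminal C] [HasPullbacks C]
  [HasCoproducts.{w} C]
  [∀ (X : C) (J : Type w), PreservesColimitsOfShape (Discrete J) (tensorLeft X)]
  [∀ (X : C) (J : Type w), PreservesColimitsOfShape (Discrete J) (tensorRight X)]
  {A B D E A' B' D' A'' B'' : Type w} {M : A → B → C} {M' : A' → B' → C} {M'' : A'' → B'' → C}
  {N : B → D → C} {N' : B' → D' → C} {P : D → E → C}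

set_option linter.unusedSectionVars false

theorem total_ext {X : C} {f g : total M ⟶ X}
    (h : ∀ a b, totalIn M a b ≫ f = totalIn M a b ≫ g) : f = g :=
  Sigma.hom_ext _ _ fun p => h p.1 p.2

theorem totalIn_desc {X : C} (f : (a : A) → (b : B) → (M a b ⟶ X)) (a : A) (b : B) :
    totalIn M a b ≫ totalDesc f = f a b :=
  Sigma.ι_desc _ (a, b)

theorem totalIn_desc_assoc {X Y : C} (f : (a : A) → (b : B) → (M a b ⟶ X)) (a : A) (b : B)
    (g : X ⟶ Y) : totalIn M a b ≫ totalDesc f ≫ g = f a b ≫ g := by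
  rw [← Category.assoc, totalIn_desc]

theorem totalIn_map (φ : MatHom M M') (a : A) (b : B) :
    totalIn M a b ≫ totalMap φ = φ.app a b ≫ totalIn M' (φ.fst a) (φ.snd b) :=
  totalIn_desc _ a b

theorem totalIn_map_assoc (φ : MatHom M M') (a : A) (b : B) {X : C} (f : total M' ⟶ X) :
    totalIn M a b ≫ totalMap φ ≫ f = φ.app a b ≫ totalIn M' (φ.fst a) (φ.snd b) ≫ f := by
  rw [← Category.assoc, totalIn_map, Category.assoc]

theorem totalMap_id (M : A → B → C) : totalMap (MatHom.id M) = 𝟙 (total M) :=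
  total_ext fun a b => (totalIn_map _ a b).trans <|
    (Category.id_comp _).trans (Category.comp_id _).symm

theorem totalMap_comp (φ : MatHom M M') (ψ : MatHom M' M'') :
    totalMap (φ.comp ψ) = totalMap φ ≫ totalMap ψ :=
  total_ext fun a b => by
    rw [totalIn_map_assoc, totalIn_map, totalIn_map, ← Category.assoc]
    rfl

/-- The comparison from the sum of the entries of a product of matrices to the tensor product of
the sums of their entries. -/
noncomputable def totalMul (M : A → B → C) (N : B → D → C) :
    total (mulMat M N) ⟶ total M ⊗ total N :=
  totalDesc fun a d => mulDesc fun b => totalIn M a b ⊗ₘ totalIn N b d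

variable (C) in
/-- The codiagonal. -/
noncomputable def totalUnit (A : Type w) : total (unitMat C A) ⟶ 𝟙_ C :=
  totalDesc fun a a' => unitDesc a a' fun _ => 𝟙 (𝟙_ C)

theorem mulIn_totalMul (a : A) (b : B) (d : D) {X : C} (f : total M ⊗ total N ⟶ X) :
    mulIn M N a b d ≫ totalIn (mulMat M N) a d ≫ totalMul M N ≫ f =
      (totalIn M a b ⊗ₘ totalIn N b d) ≫ f := by
  rw [totalMul, totalIn_desc_assoc, mulIn_desc_assoc]

theorem unitIn_totalUnit (a : A) {X : C} (f : 𝟙_ C ⟶ X) :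
    unitIn (rfl : a = a) ≫ totalIn (unitMat C A) a a ≫ totalUnit C A ≫ f = f := by
  rw [totalUnit, totalIn_desc_assoc, unitIn_desc_assoc, Category.id_comp]

/-- Restricted to M_ab ⊗ N_bd, both sides are φ_ab ⊗ ψ_bd followed by the tensor product of the
injections of the target entries. -/
theorem totalMul_nat (φ : MatHom M M') (ψ : MatHom N N') (e : φ.snd = ψ.fst) :
    totalMap (mulHom φ ψ e) ≫ totalMul M' N' = totalMul M N ≫ (totalMap φ ⊗ₘ totalMap ψ) := by
  obtain ⟨f, g, x⟩ := φ
  obtain ⟨g', h, y⟩ := ψ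
  dsimp only at e
  -- The two middle index functions become equal by definition, so the transport inside `mulHom` is
  -- an identity.
  subst e
  refine total_ext fun a d => mul_ext fun b => ?_
  rw [mulIn_totalMul, totalIn_map_assoc, tensorHom_comp_tensorHom, totalIn_map, totalIn_map,
    ← tensorHom_comp_tensorHom]
  dsimp only [mulHom]
  rw [mulIn_desc_assoc, Category.assoc]
  have := mulIn_totalMul (M := M') (N := N') (f a) (g b) (h d) (𝟙 _)
  rw [Category.comp_id, Category.comp_id] at this
  rw [this, re_rfl, Category.comp_id]

/-- Off-diagonal entries vanish, and on the diagonal re-indexing permutes or merges copies of I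
without changing the codiagonal. -/
theorem totalUnit_nat (f : A → A') :
    totalMap (unitHom f) ≫ totalUnit C A' = totalUnit C A := by
  refine total_ext fun a a' => unit_ext fun e => ?_
  subst e
  have h₁ := unitIn_totalUnit (C := C) a (𝟙 _)
  have h₂ := unitIn_totalUnit (C := C) (f a) (𝟙 _)
  rw [Category.comp_id] at h₁ h₂
  rw [h₁, totalIn_map_assoc]
  dsimp only [unitHom]
  rw [unitIn_desc_assoc, h₂]

/-- On (M_ab ⊗ N_bd) ⊗ P_de this is naturality of the associator of `C` at three injections into
sums. -/
theorem totalMul_assoc (M : A → B → C) (N : B → D → C) (P : D → E → C) :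
    totalMul (mulMat M N) P ≫ (totalMul M N ⊗ₘ 𝟙 (total P)) ≫
        (α_ (total M) (total N) (total P)).hom =
      totalMap (assocMat M N P) ≫ totalMul M (mulMat N P) ≫ (𝟙 (total M) ⊗ₘ totalMul N P) := by
  refine total_ext fun a e => mulMul_ext fun b d => ?_
  rw [mulIn_totalMul, totalIn_map_assoc]
  dsimp only [assocMat]
  rw [mulIn_mulIn_assocApp, mulIn_totalMul, tensorHom_comp_tensorHom_assoc,
    tensorHom_comp_tensorHom, Category.comp_id, Category.comp_id]
  have h₁ := mulIn_totalMul (M := M) (N := N) a b d (𝟙 _)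
  have h₂ := mulIn_totalMul (M := N) (N := P) b d e (𝟙 _)
  rw [Category.comp_id, Category.comp_id] at h₁ h₂
  rw [whiskerRight_comp_tensorHom_assoc, whiskerLeft_comp_tensorHom, h₁, h₂,
    associator_naturality]

/-- Only the summand I ⊗ M_ab has to be considered, where the codiagonal is the identity and the
claim is naturality of the left unitor. -/
theorem totalMul_lam (M : A → B → C) :
    totalMul (unitMat C A) M ≫ (totalUnit C A ⊗ₘ 𝟙 (total M)) ≫ (λ_ (total M)).hom =
      totalMap (lamMat M) := by
  refine total_ext fun a b => unitMul_ext ?_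
  have h := unitIn_totalUnit (C := C) a (𝟙 _)
  rw [Category.comp_id] at h
  rw [mulIn_totalMul, totalIn_map]
  refine Eq.trans ?_ (unit_ι_lamApp M a b (totalIn M a b)).symm
  rw [tensorHom_comp_tensorHom_assoc, whiskerRight_comp_tensorHom_assoc, h, Category.comp_id,
    id_tensorHom, leftUnitor_naturality]

theorem totalMul_rho (M : A → B → C) :
    totalMul M (unitMat C B) ≫ (𝟙 (total M) ⊗ₘ totalUnit C B) ≫ (ρ_ (total M)).hom =
      totalMap (rhoMat M) := by
  refine total_ext fun a b => mulUnit_ext ?_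
  have h := unitIn_totalUnit (C := C) b (𝟙 _)
  rw [Category.comp_id] at h
  rw [mulIn_totalMul, totalIn_map]
  refine Eq.trans ?_ (unit_ι_rhoApp M a b (totalIn M a b)).symm
  rw [tensorHom_comp_tensorHom_assoc, whiskerLeft_comp_tensorHom_assoc, h, Category.comp_id,
    tensorHom_id, rightUnitor_naturality]

end Sums


open MatHom

/-! ### G is a colax-colax morphism. -/

section SumLaws

attribute [local instance] hasBinaryProducts_of_hasTerminal_and_pullbacks

variable {C : Type u} [Category.{v} C] [MonoidalCategory C] [HasTerminal C] [HasPullbacks C]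
  [HasCoproducts.{w} C]
  [∀ (X : C) (J : Type w), PreservesColimitsOfShape (Discrete J) (tensorLeft X)]
  [∀ (X : C) (J : Type w), PreservesColimitsOfShape (Discrete J) (tensorRight X)]
  {A B D E A₁ B₁ D₁ E₁ A₂ B₂ D₂ : Type w} {A' B' D' A₁' B₁' D₁' : Type w}
  {h : Spn A B} {k : Spn B D} {l : Spn D E} {h₁ : Spn A₁ B₁} {k₁ : Spn B₁ D₁} {l₁ : Spn D₁ E₁}
  {h₂ : Spn A₂ B₂} {k₂ : Spn B₂ D₂}
  {h' : Spn A' B'} {k' : Spn B' D'} {h₁' : Spn A₁' B₁'} {k₁' : Spn B₁' D₁'}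
  {x : A → A₁ → C} {y : B → B₁ → C} {z : D → D₁ → C} {t : E → E₁ → C}
  {x₁ : A₁ → A₂ → C} {y₁ : B₁ → B₂ → C} {z₁ : D₁ → D₂ → C}
  {x' : A' → A₁' → C} {y' : B' → B₁' → C} {z' : D' → D₁' → C}

set_option linter.unusedSectionVars false

/-- The comparison from the sum of the entries of a horizontal composite to the product of the
sums of the entries. -/
noncomputable def totalProd (α : MatSq h h₁ x y) (β : MatSq k k₁ y z) :
    total (α.hmul β).mat ⟶ total α.mat ⨯ total β.mat :=
  prod.lift (totalMap (α.p₁ β)) (totalMap (α.p₂ β))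

theorem totalProd_fst (α : MatSq h h₁ x y) (β : MatSq k k₁ y z) :
    totalProd α β ≫ prod.fst = totalMap (α.p₁ β) :=
  prod.lift_fst _ _

theorem totalProd_snd (α : MatSq h h₁ x y) (β : MatSq k k₁ y z) :
    totalProd α β ≫ prod.snd = totalMap (α.p₂ β) :=
  prod.lift_snd _ _

theorem totalProd_nat {α : MatSq h h₁ x y} {β : MatSq k k₁ y z} {α' : MatSq h' h₁' x' y'}
    {β' : MatSq k' k₁' y' z'} (Φ : MatCube α α') (Ψ : MatCube β β') (e : Φ.right = Ψ.left) :
    totalMap (Φ.hmul Ψ e).mid ≫ totalProd α' β' =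
      totalProd α β ≫ prod.map (totalMap Φ.mid) (totalMap Ψ.mid) := by
  apply Limits.prod.hom_ext
  · rw [Category.assoc, Category.assoc, totalProd_fst, prod.map_fst, ← Category.assoc,
      totalProd_fst, ← totalMap_comp, ← totalMap_comp, MatCube.hmul_p₁]
  · rw [Category.assoc, Category.assoc, totalProd_snd, prod.map_snd, ← Category.assoc,
      totalProd_snd, ← totalMap_comp, ← totalMap_comp, MatCube.hmul_p₂]

/-- Functoriality of `totalMap` transports the equations for the projections of pullbacks of
matrices to equations for products in `C`. -/
theorem totalProd_assoc (α : MatSq h h₁ x y) (β : MatSq k k₁ y z) (γ : MatSq l l₁ z t) :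
    totalProd (α.hmul β) γ ≫ prod.map (totalProd α β) (𝟙 (total γ.mat)) ≫
        (Limits.prod.associator (total α.mat) (total β.mat) (total γ.mat)).hom =
      totalMap (α.hassoc β γ).mid ≫ totalProd α (β.hmul γ) ≫
        prod.map (𝟙 (total α.mat)) (totalProd β γ) := by
  refine Limits.prod.hom_ext ?_ (Limits.prod.hom_ext ?_ ?_)
  · simp only [Category.assoc, Limits.prod.associator_hom, prod.lift_fst, prod.map_fst,
      prod.map_fst_assoc, Category.comp_id, totalProd_fst]
    rw [← Category.assoc, totalProd_fst, ← totalMap_comp, ← totalMap_comp, MatSq.hassoc_p₁]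
  · simp only [Category.assoc, Limits.prod.associator_hom, prod.lift_fst, prod.lift_snd_assoc,
      prod.map_fst_assoc, prod.map_snd_assoc, totalProd_fst, totalProd_snd]
    rw [← Category.assoc, totalProd_fst, ← Category.assoc (totalProd α (β.hmul γ)), totalProd_snd,
      ← totalMap_comp, ← totalMap_comp, ← totalMap_comp, MatSq.hassoc_p₂_p₁]
  · simp only [Category.assoc, Limits.prod.associator_hom, prod.lift_snd,
      prod.map_snd, totalProd_snd, Category.comp_id]
    rw [← Category.assoc (totalProd α (β.hmul γ)), totalProd_snd,
      ← totalMap_comp, ← totalMap_comp, MatSq.hassoc_p₂_p₂]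

/-- The map `f` may be arbitrary, since the projection that follows discards its factor; in the
application it is the map to the terminal object. -/
theorem totalProd_lam (α : MatSq h h₁ x y) {X : C} (f : total (MatSq.hunit x).mat ⟶ X) :
    totalProd (MatSq.hunit x) α ≫ prod.map f (𝟙 (total α.mat)) ≫ prod.snd =
      totalMap α.hlam.mid := by
  rw [prod.map_snd, Category.comp_id, totalProd_snd]
  rfl

theorem totalProd_rho (α : MatSq h h₁ x y) {X : C} (f : total (MatSq.hunit y).mat ⟶ X) :
    totalProd α (MatSq.hunit y) ≫ prod.map (𝟙 (total α.mat)) f ≫ prod.fst =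
      totalMap α.hrho.mid := by
  rw [prod.map_fst, Category.comp_id, totalProd_fst]
  rfl

/-- The common form of three verifications: compatibility of G with χ and δ, and horizontal
coherence of α. Each is reduced to two equations about the projections of the pullback. -/
theorem totalMap_totalProd_map {X₀ Y₀ : Type w} {Q : X₀ → Y₀ → C} (α : MatSq h h₁ x y)
    (β : MatSq k k₁ y z) (φ : MatHom Q (α.hmul β).mat) {X Y : C} {f : total α.mat ⟶ X}
    {g : total β.mat ⟶ Y} {u : total Q ⟶ X ⨯ Y}
    (e₁ : totalMap (φ.comp (α.p₁ β)) ≫ f = u ≫ prod.fst)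
    (e₂ : totalMap (φ.comp (α.p₂ β)) ≫ g = u ≫ prod.snd) :
    totalMap φ ≫ totalProd α β ≫ prod.map f g = u := by
  rw [totalMap_comp, Category.assoc] at e₁ e₂
  apply Limits.prod.hom_ext
  · rw [← e₁, Category.assoc, Category.assoc, prod.map_fst, ← Category.assoc (totalProd α β),
      totalProd_fst]
  · rw [← e₂, Category.assoc, Category.assoc, prod.map_snd, ← Category.assoc (totalProd α β),
      totalProd_snd]

/-- Componentwise, χ becomes a product of projections, and what is left is naturality of `totalMul`
at these projections. -/
theorem totalMap_chi (α : MatSq h h₁ x y) (β : MatSq k k₁ y z) (α₁ : MatSq h₁ h₂ x₁ y₁)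
    (β₁ : MatSq k₁ k₂ y₁ z₁) :
    totalMap (α.chi β α₁ β₁).mid ≫ totalProd (α.vmul α₁) (β.vmul β₁) ≫
        prod.map (totalMul α.mat α₁.mat) (totalMul β.mat β₁.mat) =
      totalMul (α.hmul β).mat (α₁.hmul β₁).mat ≫ (totalProd α β ⊗ₘ totalProd α₁ β₁) ≫
        interchange _ _ _ _ := by
  refine totalMap_totalProd_map _ _ _ ?_ ?_
  · refine (congrArg (fun ξ => totalMap ξ ≫ totalMul α.mat α₁.mat)
      (MatSq.chi_p₁ α β α₁ β₁)).trans ((totalMul_nat (α.p₁ β) (α₁.p₁ β₁) rfl).trans (Eq.symm ?_))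
    refine (Category.assoc _ _ _).trans (congrArg _ ((Category.assoc _ _ _).trans
      ((congrArg _ (prod.lift_fst _ _)).trans ((tensorHom_comp_tensorHom _ _ _ _).trans ?_))))
    rw [totalProd_fst, totalProd_fst]
  · refine (congrArg (fun ξ => totalMap ξ ≫ totalMul β.mat β₁.mat)
      (MatSq.chi_p₂ α β α₁ β₁)).trans ((totalMul_nat (α.p₂ β) (α₁.p₂ β₁) rfl).trans (Eq.symm ?_))
    refine (Category.assoc _ _ _).trans (congrArg _ ((Category.assoc _ _ _).trans
      ((congrArg _ (prod.lift_snd _ _)).trans ((tensorHom_comp_tensorHom _ _ _ _).trans ?_))))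
    rw [totalProd_snd, totalProd_snd]

/-- Each component says that the codiagonal is unchanged by re-indexing along a projection of the
pullback of index sets. The identity on the right is the vertical identity cube on a trivial cell.
-/
theorem totalMap_delta (h : Spn A B) (k : Spn B D) :
    totalMap (MatSq.delta C h k).mid ≫ totalProd (MatSq.vunit C h) (MatSq.vunit C k) ≫
        prod.map (totalUnit C h.apex) (totalUnit C k.apex) =
      totalUnit C (h.mul k).apex ≫ 𝟙 _ ≫ prod.lift (𝟙 (𝟙_ C)) (𝟙 (𝟙_ C)) := by
  refine totalMap_totalProd_map _ _ _ ?_ ?_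
  · exact (congrArg (fun ξ => totalMap ξ ≫ totalUnit C h.apex)
      (MatSq.delta_p₁ h k)).trans ((totalUnit_nat _).trans (((Category.assoc _ _ _).trans
        ((congrArg _ ((Category.assoc _ _ _).trans ((congrArg _ (prod.lift_fst _ _)).trans
          (Category.comp_id _)))).trans (Category.comp_id _))).symm))
  · exact (congrArg (fun ξ => totalMap ξ ≫ totalUnit C k.apex)
      (MatSq.delta_p₂ h k)).trans ((totalUnit_nat _).trans (((Category.assoc _ _ _).trans
        ((congrArg _ ((Category.assoc _ _ _).trans ((congrArg _ (prod.lift_snd _ _)).trans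
          (Category.comp_id _)))).trans (Category.comp_id _))).symm))

variable (C)

theorem sumG_isSqColax_hsc : IsSqColax (sumG.{u, v, w} C).hsc where
  faces_mul _ _ := ⟨rfl, rfl, rfl, rfl⟩
  faces_unit _ := ⟨rfl, rfl, rfl, rfl⟩
  mul_nat Φ Ψ e _ := totalProd_nat Φ Ψ e
  unit_nat _ := terminal.hom_ext _ _
  assoc α β γ _ _ := totalProd_assoc α β γ
  lam α _ := totalProd_lam α _
  rho α _ := totalProd_rho α _

theorem sumG_isSqColax_vsc : IsSqColax (sumG.{u, v, w} C).vsc where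
  faces_mul _ _ := ⟨rfl, rfl, rfl, rfl⟩
  faces_unit _ := ⟨rfl, rfl, rfl, rfl⟩
  mul_nat Φ Ψ e _ := totalMul_nat (MatCube.mid Φ) (MatCube.mid Ψ) (congrArg SpnHom.mid e)
  unit_nat φ := (totalUnit_nat (C := C) (SpnHom.mid φ)).trans (Category.comp_id _).symm
  assoc α β γ _ _ := totalMul_assoc (MatSq.mat α) (MatSq.mat β) (MatSq.mat γ)
  lam α _ := totalMul_lam (MatSq.mat α)
  rho α _ := totalMul_rho (MatSq.mat α)

theorem isColax_of_trivDbl {O : Type u₁} [Category.{v₁} O] {D : DblData.{u₁, v₁, u₂, v₂} O}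
    {T : O ⥤ Discrete PUnit.{1}} {m : ArMap D trivDbl T} (c : ColaxData m) : IsColax c where
  dom_mul _ _ := Subsingleton.elim _ _
  cod_mul _ _ := Subsingleton.elim _ _
  dom_unit _ := Subsingleton.elim _ _
  cod_unit _ := Subsingleton.elim _ _
  mul_nat _ _ _ _ := rfl
  unit_nat _ := rfl
  assoc _ _ _ _ _ := rfl
  lam _ _ := rfl
  rho _ _ := rfl

theorem isArMap_of_trivDbl {O : Type u₁} [Category.{v₁} O] {D : DblData.{u₁, v₁, u₂, v₂} O}
    {T : O ⥤ Discrete PUnit.{1}} (m : ArMap D trivDbl T) : IsArMap m where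
  dom_cell _ := Subsingleton.elim _ _
  cod_cell _ := Subsingleton.elim _ _
  cell_one _ := rfl
  cell_comp _ _ := rfl

theorem sumG_isHColax : (sumG.{u, v, w} C).toHColax.IsHColax where
  isH := isArMap_of_trivDbl _
  isV := isArMap_of_trivDbl _
  isS :=
    { faces_cube := fun _ => ⟨rfl, rfl, rfl, rfl⟩
      cube_one := fun α => totalMap_id (MatSq.mat α)
      cube_comp := fun Φ Ψ => totalMap_comp (MatCube.mid Φ) (MatCube.mid Ψ) }
  isColaxH := isColax_of_trivDbl _
  isColaxHS := sumG_isSqColax_hsc C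

theorem sumG_isColaxColax : (sumG.{u, v, w} C).IsColaxColax where
  isHColax := sumG_isHColax C
  isColaxV := isColax_of_trivDbl _
  isColaxVS := sumG_isSqColax_vsc C
  chi α β α₁ β₁ _ _ := totalMap_chi α β α₁ β₁
  mu _ _ _ := terminal.hom_ext _ _
  delta h k _ := totalMap_delta h k
  tau _ := terminal.hom_ext _ _

end SumLaws

/-! ### The double cells α and β, and the triangle equalities. -/

section Cells

attribute [local instance] hasBinaryProducts_of_hasTerminal_and_pullbacks

variable {C : Type u} [Category.{v} C] [MonoidalCategory C] [HasTerminal C] [HasPullbacks C]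
  [HasCoproducts.{w} C]
  [∀ (X : C) (J : Type w), PreservesColimitsOfShape (Discrete J) (tensorLeft X)]
  [∀ (X : C) (J : Type w), PreservesColimitsOfShape (Discrete J) (tensorRight X)]
  {A B D A₁ B₁ D₁ A₂ B₂ A' B' : Type w} {M : A → B → C} {M' : A' → B' → C} {N : B → D → C}
  {h : Spn A B} {k : Spn B D} {h₁ : Spn A₁ B₁} {k₁ : Spn B₁ D₁} {h₂ : Spn A₂ B₂}
  {x : A → A₁ → C} {y : B → B₁ → C} {z : D → D₁ → C} {x₁ : A₁ → A₂ → C} {y₁ : B₁ → B₂ → C}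

set_option linter.unusedSectionVars false

/-- The identification of the sum of the only entry of a `1 × 1` matrix with this entry. -/
noncomputable def collapse (X : C) : total (single.{u, w} X) ⟶ X :=
  totalDesc fun _ _ => 𝟙 X

theorem totalIn_collapse (X : C) (a b : pt.{w}) {Y : C} (f : X ⟶ Y) :
    totalIn (single.{u, w} X) a b ≫ collapse X ≫ f = f :=
  (totalIn_desc_assoc _ _ _ _).trans (Category.id_comp _)

theorem totalIn_collapse_self (X : C) (a b : pt.{w}) :
    totalIn (single.{u, w} X) a b ≫ collapse X = 𝟙 X :=
  totalIn_desc _ _ _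

/-- A morphism from `M` to [X] is a cocone; summing it and collapsing gives the map induced on the
coproduct. This is one direction of the adjunction between sums and 1 × 1 matrices. -/
theorem totalMap_collapse {X : C} (φ : MatHom M (single.{u, w} X)) (a : A) (b : B) :
    totalIn M a b ≫ totalMap φ ≫ collapse X = φ.app a b :=
  (totalIn_map_assoc _ _ _ _).trans <|
    (congrArg _ (totalIn_collapse_self X _ _)).trans (Category.comp_id _)

theorem collapse_totalIn (X : C) (a b : pt.{w}) :
    collapse.{u, v, w} X ≫ totalIn (single X) a b = 𝟙 _ :=
  total_ext fun _ _ => (totalIn_collapse X _ _ _).trans (Category.comp_id _).symm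

theorem collapse_nat {X Y : C} (f : X ⟶ Y) :
    totalMap (singleHom.{u, v, w} f) ≫ collapse Y = collapse X ≫ f :=
  total_ext fun a b => (totalMap_collapse _ a b).trans (totalIn_collapse X a b f).symm

/-- The matrix of the injections into the sum of all entries. -/
noncomputable def totalCone (M : A → B → C) : MatHom M (single.{u, w} (total M)) :=
  ⟨fun _ => ⟨⟩, fun _ => ⟨⟩, fun s t => totalIn M s t⟩

theorem totalCone_nat (φ : MatHom M M') :
    φ.comp (totalCone M') = (totalCone M).comp (singleHom (totalMap φ)) :=
  single_ext fun a b => (totalIn_map φ a b).symm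

/-- The map induced by the injections is the identity. This is the triangle equality for G at basic
cells. -/
theorem totalMap_totalCone (M : A → B → C) : totalMap (totalCone M) ≫ collapse _ = 𝟙 (total M) :=
  total_ext fun a b => (totalMap_collapse _ a b).trans (Category.comp_id _).symm

/-- Vertical coherence of β: on M_ab ⊗ N_bd both sides are the tensor product of the two injections.
-/
theorem totalCone_mul (M : A → B → C) (N : B → D → C) :
    (totalCone (mulMat M N)).comp (singleHom (totalMul M N)) =
      (mulHom (totalCone M) (totalCone N) rfl).comp (singleMul (total M) (total N)) := by
  refine single_ext fun a d => mul_ext fun b => ?_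
  have h₁ := mulIn_totalMul (M := M) (N := N) a b d (𝟙 _)
  rw [Category.comp_id, Category.comp_id] at h₁
  refine h₁.trans (Eq.symm ((mulIn_desc_assoc _ _ _).trans ?_))
  refine (Category.assoc _ _ _).trans ?_
  refine (congrArg _ (mulIn_desc _ _)).trans ((Category.comp_id _).trans ?_)
  exact congrArg _ (Category.comp_id _)

/-- Only diagonal entries matter, and on those both sides restrict to the identity of I. -/
theorem totalCone_unit (A : Type w) :
    (totalCone (unitMat C A)).comp (singleHom (totalUnit C A)) =
      (unitHom fun _ => PUnit.unit).comp (singleUnit C) := by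
  refine single_ext fun a a' => unit_ext fun e => ?_
  subst e
  have h₁ := unitIn_totalUnit (C := C) a (𝟙 _)
  rw [Category.comp_id] at h₁
  exact h₁.trans ((unitIn_desc_assoc (rfl : a = a)
    (fun h => unitIn (congrArg (fun _ : A => PUnit.unit.{w + 1}) h))
    (unitDesc PUnit.unit PUnit.unit fun _ => 𝟙 (𝟙_ C))).trans
      (unitIn_desc (rfl : PUnit.unit.{w + 1} = PUnit.unit) fun _ => 𝟙 (𝟙_ C))).symm

/-- The components of `cellβ` at basic cells. -/
noncomputable abbrev sqCone (α : MatSq h h₁ x y) : MatCube α (singleSq.{u, v, w} (total α.mat)) :=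
  cubeTo α (total α.mat) (totalCone α.mat)

/-- Horizontal coherence of β: after a projection it is naturality of the cone of injections at that
projection. The two identity cubes on the left are the horizontal comparisons of identity morphisms
of intercategories. -/
theorem sqCone_hmul (α : MatSq h h₁ x y) (β : MatSq k k₁ y z)
    (e : (sqCone α).right = (sqCone β).left) :
    (MatCube.one (α.hmul β)).comp ((MatCube.one (α.hmul β)).comp ((sqCone α).hmul (sqCone β) e)) =
      (sqCone (α.hmul β)).comp ((cubeTo (singleSq _) _ (singleHom (totalProd α β))).comp
        (singleProd (total α.mat) (total β.mat))) := by
  refine MatCube.ext_pt (Eq.trans ((MatHom.id_comp _).trans (MatHom.id_comp _))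
    (MatSq.lift_ext ?_ ?_))
  · refine (MatCube.hmul_p₁ _ _ e).trans (Eq.symm ?_)
    refine (MatHom.comp_assoc _ _ _).trans ((congrArg _ ((MatHom.comp_assoc _ _ _).trans
      (congrArg _ (singleProd_p₁ _ _)))).trans ?_)
    refine (congrArg (fun f => (totalCone _).comp (singleHom f)) (totalProd_fst α β)).trans ?_
    exact (totalCone_nat _).symm
  · refine (MatCube.hmul_p₂ _ _ e).trans (Eq.symm ?_)
    refine (MatHom.comp_assoc _ _ _).trans ((congrArg _ ((MatHom.comp_assoc _ _ _).trans
      (congrArg _ (singleProd_p₂ _ _)))).trans ?_)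
    refine (congrArg (fun f => (totalCone _).comp (singleHom f)) (totalProd_snd α β)).trans ?_
    exact (totalCone_nat _).symm

theorem collapse_hmul (X Y : C) :
    totalMap (singleProd.{u, v, w} X Y).mid ≫ totalProd (singleSq X) (singleSq Y) ≫
        prod.map (collapse X) (collapse Y) = collapse (X ⨯ Y) := by
  refine totalMap_totalProd_map _ _ _ ?_ ?_
  · rw [singleProd_p₁]
    exact collapse_nat _
  · rw [singleProd_p₂]
    exact collapse_nat _

/-- All sums involved have a single term; on it both sides are the identity of X ⊗ Y. -/
theorem collapse_vmul (X Y : C) :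
    totalMap (singleMul.{u, v, w} X Y) ≫ collapse (X ⊗ Y) =
      totalMul (single X) (single Y) ≫ (collapse X ⊗ₘ collapse Y) := by
  refine total_ext fun a d => (totalMap_collapse _ a d).trans (mul_ext fun b => ?_)
  refine (mulIn_desc _ _).trans (Eq.symm ((mulIn_totalMul _ _ _ _).trans ?_))
  refine (tensorHom_comp_tensorHom _ _ _ _).trans ?_
  rw [totalIn_collapse_self, totalIn_collapse_self]
  exact id_tensorHom_id _ _

theorem collapse_vunit :
    totalMap (singleUnit.{u, v, w} C) ≫ collapse (𝟙_ C) = totalUnit C pt :=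
  total_ext fun a a' => (totalMap_collapse _ a a').trans (totalIn_desc _ a a').symm

variable (C)

theorem cellα_isDblCell : (cellα.{u, v, w} C).IsDblCell where
  dom_hor _ := Subsingleton.elim _ _
  cod_hor _ := Subsingleton.elim _ _
  dom_ver _ := Subsingleton.elim _ _
  cod_ver _ := Subsingleton.elim _ _
  faces_sq _ := ⟨rfl, rfl, rfl, rfl⟩
  ob_nat _ := Subsingleton.elim _ _
  hor_nat _ := rfl
  ver_nat _ := rfl
  sq_nat f := collapse_nat (C := C) f
  hor_mul _ _ _ := rfl
  hor_unit _ := rfl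
  -- The comparisons of the identity morphism of intercategories are identities; in this and the two
  -- vertical laws for basic cells below they are cancelled.
  sq_hmul (X : C) (Y : C) _ := (collapse_hmul X Y).trans
    ((congrArg _ (Category.comp_id _)).trans (Category.comp_id _)).symm
  sq_hunit _ := terminal.hom_ext _ _
  ver_mul _ _ _ := rfl
  ver_unit _ := rfl
  sq_vmul (X : C) (Y : C) _ := (congrArg _ (Category.comp_id _)).trans ((collapse_vmul X Y).trans
    (congrArg _ (Category.comp_id _)).symm)
  sq_vunit _ := (congrArg _ (Category.comp_id _)).trans (collapse_vunit.trans
    ((congrArg _ (Category.comp_id _)).trans (Category.comp_id _)).symm)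

/-- Everything except the middle components takes values in terminal objects, spans or matrices, so
only the four laws for basic cells other than `sq_hunit` and `faces_sq` have content. -/
theorem cellβ_isDblCell : (cellβ.{u, v, w} C).IsDblCell where
  dom_hor _ := rfl
  cod_hor _ := rfl
  dom_ver _ := rfl
  cod_ver _ := rfl
  faces_sq _ := ⟨rfl, rfl, rfl, rfl⟩
  ob_nat _ := rfl
  hor_nat _ := rfl
  ver_nat _ := toPt_unique _ _
  sq_nat Φ := MatCube.ext_pt (totalCone_nat (MatCube.mid Φ))
  hor_mul _ _ _ := rfl
  hor_unit _ := rfl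
  sq_hmul α β e := sqCone_hmul α β e
  sq_hunit _ := MatCube.ext (toPt_unique _ _) (toPt_unique _ _) (toPt_unique _ _)
  ver_mul _ _ _ := toPt_unique _ _
  ver_unit _ := toPt_unique _ _
  sq_vmul α β _ := MatCube.ext_pt ((MatHom.id_comp _).trans
    ((totalCone_mul (MatSq.mat α) (MatSq.mat β)).trans (MatHom.id_comp _).symm))
  sq_vunit h := MatCube.ext_pt ((MatHom.id_comp _).trans
    ((totalCone_unit (C := C) (Spn.apex h)).trans (MatHom.id_comp _).symm))

theorem cellα_isInv : (cellα.{u, v, w} C).IsInv where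
  ob _ := ⟨eqToHom (Subsingleton.elim (α := Discrete PUnit.{1}) _ _), Subsingleton.elim _ _,
    Subsingleton.elim _ _⟩
  hor _ := ⟨⟨⟩, rfl, rfl⟩
  ver _ := ⟨⟨⟩, rfl, rfl⟩
  sq (X : C) := ⟨totalIn (single X) PUnit.unit PUnit.unit, collapse_totalIn X _ _,
    totalIn_collapse_self X _ _⟩

/-- The triangle equalities have content only at basic cells. For F it is that the injection into a
one-term sum is a section of the collapse, for G that the injections induce the identity. -/
theorem isConjoint_embF_sumG :
    IsConjoint (embF.{u, v, w} C) (sumG.{u, v, w} C) (cellα.{u, v, w} C) (cellβ.{u, v, w} C) where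
  isColaxLax := embF_isColaxLax C
  isColaxColax := sumG_isColaxColax C
  isDblCell_α := cellα_isDblCell C
  isDblCell_β := cellβ_isDblCell C
  h_ob _ := rfl
  h_hor _ := rfl
  h_ver _ := toPt_unique _ _
  h_sq (X : C) := MatCube.ext_pt (single_ext fun a b => totalIn_collapse_self X a b)
  v_ob _ := Subsingleton.elim _ _
  v_hor _ := rfl
  v_ver _ := rfl
  v_sq σ := totalMap_totalCone (MatSq.mat σ)

end Cells

end Intercat

theorem mainTheorem7 {C : Type u} [Category.{v} C] [MonoidalCategory C] [HasCoproducts.{w} C]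
    [∀ (X : C) (J : Type w), PreservesColimitsOfShape (Discrete J) (tensorLeft X)]
    [∀ (X : C) (J : Type w), PreservesColimitsOfShape (Discrete J) (tensorRight X)]
    [HasPullbacks C] [HasTerminal C] :
    (Intercat.prodTensor C).IsIntercategory ∧
    (Intercat.SM.{u, v, w} C).IsIntercategory ∧
    (Intercat.embF.{u, v, w} C).IsColaxLax ∧
    (Intercat.embF.{u, v, w} C).toHColax.IsStrong ∧
    (Intercat.embF.{u, v, w} C).toHColax.IsFullInclusion ∧
    (Intercat.sumG.{u, v, w} C).IsColaxColax ∧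
    Intercat.IsConjoint (Intercat.embF.{u, v, w} C) (Intercat.sumG.{u, v, w} C)
      (Intercat.cellα.{u, v, w} C) (Intercat.cellβ.{u, v, w} C) ∧
    (Intercat.cellα.{u, v, w} C).IsInv :=
  ⟨Intercat.prodTensor_isIntercategory C, Intercat.SM_isIntercategory C,
    Intercat.embF_isColaxLax C, Intercat.embF_isStrong C, Intercat.embF_isFullInclusion C,
    Intercat.sumG_isColaxColax C, Intercat.isConjoint_embF_sumG C, Intercat.cellα_isInv C⟩
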